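/- **Theorem (Main).** Linear programming problems with gainfree Leontief substitution systems admit a combinatorial $O(m^3n)$-time certifying algorithm. In detail: *The problem.* Let $m,n\ge 1$, $A\in\mathbb R^{m\times n}$, $b\in\mathbb R^m$, $c\in\mathbb R^n$. Consider the primal problem $$\min\ c^Tx\quad\text{s.t. } Ax=b,\ x\ge 0, \tag{P}$$ and its dual $$\max\ y^Tb\quad\text{s.t. } y^TA\le c^T,\ y\in\mathbb R^m. \tag{D}$$ Assume that $b\ge 0$, that $A$ is *Leontief*, i.e. each column of $A$ has at most one positive entry, normalized so that every positive entry of $A$ equals $1$, and that $A$ is *gainfree*, in the following sense. Associate with $A$ the directed hypergraph with vertices $v_1,\dots,v_m$ (the rows) and hyperarcs $E_1,\dots,E_n$ (the columns), where $E_j$ has head set $\{v_i: A_{ij}=1\}$ (at most one vertex), tail set $T(E_j)=\{v_i:A_{ij}<0\}$, and weights $\gamma(E_j,v_i)=-A_{ij}>0$ for $v_i\in T(E_j)$. A directed cycle is a sequence $u_1F_1u_2F_2\cdots F_ku_{k+1}$ with $k\ge1$, $u_{k+1}=u_1$, where $u_1,\dots,u_k$ are distinct vertices, $F_1,\dots,F_k$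 are distinct hyperarcs, $u_{l+1}$ is the head of $F_l$ and $u_l\in T(F_l)$; its gain is $1/\prod_{l=1}^k\gamma(F_l,u_l)$. $A$ is gainfree if every directed cycle has gain at most $1$. *The algorithms.* A combinatorial algorithm is a program (with branching and loops) of a random access machine with real memory cells, whose only operations on real numbers are additions, subtractions, multiplications and comparisons, with only the real constants $0$ and $1$; integers are used for indexing only, with additions, truncated subtractions and comparisons. Every elementary operation takes one unit of time. Since division is not available, dual solutions $y$ are output as fractions $y=p/q$, with a vector $p\in\mathbb R^m$ of numerators and a common denominator $q>0$; all other vectors are output directly. *The claim.* There are a single combinatorial algorithm and a constant $K$ such that for all $m,n\ge1$ and all $A,b,c$ as above, the algorithm, given $m,n,A,b,c$, halts after at most $K\,m^3n$ steps and outputs which of the following four cases holds, together with the certificate listed for it: 1. (P) and (D) have feasible solutions with equal objective values; certificate: a feasible solution $x$ of (P) and a feasible solution $y$ of (D) with $c^Tx=y^Tb$. 2. (P) is infeasible, and (D) is feasible and unbounded; certificate: a Farkas certificate $z\in\mathbb R^m$ of primal infeasibility, i.e. $z^TA\le 0$ and $z^Tb>0$, and a feasible solution $y$ of (D). 3. (P)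 is feasible and unbounded, and (D) is infeasible; certificate: a feasible solution $x$ of (P) and a Farkas certificate $r\in\mathbb R^n$ of dual infeasibility, i.e. $Ar=0$, $c^Tr<0$ and $r\ge0$. 4. (P) and (D) are both infeasible; certificate: Farkas certificates $z$ and $r$ as in cases 2 and 3. -/

import Mathlib

open scoped Matrix

/-! ### Leontief matrices, associated hypergraphs, gainfreeness -/

/-- Every column of `A` has at most one positive entry. -/
def IsLeontief {m n : ℕ} (A : Matrix (Fin m) (Fin n) ℝ) : Prop :=
  ∀ (j : Fin n) (i i' : Fin m), 0 < A i j → 0 < A i' j → i = i'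

/-- The usual normalization of Leontief matrices: all positive entries are ones. -/
def HasUnitPositiveEntries {m n : ℕ} (A : Matrix (Fin m) (Fin n) ℝ) : Prop :=
  ∀ (i : Fin m) (j : Fin n), 0 < A i j → A i j = 1

/-- A directed hypergraph with vertex set `V` and hyperarcs indexed by `E`, together with a
weight `weight e v` for each hyperarc `e` and each vertex `v` of its tail (the values of `weight`
at vertices outside the tail are irrelevant). -/
structure DirectedHypergraph (V E : Type) where
  head : E → Set V
  tail : E → Set V
  disjoint_head_tail : ∀ e, Disjoint (head e) (tail e)
  weight : E → V → ℝ

/-- The hypergraph of a (normalized) Leontief matrix: vertices are rows, hyperarcs are columns. -/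
def associatedHypergraph {m n : ℕ} (A : Matrix (Fin m) (Fin n) ℝ) :
    DirectedHypergraph (Fin m) (Fin n) where
  head j := {i | A i j = 1}
  tail j := {i | A i j < 0}
  disjoint_head_tail j := by
    rw [Set.disjoint_left]
    intro i h1 h2
    have h1' : A i j = 1 := h1
    have h2' : A i j < 0 := h2
    linarith
  weight j i := -A i j

/-- A directed cycle `v₀ e₀ v₁ e₁ … e_{k-1} v_k`, `v_k = v₀`, `k ≥ 1`, without repeated vertices
(apart from `v_k = v₀`) or hyperarcs: `eᵢ` has head `vᵢ₊₁`, and `vᵢ` is in the tail of `eᵢ`. -/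
structure DirectedHypergraph.DirectedCycle {V E : Type} (H : DirectedHypergraph V E) where
  length : ℕ
  length_pos : 0 < length
  vertex : Fin (length + 1) → V
  arc : Fin length → E
  closed : vertex 0 = vertex (Fin.last length)
  vertex_injective : Function.Injective (fun i : Fin length => vertex i.castSucc)
  arc_injective : Function.Injective arc
  head_eq : ∀ i : Fin length, H.head (arc i) = {vertex i.succ}
  mem_tail : ∀ i : Fin length, vertex i.castSucc ∈ H.tail (arc i)

/-- The gain of a directed cycle. -/
noncomputable def DirectedHypergraph.DirectedCycle.gain {V E : Type} {H : DirectedHypergraph V E}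
    (C : H.DirectedCycle) : ℝ :=
  1 / ∏ i : Fin C.length, H.weight (C.arc i) (C.vertex i.castSucc)

/-- Every directed cycle of the associated hypergraph has gain at most one. -/
def IsGainfree {m n : ℕ} (A : Matrix (Fin m) (Fin n) ℝ) : Prop :=
  ∀ C : (associatedHypergraph A).DirectedCycle, C.gain ≤ 1

/-! ### The linear program `min cᵀx, Ax = b, x ≥ 0`, its dual `max yᵀb, yᵀA ≤ cᵀ`, certificates -/

/-- `x` is a feasible solution of the primal problem. -/
def PrimalFeasible {m n : ℕ} (A : Matrix (Fin m) (Fin n) ℝ) (b : Fin m → ℝ)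
    (x : Fin n → ℝ) : Prop :=
  A *ᵥ x = b ∧ 0 ≤ x

/-- `y` is a feasible solution of the dual problem. -/
def DualFeasible {m n : ℕ} (A : Matrix (Fin m) (Fin n) ℝ) (c : Fin n → ℝ)
    (y : Fin m → ℝ) : Prop :=
  y ᵥ* A ≤ c

/-- `z` is a Farkas certificate of infeasibility of the primal problem. -/
def PrimalFarkasCertificate {m n : ℕ} (A : Matrix (Fin m) (Fin n) ℝ) (b : Fin m → ℝ)
    (z : Fin m → ℝ) : Prop :=
  z ᵥ* A ≤ 0 ∧ 0 < z ⬝ᵥ b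

/-- `r` is a Farkas certificate of infeasibility of the dual problem. -/
def DualFarkasCertificate {m n : ℕ} (A : Matrix (Fin m) (Fin n) ℝ) (c : Fin n → ℝ)
    (r : Fin n → ℝ) : Prop :=
  A *ᵥ r = 0 ∧ c ⬝ᵥ r < 0 ∧ 0 ≤ r

/-- The output of a certifying algorithm: one of the four cases of linear programming duality
(the answer), together with a pair of vectors (the certificate). -/
inductive LPOutput (m n : ℕ) where
  | optimal (x : Fin n → ℝ) (y : Fin m → ℝ)
  | primalInfeasible (z : Fin m → ℝ) (y : Fin m → ℝ)
  | dualInfeasible (x : Fin n → ℝ) (r : Fin n → ℝ)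
  | bothInfeasible (z : Fin m → ℝ) (r : Fin n → ℝ)

/-- The answer is correct: the named case of linear programming duality holds. -/
def LPOutput.CaseHolds {m n : ℕ} (A : Matrix (Fin m) (Fin n) ℝ) (b : Fin m → ℝ)
    (c : Fin n → ℝ) : LPOutput m n → Prop
  | .optimal _ _ =>
      ∃ x y, PrimalFeasible A b x ∧ DualFeasible A c y ∧ c ⬝ᵥ x = y ⬝ᵥ b
  | .primalInfeasible _ _ =>
      (¬ ∃ x, PrimalFeasible A b x) ∧ (∃ y, DualFeasible A c y) ∧
        ∀ K : ℝ, ∃ y, DualFeasible A c y ∧ K < y ⬝ᵥ b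
  | .dualInfeasible _ _ =>
      (∃ x, PrimalFeasible A b x) ∧ (∀ K : ℝ, ∃ x, PrimalFeasible A b x ∧ c ⬝ᵥ x < K) ∧
        ¬ ∃ y, DualFeasible A c y
  | .bothInfeasible _ _ =>
      (¬ ∃ x, PrimalFeasible A b x) ∧ ¬ ∃ y, DualFeasible A c y

/-- The certificate is valid for the named case. -/
def LPOutput.Certified {m n : ℕ} (A : Matrix (Fin m) (Fin n) ℝ) (b : Fin m → ℝ)
    (c : Fin n → ℝ) : LPOutput m n → Prop
  | .optimal x y => PrimalFeasible A b x ∧ DualFeasible A c y ∧ c ⬝ᵥ x = y ⬝ᵥ b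
  | .primalInfeasible z y => PrimalFarkasCertificate A b z ∧ DualFeasible A c y
  | .dualInfeasible x r => PrimalFeasible A b x ∧ DualFarkasCertificate A c r
  | .bothInfeasible z r => PrimalFarkasCertificate A b z ∧ DualFarkasCertificate A c r

/-! ### Combinatorial algorithms: a random access machine over the reals without division

Programs are structured (`if`, `while`). The memory consists of registers holding natural numbers
(used for indices), arrays of natural numbers and arrays of reals; arrays have arbitrary finite
dimension and are indexed by the contents of registers. The only operations on reals are addition,
subtraction, multiplication and comparison; the only real constants are `0` and `1`. -/

/-- A memory configuration. Registers and arrays are named by natural numbers. -/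
structure RAMState where
  reg : ℕ → ℕ
  natArr : ℕ → List ℕ → ℕ
  realArr : ℕ → List ℕ → ℝ

/-- Expressions with values in the natural numbers; `sub` is truncated subtraction.
In `load a rs`, `a` names an array and `rs` lists the registers holding the indices. -/
inductive NatExpr where
  | const (k : ℕ)
  | reg (r : ℕ)
  | load (a : ℕ) (rs : List ℕ)
  | add (e f : NatExpr)
  | sub (e f : NatExpr)

/-- Expressions with real values. -/
inductive RealExpr where
  | zero
  | one
  | load (a : ℕ) (rs : List ℕ)
  | add (e f : RealExpr)
  | sub (e f : RealExpr)
  | mul (e f : RealExpr)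

/-- Tests. -/
inductive RAMTest where
  | natLt (e f : NatExpr)
  | natEq (e f : NatExpr)
  | realLt (e f : RealExpr)
  | realEq (e f : RealExpr)
  | not (p : RAMTest)
  | and (p q : RAMTest)

/-- Programs. -/
inductive RAMProgram where
  | skip
  | setReg (r : ℕ) (e : NatExpr)
  | storeNat (a : ℕ) (rs : List ℕ) (e : NatExpr)
  | storeReal (a : ℕ) (rs : List ℕ) (e : RealExpr)
  | seq (P Q : RAMProgram)
  | cond (p : RAMTest) (P Q : RAMProgram)
  | loop (p : RAMTest) (P : RAMProgram)

/-- The value of an expression. -/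
def NatExpr.eval (s : RAMState) : NatExpr → ℕ
  | .const k => k
  | .reg r => s.reg r
  | .load a rs => s.natArr a (rs.map s.reg)
  | .add e f => e.eval s + f.eval s
  | .sub e f => e.eval s - f.eval s

/-- The number of elementary operations in the evaluation of an expression. -/
def NatExpr.cost : NatExpr → ℕ
  | .const _ => 1
  | .reg _ => 1
  | .load _ rs => 1 + rs.length
  | .add e f => 1 + e.cost + f.cost
  | .sub e f => 1 + e.cost + f.cost

/-- The value of an expression. -/
noncomputable def RealExpr.eval (s : RAMState) : RealExpr → ℝ
  | .zero => 0
  | .one => 1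
  | .load a rs => s.realArr a (rs.map s.reg)
  | .add e f => e.eval s + f.eval s
  | .sub e f => e.eval s - f.eval s
  | .mul e f => e.eval s * f.eval s

/-- The number of elementary operations in the evaluation of an expression. -/
def RealExpr.cost : RealExpr → ℕ
  | .zero => 1
  | .one => 1
  | .load _ rs => 1 + rs.length
  | .add e f => 1 + e.cost + f.cost
  | .sub e f => 1 + e.cost + f.cost
  | .mul e f => 1 + e.cost + f.cost

/-- The test succeeds. -/
def RAMTest.Holds (s : RAMState) : RAMTest → Prop
  | .natLt e f => e.eval s < f.eval s
  | .natEq e f => e.eval s = f.eval s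
  | .realLt e f => e.eval s < f.eval s
  | .realEq e f => e.eval s = f.eval s
  | .not p => ¬ p.Holds s
  | .and p q => p.Holds s ∧ q.Holds s

/-- The number of elementary operations in a test. -/
def RAMTest.cost : RAMTest → ℕ
  | .natLt e f => 1 + e.cost + f.cost
  | .natEq e f => 1 + e.cost + f.cost
  | .realLt e f => 1 + e.cost + f.cost
  | .realEq e f => 1 + e.cost + f.cost
  | .not p => 1 + p.cost
  | .and p q => 1 + p.cost + q.cost

/-- Write a natural number into a register. -/
def RAMState.setReg (s : RAMState) (r k : ℕ) : RAMState :=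
  { s with reg := Function.update s.reg r k }

/-- Write a natural number into an array cell. -/
def RAMState.setNat (s : RAMState) (a : ℕ) (idx : List ℕ) (k : ℕ) : RAMState :=
  { s with natArr := Function.update s.natArr a (Function.update (s.natArr a) idx k) }

/-- Write a real number into an array cell. -/
noncomputable def RAMState.setReal (s : RAMState) (a : ℕ) (idx : List ℕ) (v : ℝ) : RAMState :=
  { s with realArr := Function.update s.realArr a (Function.update (s.realArr a) idx v) }

/-- `RAMExec P s s' t`: started in the memory configuration `s`, the program `P` halts after
exactly `t` elementary operations in the memory configuration `s'`. -/
inductive RAMExec : RAMProgram → RAMState → RAMState → ℕ → Prop where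
  | skip (s : RAMState) : RAMExec .skip s s 1
  | setReg (r : ℕ) (e : NatExpr) (s : RAMState) :
      RAMExec (.setReg r e) s (s.setReg r (e.eval s)) (1 + e.cost)
  | storeNat (a : ℕ) (rs : List ℕ) (e : NatExpr) (s : RAMState) :
      RAMExec (.storeNat a rs e) s (s.setNat a (rs.map s.reg) (e.eval s))
        (1 + rs.length + e.cost)
  | storeReal (a : ℕ) (rs : List ℕ) (e : RealExpr) (s : RAMState) :
      RAMExec (.storeReal a rs e) s (s.setReal a (rs.map s.reg) (e.eval s))
        (1 + rs.length + e.cost)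
  | seq {P Q : RAMProgram} {s s' s'' : RAMState} {t t' : ℕ} :
      RAMExec P s s' t → RAMExec Q s' s'' t' → RAMExec (.seq P Q) s s'' (t + t')
  | condTrue {p : RAMTest} {P Q : RAMProgram} {s s' : RAMState} {t : ℕ} :
      p.Holds s → RAMExec P s s' t → RAMExec (.cond p P Q) s s' (1 + p.cost + t)
  | condFalse {p : RAMTest} {P Q : RAMProgram} {s s' : RAMState} {t : ℕ} :
      ¬ p.Holds s → RAMExec Q s s' t → RAMExec (.cond p P Q) s s' (1 + p.cost + t)
  | loopTrue {p : RAMTest} {P : RAMProgram} {s s' s'' : RAMState} {t t' : ℕ} :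
      p.Holds s → RAMExec P s s' t → RAMExec (.loop p P) s' s'' t' →
        RAMExec (.loop p P) s s'' (1 + p.cost + t + t')
  | loopFalse {p : RAMTest} {P : RAMProgram} {s : RAMState} :
      ¬ p.Holds s → RAMExec (.loop p P) s s (1 + p.cost)

/-! ### Input and output conventions -/

/-- The initial configuration on input `A`, `b`, `c`: registers 0 and 1 hold `m` and `n`, the real
arrays 0, 1 and 2 hold `A`, `b` and `c` (indices start at `0`), and all other cells hold `0`. -/
noncomputable def RAMState.input {m n : ℕ} (A : Matrix (Fin m) (Fin n) ℝ) (b : Fin m → ℝ)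
    (c : Fin n → ℝ) : RAMState where
  reg
    | 0 => m
    | 1 => n
    | _ => 0
  natArr _ _ := 0
  realArr
    | 0, [i, j] => if h : i < m ∧ j < n then A ⟨i, h.1⟩ ⟨j, h.2⟩ else 0
    | 1, [i] => if h : i < m then b ⟨i, h⟩ else 0
    | 2, [j] => if h : j < n then c ⟨j, h⟩ else 0
    | _, _ => 0

/-- The real array `a` holds the vector `v`. -/
def RAMState.HoldsVector {k : ℕ} (s : RAMState) (a : ℕ) (v : Fin k → ℝ) : Prop :=
  ∀ i : Fin k, s.realArr a [(i : ℕ)] = v i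

/-- The vector `v` is given as a fraction `p / q`: the real array `a` holds the vector `p` of
numerators, and the real array `d` (of dimension zero) holds a common denominator `q > 0`. -/
def RAMState.HoldsFraction {k : ℕ} (s : RAMState) (a d : ℕ) (v : Fin k → ℝ) : Prop :=
  0 < s.realArr d [] ∧ ∀ i : Fin k, s.realArr a [(i : ℕ)] = s.realArr d [] * v i

/-- The final configuration `s` presents the given output: register 0 holds the number `1`, …, `4`
of the case; the real arrays 3, 4, 5 and 6 hold `x`, `r`, `z` and the numerators of `y`, as far as
the case asks for them, and the real array 7 (of dimension zero) holds the denominator of `y`. -/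
def RAMState.Presents {m n : ℕ} (s : RAMState) : LPOutput m n → Prop
  | .optimal x y => s.reg 0 = 1 ∧ s.HoldsVector 3 x ∧ s.HoldsFraction 6 7 y
  | .primalInfeasible z y => s.reg 0 = 2 ∧ s.HoldsVector 5 z ∧ s.HoldsFraction 6 7 y
  | .dualInfeasible x r => s.reg 0 = 3 ∧ s.HoldsVector 3 x ∧ s.HoldsVector 4 r
  | .bothInfeasible z r => s.reg 0 = 4 ∧ s.HoldsVector 5 z ∧ s.HoldsVector 4 r

/-!
A column of `A` with head `i` says that one unit of `i` can be derived from its tail, and bounds the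
dual variable `y i` by the cost of the column plus a weighted sum of the `y k` over the tail. As
`b ≥ 0`, the dual asks for the greatest solution, and so a Bellman–Ford iteration applies: the value
of `i` in round `t` is the least cost of a derivation of `i` of depth at most `t`. Rows that cannot
be derived are handled by artificial supplies, whose amount is minimized first: values are pairs
(artificial supply, cost) in lexicographic order. Together with its value, every vertex carries the
flow that derives it, and the tables of all rounds are kept. A column without a head is given an
additional root as its head.

An improvement in a round is caused by an improvement of a vertex of the tail in the round before
(`BellmanFordTrace.exists_tail_improved`). Hence an improvement in round `m + 1` comes with a path
of `m + 1` improvements, which visits some vertex `v` twice, in rounds `s < t`, along a cycle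
without further repetitions. The later derivation of `v` contains the earlier one, scaled by the
product of the weights along the cycle. Gainfreeness says that this product is at least one, so the
difference of the two flows is nonnegative; the artificial supplies cannot have increased, hence
they agree, and the difference is a ray of negative cost (`BellmanFordTrace.ray_of_cycle`). The same
argument for artificial supplies alone shows that they are stationary after `m` rounds whatever the
costs are, and form a solution `z` of `zᵀA ≤ 0` (`BellmanFordTrace.supply_farkas`). If `zᵀb = 0`,
then superposing the derivations gives a primal solution; otherwise `z` is a Farkas certificate. If
there is no improvement in round `m + 1` and the root is not improved, then the costs `q` satisfy
the dual constraints on which `z` is tight (`BellmanFordTrace.cost_feasible`), and `q + M z` is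
dual feasible for large `M`. The least such `M` is a maximum of ratios, found by
cross-multiplication, which is why `y` is output as a fraction.

The algorithm uses counting loops only. For such programs the final configuration is a total
function of the initial one, and the running time is bounded by the text of the program
(`CountingProgram.exec_compile`), so that correctness and running time are proved separately.
-/

/-! ### Lexicographic Bellman–Ford iteration on a Leontief matrix -/

/-- The vector attached to the bare arc `j` of cost `c j`: one unit of the arc itself, its cost in
coordinate `n`, and no artificial supply in coordinate `n + 1`. -/
noncomputable def arcEntry (n : ℕ) (c : ℕ → ℝ) (j l : ℕ) : ℝ :=
  if l = j then 1 else if l = n then c j else 0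

/-- The change of coordinate `l` at the head of the arc `j`, if the derivation of the head is
replaced by the arc `j` fed by the derivations `X k` of its tail. For `l = n` this is the reduced
cost of `j`. -/
noncomputable def reduced (m n : ℕ) (A : ℕ → ℕ → ℝ) (c : ℕ → ℝ) (X : ℕ → ℕ → ℝ) (j l : ℕ) : ℝ :=
  arcEntry n c j l - ∑ k ∈ Finset.range (m + 1), A k j * X k l

/-- The pair (change of artificial supply, change of cost) in lexicographic order. -/
noncomputable def reducedKey (m n : ℕ) (A : ℕ → ℕ → ℝ) (c : ℕ → ℝ) (X : ℕ → ℕ → ℝ) (j : ℕ) :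
    ℝ ×ₗ ℝ :=
  toLex (reduced m n A c X j (n + 1), reduced m n A c X j n)

/-- The pair (artificial supply, cost) of a vertex in lexicographic order. -/
noncomputable def vertexKey (n : ℕ) (X : ℕ → ℕ → ℝ) (v : ℕ) : ℝ ×ₗ ℝ :=
  toLex (X v (n + 1), X v n)

/-- One update of the vertex `v` in the Bellman–Ford iteration: `X` is the table before and `X'`
the row of `v` afterwards; `imp` tells whether `v` was improved, and `arc` by which arc. -/
def UpdateSpec (m n : ℕ) (A : ℕ → ℕ → ℝ) (c : ℕ → ℝ) (X : ℕ → ℕ → ℝ) (X' : ℕ → ℝ)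
    (imp arc v : ℕ) : Prop :=
  (imp = 0 ∧ (∀ l < n + 2, X' l = X v l) ∧
      ∀ j < n, A v j = 1 → 0 ≤ reducedKey m n A c X j) ∨
    (imp = 1 ∧ arc < n ∧ A v arc = 1 ∧ reducedKey m n A c X arc < 0 ∧
      (∀ j < n, A v j = 1 → reducedKey m n A c X arc ≤ reducedKey m n A c X j) ∧
      ∀ l < n + 2, X' l = X v l + reduced m n A c X arc l)

/-- A complete history of the iteration. Rows `0, …, m - 1` of `A` are the vertices of the
hypergraph, and row `m` is an additional root, the head of the arcs without a head. `X t v` is the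
table of round `t`: coordinates `l < n` hold a flow that derives one unit of `v`, coordinate `n` its
cost, and coordinate `n + 1` the artificial supply that it uses. -/
structure BellmanFordTrace (m n : ℕ) (A : ℕ → ℕ → ℝ) (c : ℕ → ℝ) (X : ℕ → ℕ → ℕ → ℝ)
    (imp arc : ℕ → ℕ → ℕ) : Prop where
  offhead : ∀ j < n, ∀ v ≤ m, A v j = 1 → ∀ k ≤ m, k ≠ v → A k j ≤ 0
  exists_head : ∀ j < n, ∃ v ≤ m, A v j = 1
  root : ∀ j < n, 0 ≤ A m j
  init : ∀ v ≤ m, ∀ l < n + 2, X 0 v l = if l = n + 1 ∧ v < m then 1 else 0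
  step : ∀ t ≤ m, ∀ v ≤ m,
    UpdateSpec m n A c (X t) (X (t + 1) v) (imp (t + 1) v) (arc (t + 1) v) v

/-- The vertex quantity `f t v` is updated along the iteration like a linear coordinate of `X`,
where the bare arc `j` contributes `d j`. -/
def FollowsUpdates (m : ℕ) (A : ℕ → ℕ → ℝ) (imp arc : ℕ → ℕ → ℕ) (d : ℕ → ℝ)
    (f : ℕ → ℕ → ℝ) : Prop :=
  ∀ t ≤ m, ∀ v ≤ m, f (t + 1) v = f t v + if imp (t + 1) v = 1 then
    d (arc (t + 1) v) - ∑ k ∈ Finset.range (m + 1), A k (arc (t + 1) v) * f t k else 0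

namespace FollowsUpdates

variable {m : ℕ} {A : ℕ → ℕ → ℝ} {imp arc : ℕ → ℕ → ℕ} {d d' : ℕ → ℝ} {f f' : ℕ → ℕ → ℝ}

theorem sub (h : FollowsUpdates m A imp arc d f) (h' : FollowsUpdates m A imp arc d' f') :
    FollowsUpdates m A imp arc (fun j => d j - d' j) (fun t v => f t v - f' t v) := by
  intro t ht v hv
  beta_reduce
  rw [h t ht v hv, h' t ht v hv]
  split_ifs
  · simp only [mul_sub, Finset.sum_sub_distrib]; ring
  · ring

theorem sum {ι : Type*} (S : Finset ι) (a : ι → ℝ) {D : ι → ℕ → ℝ} {F : ι → ℕ → ℕ → ℝ}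
    (h : ∀ i ∈ S, FollowsUpdates m A imp arc (D i) (F i)) :
    FollowsUpdates m A imp arc (fun j => ∑ i ∈ S, a i * D i j)
      (fun t v => ∑ i ∈ S, a i * F i t v) := by
  intro t ht v hv
  have : ∀ i ∈ S, a i * F i (t + 1) v = a i * F i t v + a i * if imp (t + 1) v = 1 then
      D i (arc (t + 1) v) - ∑ k ∈ Finset.range (m + 1), A k (arc (t + 1) v) * F i t k else 0 := by
    intro i hi
    rw [h i hi t ht v hv, mul_add]
  beta_reduce
  rw [Finset.sum_congr rfl this, Finset.sum_add_distrib]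
  congr 1
  split_ifs
  · simp only [mul_sub, Finset.sum_sub_distrib, Finset.mul_sum]
    rw [Finset.sum_comm]
    congr 1
    refine Finset.sum_congr rfl fun k _ => Finset.sum_congr rfl fun i _ => ?_
    ring
  · simp

/-- A quantity that never changes follows the updates, with the offset that cancels them. -/
theorem of_const (g : ℕ → ℝ) :
    FollowsUpdates m A imp arc (fun j => ∑ k ∈ Finset.range (m + 1), A k j * g k)
      (fun _ v => g v) := by
  intro t _ v _
  simp

theorem eq_of_init (h : FollowsUpdates m A imp arc d f) (h' : FollowsUpdates m A imp arc d' f')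
    (hd : ∀ t ≤ m, ∀ v ≤ m, imp (t + 1) v = 1 → d (arc (t + 1) v) = d' (arc (t + 1) v))
    (h0 : ∀ v ≤ m, f 0 v = f' 0 v) : ∀ t ≤ m + 1, ∀ v ≤ m, f t v = f' t v := by
  intro t
  induction t with
  | zero => intro _ v hv; exact h0 v hv
  | succ t ih =>
    intro ht v hv
    have ht' : t ≤ m := by omega
    rw [h t ht' v hv, h' t ht' v hv, ih (by omega) v hv]
    split_ifs with hi
    · rw [hd t ht' v hv hi]
      congr 2
      refine Finset.sum_congr rfl fun k hk => ?_
      rw [ih (by omega) k (by simpa [Nat.lt_succ_iff] using hk)]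
    · rfl

end FollowsUpdates

theorem add_sub_sum_eq_sub_sum_erase {m v : ℕ} (hv : v ≤ m) (a g : ℕ → ℝ) (ha : a v = 1) (d : ℝ) :
    g v + (d - ∑ k ∈ Finset.range (m + 1), a k * g k) =
      d + ∑ k ∈ (Finset.range (m + 1)).erase v, -a k * g k := by
  rw [← Finset.add_sum_erase _ _ (Finset.mem_range.2 (Nat.lt_succ_of_le hv)), ha]
  simp only [neg_mul, Finset.sum_neg_distrib]
  ring

namespace BellmanFordTrace

variable {m n : ℕ} {A : ℕ → ℕ → ℝ} {c : ℕ → ℝ} {X : ℕ → ℕ → ℕ → ℝ} {imp arc : ℕ → ℕ → ℕ}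

theorem imp_spec (H : BellmanFordTrace m n A c X imp arc) {t v : ℕ} (ht : t ≤ m) (hv : v ≤ m)
    (hi : imp (t + 1) v = 1) : arc (t + 1) v < n ∧ A v (arc (t + 1) v) = 1 ∧
      reducedKey m n A c (X t) (arc (t + 1) v) < 0 := by
  rcases H.step t ht v hv with h | h
  · omega
  · exact ⟨h.2.1, h.2.2.1, h.2.2.2.1⟩

theorem eq_of_imp_ne_one (H : BellmanFordTrace m n A c X imp arc) {t v : ℕ} (ht : t ≤ m)
    (hv : v ≤ m) (hi : imp (t + 1) v ≠ 1) : imp (t + 1) v = 0 ∧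
      ∀ l < n + 2, X (t + 1) v l = X t v l := by
  rcases H.step t ht v hv with h | h
  · exact ⟨h.1, h.2.1⟩
  · omega

theorem followsUpdates_apply (H : BellmanFordTrace m n A c X imp arc) {l : ℕ} (hl : l < n + 2) :
    FollowsUpdates m A imp arc (fun j => arcEntry n c j l) (fun t v => X t v l) := by
  intro t ht v hv
  rcases H.step t ht v hv with h | h
  · simp [h.1, h.2.1 l hl]
  · simp [h.1, h.2.2.2.2.2 l hl, reduced]

theorem follows_nonneg (H : BellmanFordTrace m n A c X imp arc) {d : ℕ → ℝ} {f : ℕ → ℕ → ℝ}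
    (hf : FollowsUpdates m A imp arc d f) (hd : ∀ j < n, 0 ≤ d j) (h0 : ∀ v ≤ m, 0 ≤ f 0 v) :
    ∀ t ≤ m + 1, ∀ v ≤ m, 0 ≤ f t v := by
  intro t
  induction t with
  | zero => intro _ v hv; exact h0 v hv
  | succ t ih =>
    intro ht v hv
    have ht' : t ≤ m := by omega
    rw [hf t ht' v hv]
    split_ifs with hi
    · obtain ⟨h1, h2, -⟩ := H.imp_spec ht' hv hi
      rw [add_sub_sum_eq_sub_sum_erase hv (fun k => A k (arc (t + 1) v)) _ h2]
      refine add_nonneg (hd _ h1) (Finset.sum_nonneg fun k hk => ?_)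
      obtain ⟨hk1, hk2⟩ := Finset.mem_erase.1 hk
      have hk2 : k ≤ m := by simpa [Nat.lt_succ_iff] using hk2
      exact mul_nonneg (neg_nonneg.2 (H.offhead _ h1 v hv h2 k hk2 hk1)) (ih (by omega) k hk2)
    · simpa using ih (by omega) v hv

/-- The derivation of an improved vertex contains the derivation of each vertex of the tail of the
improving arc, scaled by the weight of that vertex. -/
theorem follows_ge (H : BellmanFordTrace m n A c X imp arc) {d : ℕ → ℝ} {f : ℕ → ℕ → ℝ}
    (hf : FollowsUpdates m A imp arc d f) (hd : ∀ j < n, 0 ≤ d j) (h0 : ∀ v ≤ m, 0 ≤ f 0 v)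
    {t v k : ℕ} (ht : t ≤ m) (hv : v ≤ m) (hi : imp (t + 1) v = 1) (hk : k ≤ m)
    (hA : A k (arc (t + 1) v) < 0) :
    -A k (arc (t + 1) v) * f t k ≤ f (t + 1) v := by
  obtain ⟨h1, h2, -⟩ := H.imp_spec ht hv hi
  have hkv : k ≠ v := by rintro rfl; linarith
  rw [hf t ht v hv, if_pos hi,
    add_sub_sum_eq_sub_sum_erase hv (fun k => A k (arc (t + 1) v)) _ h2]
  have := Finset.single_le_sum (f := fun k => -A k (arc (t + 1) v) * f t k)
    (s := (Finset.range (m + 1)).erase v) (fun k hk => by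
      obtain ⟨hk1, hk2⟩ := Finset.mem_erase.1 hk
      have hk2 : k ≤ m := by simpa [Nat.lt_succ_iff] using hk2
      exact mul_nonneg (neg_nonneg.2 (H.offhead _ h1 v hv h2 k hk2 hk1))
        (H.follows_nonneg hf hd h0 t (by omega) k hk2))
    (Finset.mem_erase.2 ⟨hkv, Finset.mem_range.2 (by omega)⟩)
  have := hd _ h1
  linarith

theorem flow_nonneg (H : BellmanFordTrace m n A c X imp arc) {t v l : ℕ} (ht : t ≤ m + 1)
    (hv : v ≤ m) (hl : l < n) : 0 ≤ X t v l := by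
  refine H.follows_nonneg (H.followsUpdates_apply (l := l) (by omega)) (fun j _ => ?_)
    (fun v hv => ?_) t ht v hv
  · unfold arcEntry; split_ifs <;> first | positivity | omega
  · rw [H.init v hv l (by omega)]; split_ifs <;> norm_num

/-- The artificial supply of `i` used by the derivation of `v`. -/
noncomputable def artificial (n : ℕ) (A : ℕ → ℕ → ℝ) (X : ℕ → ℕ → ℕ → ℝ) (i t v : ℕ) : ℝ :=
  (if v = i then 1 else 0) - ∑ l ∈ Finset.range n, A i l * X t v l

theorem follows_artificial (H : BellmanFordTrace m n A c X imp arc) (i : ℕ) :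
    FollowsUpdates m A imp arc
      (fun j => ∑ k ∈ Finset.range (m + 1), A k j * (if k = i then 1 else 0) -
        ∑ l ∈ Finset.range n, A i l * arcEntry n c j l)
      (artificial n A X i) :=
  (FollowsUpdates.of_const fun v => if v = i then (1 : ℝ) else 0).sub
    (FollowsUpdates.sum (Finset.range n) (fun l => A i l) fun l hl =>
      H.followsUpdates_apply (by have := Finset.mem_range.1 hl; omega))

/-- Arcs contribute nothing to artificial supplies. -/
theorem artificial_offset {i j : ℕ} (hi : i ≤ m) (hj : j < n) :
    ∑ k ∈ Finset.range (m + 1), A k j * (if k = i then 1 else 0) -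
        ∑ l ∈ Finset.range n, A i l * arcEntry n c j l = 0 := by
  rw [Finset.sum_eq_single i, Finset.sum_eq_single j]
  · simp [arcEntry]
  · intro l hl hlj
    have : l ≠ n := by have := Finset.mem_range.1 hl; omega
    simp [arcEntry, hlj, this]
  · simp [hj]
  · intro k _ hk; simp [hk]
  · intro h; exact absurd (Finset.mem_range.2 (by omega)) h

theorem artificial_init (H : BellmanFordTrace m n A c X imp arc) {i v : ℕ} (hv : v ≤ m) :
    artificial n A X i 0 v = if v = i then 1 else 0 := by
  unfold artificial
  rw [Finset.sum_eq_zero, sub_zero]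
  intro l hl
  have := Finset.mem_range.1 hl
  rw [H.init v hv l (by omega), if_neg (by omega), mul_zero]

theorem artificial_nonneg (H : BellmanFordTrace m n A c X imp arc) {i t v : ℕ} (hi : i ≤ m)
    (ht : t ≤ m + 1) (hv : v ≤ m) : 0 ≤ artificial n A X i t v := by
  refine H.follows_nonneg (H.follows_artificial i) (fun j hj => ?_) (fun v hv => ?_) t ht v hv
  · exact (artificial_offset hi hj).ge
  · rw [H.artificial_init hv]; split_ifs <;> norm_num

theorem artificial_sum (H : BellmanFordTrace m n A c X imp arc) {t v : ℕ}
    (ht : t ≤ m + 1) (hv : v ≤ m) :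
    X t v (n + 1) = ∑ i ∈ Finset.range m, artificial n A X i t v := by
  have := (H.followsUpdates_apply (l := n + 1) (by omega)).eq_of_init
    (FollowsUpdates.sum (Finset.range m) (fun _ => (1 : ℝ)) fun i _ =>
      H.follows_artificial i) ?_ ?_ t ht v hv
  · simpa using this
  · intro t ht v hv hi
    have hj := (H.imp_spec ht hv hi).1
    rw [Finset.sum_eq_zero]
    · simp [arcEntry]; omega
    · intro i hi
      rw [artificial_offset (by have := Finset.mem_range.1 hi; omega) hj, mul_zero]
  · intro v hv
    rw [H.init v hv _ (by omega), Finset.sum_congr rfl fun i _ => by rw [H.artificial_init hv]]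
    simp

theorem artificial_total_nonneg (H : BellmanFordTrace m n A c X imp arc) {t v : ℕ}
    (ht : t ≤ m + 1) (hv : v ≤ m) : 0 ≤ X t v (n + 1) := by
  rw [H.artificial_sum ht hv]
  exact Finset.sum_nonneg fun i hi =>
    H.artificial_nonneg (by have := Finset.mem_range.1 hi; omega) ht hv

theorem cost_sum (H : BellmanFordTrace m n A c X imp arc) {t v : ℕ}
    (ht : t ≤ m + 1) (hv : v ≤ m) :
    X t v n = ∑ l ∈ Finset.range n, c l * X t v l := by
  refine (H.followsUpdates_apply (l := n) (by omega)).eq_of_init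
    (FollowsUpdates.sum (Finset.range n) c fun l hl =>
      H.followsUpdates_apply (l := l) (by have := Finset.mem_range.1 hl; omega)) ?_ ?_ t ht v hv
  · intro t ht v hv hi
    have hj := (H.imp_spec ht hv hi).1
    rw [Finset.sum_eq_single (arc (t + 1) v)]
    · simp [arcEntry]; omega
    · intro l hl hlj
      have : l ≠ n := by have := Finset.mem_range.1 hl; omega
      simp [arcEntry, hlj, this]
    · simp [hj]
  · intro v hv
    rw [H.init v hv _ (by omega), if_neg (by omega), Finset.sum_eq_zero]
    intro l hl
    have := Finset.mem_range.1 hl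
    rw [H.init v hv l (by omega), if_neg (by omega), mul_zero]

/-! ### Values decrease, and improvements propagate along arcs -/

theorem vertexKey_step (H : BellmanFordTrace m n A c X imp arc) {t v : ℕ} (ht : t ≤ m)
    (hv : v ≤ m) : (vertexKey n (X (t + 1)) v = vertexKey n (X t) v ∧ imp (t + 1) v = 0) ∨
      (vertexKey n (X (t + 1)) v =
        vertexKey n (X t) v + reducedKey m n A c (X t) (arc (t + 1) v) ∧ imp (t + 1) v = 1) := by
  rcases H.step t ht v hv with h | h
  · left
    simp [vertexKey, h.2.1, h.1]
  · right
    refine ⟨?_, h.1⟩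
    simp only [vertexKey, reducedKey, ← toLex_add, Prod.mk_add_mk]
    rw [h.2.2.2.2.2 _ (by omega), h.2.2.2.2.2 _ (by omega)]

theorem vertexKey_le (H : BellmanFordTrace m n A c X imp arc) {t v : ℕ} (ht : t ≤ m)
    (hv : v ≤ m) : vertexKey n (X (t + 1)) v ≤ vertexKey n (X t) v := by
  rcases H.vertexKey_step ht hv with ⟨h, -⟩ | ⟨h, hi⟩
  · exact h.le
  · rw [h]
    exact add_le_of_nonpos_right (H.imp_spec ht hv hi).2.2.le

theorem vertexKey_lt (H : BellmanFordTrace m n A c X imp arc) {t v : ℕ} (ht : t ≤ m)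
    (hv : v ≤ m) (hi : imp (t + 1) v = 1) :
    vertexKey n (X (t + 1)) v < vertexKey n (X t) v := by
  rcases H.vertexKey_step ht hv with ⟨h, h'⟩ | ⟨h, -⟩
  · omega
  · rw [h]
    exact add_lt_of_neg_right _ (H.imp_spec ht hv hi).2.2

theorem vertexKey_antitone (H : BellmanFordTrace m n A c X imp arc) {s t v : ℕ} (hst : s ≤ t)
    (ht : t ≤ m + 1) (hv : v ≤ m) : vertexKey n (X t) v ≤ vertexKey n (X s) v := by
  induction t, hst using Nat.le_induction with
  | base => exact le_rfl
  | succ t hst ih => exact (H.vertexKey_le (by omega) hv).trans (ih (by omega))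

theorem supply_antitone (H : BellmanFordTrace m n A c X imp arc) {s t v : ℕ} (hst : s ≤ t)
    (ht : t ≤ m + 1) (hv : v ≤ m) : X t v (n + 1) ≤ X s v (n + 1) := by
  have := H.vertexKey_antitone hst ht hv
  simp only [vertexKey, Prod.Lex.toLex_le_toLex] at this
  rcases this with h | h
  · exact h.le
  · exact h.1.le

theorem vertexKey_le_candidate (H : BellmanFordTrace m n A c X imp arc) {t v j : ℕ} (ht : t ≤ m)
    (hv : v ≤ m) (hj : j < n) (hA : A v j = 1) :
    vertexKey n (X (t + 1)) v ≤ vertexKey n (X t) v + reducedKey m n A c (X t) j := by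
  rcases H.vertexKey_step ht hv with ⟨h, hi⟩ | ⟨h, hi⟩
  · rw [h]
    rcases H.step t ht v hv with h' | h'
    · exact le_add_of_nonneg_right (h'.2.2 j hj hA)
    · omega
  · rw [h]
    rcases H.step t ht v hv with h' | h'
    · omega
    · exact add_le_add_right (h'.2.2.2.2.1 j hj hA) _

theorem supply_le_candidate (H : BellmanFordTrace m n A c X imp arc) {t v j : ℕ} (ht : t ≤ m)
    (hv : v ≤ m) (hj : j < n) (hA : A v j = 1) :
    X (t + 1) v (n + 1) ≤ X t v (n + 1) + reduced m n A c (X t) j (n + 1) := by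
  have := H.vertexKey_le_candidate ht hv hj hA
  simp only [vertexKey, reducedKey, ← toLex_add, Prod.mk_add_mk, Prod.Lex.toLex_le_toLex] at this
  rcases this with h | h
  · exact h.le
  · exact h.1.le

theorem apply_add_reduced (X : ℕ → ℕ → ℝ) {v j : ℕ} (hv : v ≤ m) (hA : A v j = 1) (l : ℕ) :
    X v l + reduced m n A c X j l =
      arcEntry n c j l + ∑ k ∈ (Finset.range (m + 1)).erase v, -A k j * X k l :=
  add_sub_sum_eq_sub_sum_erase hv (fun k => A k j) (fun k => X k l) hA _

/-- An improvement is caused by an improvement of some vertex of the tail in the round before. -/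
theorem exists_tail_improved (H : BellmanFordTrace m n A c X imp arc) {t v : ℕ} (ht : t + 1 ≤ m)
    (hv : v ≤ m) (hi : imp (t + 2) v = 1) :
    ∃ k < m, A k (arc (t + 2) v) < 0 ∧ imp (t + 1) k = 1 := by
  obtain ⟨hj, hA, hneg⟩ := H.imp_spec ht hv hi
  simp only [show t + 1 + 1 = t + 2 from rfl] at hj hA hneg
  by_contra! hcon
  -- If the tail did not change, then the arc was already this good in the round before.
  have key : ∀ l < n + 2, X (t + 1) v l + reduced m n A c (X (t + 1)) (arc (t + 2) v) l =
      X t v l + reduced m n A c (X t) (arc (t + 2) v) l := by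
    intro l hl
    rw [apply_add_reduced _ hv hA, apply_add_reduced _ hv hA]
    congr 1
    refine Finset.sum_congr rfl fun k hk => ?_
    obtain ⟨hk1, hk2⟩ := Finset.mem_erase.1 hk
    have hk2 : k ≤ m := by simpa [Nat.lt_succ_iff] using hk2
    rcases (H.offhead _ hj v hv hA k hk2 hk1).lt_or_eq with h | h
    · have hkm : k < m := lt_of_le_of_ne hk2 (by rintro rfl; have := H.root _ hj; linarith)
      rw [(H.eq_of_imp_ne_one (by omega) hk2 (hcon k hkm h)).2 l hl]
    · simp [h]
  have h1 := H.vertexKey_le_candidate (t := t) (by omega) hv hj hA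
  have h2 : vertexKey n (X (t + 1)) v + reducedKey m n A c (X (t + 1)) (arc (t + 2) v) =
      vertexKey n (X t) v + reducedKey m n A c (X t) (arc (t + 2) v) := by
    simp only [vertexKey, reducedKey, ← toLex_add, Prod.mk_add_mk]
    rw [key _ (by omega), key _ (by omega)]
  rw [← h2] at h1
  exact absurd (le_of_add_le_add_left ((add_zero _).trans_le h1)) (not_le.2 hneg)

/-- A decrease of the artificial supply is caused by such a decrease at some vertex of the tail in
the round before. -/
theorem exists_tail_supply_decreased (H : BellmanFordTrace m n A c X imp arc) {t v : ℕ}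
    (ht : t + 1 ≤ m) (hv : v ≤ m) (hi : X (t + 2) v (n + 1) < X (t + 1) v (n + 1)) :
    ∃ k < m, A k (arc (t + 2) v) < 0 ∧ X (t + 1) k (n + 1) < X t k (n + 1) := by
  have hi1 : imp (t + 2) v = 1 := by
    by_contra h
    exact hi.ne ((H.eq_of_imp_ne_one ht hv h).2 _ (by omega))
  obtain ⟨hj, hA, hneg⟩ := H.imp_spec ht hv hi1
  simp only [show t + 1 + 1 = t + 2 from rfl] at hj hA hneg
  by_contra! hcon
  have key : X t v (n + 1) + reduced m n A c (X t) (arc (t + 2) v) (n + 1) ≤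
      X (t + 1) v (n + 1) + reduced m n A c (X (t + 1)) (arc (t + 2) v) (n + 1) := by
    rw [apply_add_reduced _ hv hA, apply_add_reduced _ hv hA]
    refine add_le_add_right (Finset.sum_le_sum fun k hk => ?_) _
    obtain ⟨hk1, hk2⟩ := Finset.mem_erase.1 hk
    have hk2 : k ≤ m := by simpa [Nat.lt_succ_iff] using hk2
    rcases (H.offhead _ hj v hv hA k hk2 hk1).lt_or_eq with h | h
    · have hkm : k < m := lt_of_le_of_ne hk2 (by rintro rfl; have := H.root _ hj; linarith)
      exact mul_le_mul_of_nonneg_left (hcon k hkm h) (by linarith)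
    · simp [h]
  have h1 := H.supply_le_candidate (t := t) (by omega) hv hj hA
  have h2 : X (t + 2) v (n + 1) =
      X (t + 1) v (n + 1) + reduced m n A c (X (t + 1)) (arc (t + 2) v) (n + 1) := by
    rcases H.step (t + 1) ht v hv with h | h
    · have := h.1; simp only [show t + 1 + 1 = t + 2 from rfl] at this; omega
    · exact h.2.2.2.2.2 _ (by omega)
  linarith

end BellmanFordTrace

/-! ### Improvement paths and the certificates they yield -/

/-- Every directed cycle of the hypergraph on the rows `0, …, m - 1` has weights of product at
least one. -/
def CycleWeightsGeOne (m n : ℕ) (A : ℕ → ℕ → ℝ) : Prop :=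
  ∀ (p e : ℕ → ℕ) (s t : ℕ), s < t → p t = p s →
    (∀ u ∈ Set.Ico s t, p u < m ∧ e u < n ∧ A (p u) (e u) < 0 ∧ A (p (u + 1)) (e u) = 1) →
    Set.InjOn p (Set.Ico s t) → 1 ≤ ∏ u ∈ Finset.Ico s t, -A (p u) (e u)

/-- A sequence of vertices `p 1, …, p (m + 1)`, where `p u` is improved in round `u` by an arc with
`p (u - 1)` in its tail. -/
structure ImprovementPath (m : ℕ) (A : ℕ → ℕ → ℝ) (imp arc : ℕ → ℕ → ℕ) (p : ℕ → ℕ) : Prop where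
  lt : ∀ u, 1 ≤ u → u ≤ m + 1 → p u < m
  improved : ∀ u, 1 ≤ u → u ≤ m + 1 → imp u (p u) = 1
  tail : ∀ u, 1 ≤ u → u ≤ m → A (p u) (arc (u + 1) (p (u + 1))) < 0

/-- `s < t` are rounds in which the path visits the same vertex, and no repetition starts later. -/
structure LastRepetition (m : ℕ) (p : ℕ → ℕ) (s t : ℕ) : Prop where
  one_le : 1 ≤ s
  lt : s < t
  le : t ≤ m + 1
  eq : p t = p s
  last : ∀ s' t', 1 ≤ s' → s' < t' → t' ≤ m + 1 → p t' = p s' → s' ≤ s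

theorem LastRepetition.injOn {m : ℕ} {p : ℕ → ℕ} {s t : ℕ} (h : LastRepetition m p s t) :
    Set.InjOn p (Set.Ico s t) := by
  have key : ∀ u u', s ≤ u → u < u' → u' < t → p u' ≠ p u := by
    intro u u' hu huu' hu' he
    have h1 := h.last u u' (h.one_le.trans hu) huu' (by have := h.le; omega) he
    have : u = s := le_antisymm h1 hu
    subst this
    have := h.last u' t (by omega) hu' h.le (h.eq.trans he.symm)
    omega
  intro u hu u' hu' he
  rcases lt_trichotomy u u' with hlt | heq | hlt
  · exact absurd he.symm (key u u' hu.1 hlt hu'.2)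
  · exact heq
  · exact absurd he (key u' u hu'.1 hlt hu.2)

theorem exists_repetition {m : ℕ} {p : ℕ → ℕ} (hp : ∀ u, 1 ≤ u → u ≤ m + 1 → p u < m) :
    ∃ s t, 1 ≤ s ∧ s < t ∧ t ≤ m + 1 ∧ p t = p s := by
  obtain ⟨x, hx, y, hy, hne, he⟩ := Finset.exists_ne_map_eq_of_card_lt_of_maps_to
    (s := Finset.Icc 1 (m + 1)) (t := Finset.range m) (f := p) (by simp)
    (fun u hu => by
      have := Finset.mem_Icc.1 hu
      simpa using hp u this.1 this.2)
  rw [Finset.mem_Icc] at hx hy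
  rcases hne.lt_or_gt with h | h
  · exact ⟨x, y, hx.1, h, hy.2, he.symm⟩
  · exact ⟨y, x, hy.1, h, hx.2, he⟩

theorem exists_lastRepetition {m : ℕ} {p : ℕ → ℕ} (hp : ∀ u, 1 ≤ u → u ≤ m + 1 → p u < m) :
    ∃ s t, LastRepetition m p s t := by
  classical
  obtain ⟨s, t, h1, h2, h3, h4⟩ := exists_repetition hp
  let S := (Finset.range (m + 1)).filter fun s => 1 ≤ s ∧ ∃ t, s < t ∧ t ≤ m + 1 ∧ p t = p s
  have hS : S.Nonempty := ⟨s, by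
    simp only [S, Finset.mem_filter, Finset.mem_range]
    exact ⟨by omega, h1, t, h2, h3, h4⟩⟩
  have hmem := S.max'_mem hS
  obtain ⟨-, hs1, t', ht1, ht2, ht3⟩ := by
    simpa only [S, Finset.mem_filter, Finset.mem_range] using hmem
  refine ⟨_, t', hs1, ht1, ht2, ht3, fun s' t'' a b c d => S.le_max' s' ?_⟩
  simp only [S, Finset.mem_filter, Finset.mem_range]
  exact ⟨by omega, a, t'', b, c, d⟩

/-- A property of (round, vertex) pairs that always propagates backwards along some arc is
witnessed by a path through all rounds. -/
theorem exists_path {m : ℕ} {A : ℕ → ℕ → ℝ} {arc : ℕ → ℕ → ℕ} (Q : ℕ → ℕ → Prop)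
    (hQ : ∀ t v, t + 1 ≤ m → v < m → Q (t + 2) v →
      ∃ k < m, A k (arc (t + 2) v) < 0 ∧ Q (t + 1) k) (t v : ℕ) (ht : t ≤ m) (hv : v < m)
    (h : Q (t + 1) v) :
    ∃ p : ℕ → ℕ, p (t + 1) = v ∧ (∀ u, 1 ≤ u → u ≤ t + 1 → p u < m ∧ Q u (p u)) ∧
      ∀ u, 1 ≤ u → u ≤ t → A (p u) (arc (u + 1) (p (u + 1))) < 0 := by
  induction t generalizing v with
  | zero =>
    refine ⟨fun _ => v, rfl, fun u h1 h2 => ?_, fun u h1 h2 => by omega⟩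
    obtain rfl : u = 1 := by omega
    exact ⟨hv, h⟩
  | succ t ih =>
    obtain ⟨k, hk, hA, hQk⟩ := hQ t v ht hv h
    obtain ⟨p, hp, hp1, hp2⟩ := ih k (by omega) hk hQk
    refine ⟨Function.update p (t + 2) v, by simp, fun u h1 h2 => ?_, fun u h1 h2 => ?_⟩
    · rcases eq_or_ne u (t + 2) with rfl | hu
      · simpa using ⟨hv, h⟩
      · rw [Function.update_of_ne hu]
        exact hp1 u h1 (by omega)
    · rw [Function.update_of_ne (by omega : u ≠ t + 2)]
      rcases eq_or_ne u (t + 1) with rfl | hu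
      · rw [Function.update_self, hp]
        exact hA
      · rw [Function.update_of_ne (by omega : u + 1 ≠ t + 2)]
        exact hp2 u h1 (by omega)

namespace BellmanFordTrace

variable {m n : ℕ} {A : ℕ → ℕ → ℝ} {c : ℕ → ℝ} {X : ℕ → ℕ → ℕ → ℝ} {imp arc : ℕ → ℕ → ℕ}

theorem follows_path (H : BellmanFordTrace m n A c X imp arc) {p : ℕ → ℕ}
    (hp : ImprovementPath m A imp arc p) {d : ℕ → ℝ} {f : ℕ → ℕ → ℝ}
    (hf : FollowsUpdates m A imp arc d f) (hd : ∀ j < n, 0 ≤ d j) (h0 : ∀ v ≤ m, 0 ≤ f 0 v)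
    {s t : ℕ} (hs : 1 ≤ s) (hst : s ≤ t) (ht : t ≤ m + 1) :
    (∏ u ∈ Finset.Ico s t, -A (p u) (arc (u + 1) (p (u + 1)))) * f s (p s) ≤ f t (p t) := by
  induction t, hst using Nat.le_induction with
  | base => simp
  | succ t hst ih =>
    have h1 := hp.tail t (by omega) (by omega)
    rw [Finset.prod_Ico_succ_top hst, mul_right_comm, mul_comm]
    refine (mul_le_mul_of_nonneg_left (ih (by omega)) (by linarith)).trans ?_
    exact H.follows_ge hf hd h0 (by omega) (hp.lt _ (by omega) ht).le
      (hp.improved _ (by omega) ht) (hp.lt t (by omega) (by omega)).le h1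

/-- Gainfreeness: along a cycle of improvements, nonnegative coordinates do not decrease. -/
theorem follows_cycle (H : BellmanFordTrace m n A c X imp arc) (hG : CycleWeightsGeOne m n A)
    {p : ℕ → ℕ} (hp : ImprovementPath m A imp arc p) {d : ℕ → ℝ} {f : ℕ → ℕ → ℝ}
    (hf : FollowsUpdates m A imp arc d f) (hd : ∀ j < n, 0 ≤ d j) (h0 : ∀ v ≤ m, 0 ≤ f 0 v)
    {s t : ℕ} (hst : LastRepetition m p s t) : f s (p s) ≤ f t (p s) := by
  have h1 := H.follows_path hp hf hd h0 hst.one_le hst.lt.le hst.le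
  rw [hst.eq] at h1
  refine le_trans ?_ h1
  have hs : s ≤ m + 1 := hst.lt.le.trans hst.le
  refine le_mul_of_one_le_left
    (H.follows_nonneg hf hd h0 s hs _ (hp.lt s hst.one_le hs).le) ?_
  refine hG p (fun u => arc (u + 1) (p (u + 1))) s t hst.lt hst.eq (fun u hu => ?_) hst.injOn
  have hu1 := hu.1
  have hu2 := hu.2
  have := hst.one_le
  have := hst.le
  have h2 := H.imp_spec (by omega) (hp.lt (u + 1) (by omega) (by omega)).le
    (hp.improved (u + 1) (by omega) (by omega))
  exact ⟨hp.lt u (by omega) (by omega), h2.1, hp.tail u (by omega) (by omega), h2.2.1⟩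

/-- If the derivation of `v` in round `t` is cheaper than the one in round `s`, but dominates it as
a flow and in its artificial supplies, then their difference is a ray of negative cost. -/
theorem ray_of_dominates (H : BellmanFordTrace m n A c X imp arc) {s t v : ℕ} (hst : s ≤ t)
    (ht : t ≤ m + 1) (hv : v ≤ m) (hlt : vertexKey n (X t) v < vertexKey n (X s) v)
    (ha : ∀ i < m, artificial n A X i s v ≤ artificial n A X i t v) :
    (∀ i < m, ∑ l ∈ Finset.range n, A i l * (X t v l - X s v l) = 0) ∧
      ∑ l ∈ Finset.range n, c l * (X t v l - X s v l) < 0 := by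
  -- The supplies add up to the first component of the key, so this component cannot decrease.
  have hz : X s v (n + 1) ≤ X t v (n + 1) := by
    rw [H.artificial_sum ht hv, H.artificial_sum (by omega) hv]
    exact Finset.sum_le_sum fun i hi => ha i (Finset.mem_range.1 hi)
  simp only [vertexKey, Prod.Lex.toLex_lt_toLex] at hlt
  obtain ⟨hzeq, hq⟩ := hlt.resolve_left (not_lt.2 hz)
  constructor
  · intro i hi
    rw [H.artificial_sum ht hv, H.artificial_sum (by omega) hv] at hzeq
    have := (Finset.sum_eq_sum_iff_of_le fun i hi => ha i (Finset.mem_range.1 hi)).1 hzeq.symm i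
      (Finset.mem_range.2 hi)
    simp only [artificial] at this
    simp only [mul_sub, Finset.sum_sub_distrib]
    linarith
  · rw [H.cost_sum ht hv, H.cost_sum (by omega) hv] at hq
    simp only [mul_sub, Finset.sum_sub_distrib]
    linarith

theorem ray_of_cycle (H : BellmanFordTrace m n A c X imp arc) (hG : CycleWeightsGeOne m n A)
    {p : ℕ → ℕ} (hp : ImprovementPath m A imp arc p) {s t : ℕ} (hst : LastRepetition m p s t) :
    (∀ i < m, ∑ l ∈ Finset.range n, A i l * (X t (p s) l - X s (p s) l) = 0) ∧
      ∑ l ∈ Finset.range n, c l * (X t (p s) l - X s (p s) l) < 0 ∧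
      ∀ l < n, 0 ≤ X t (p s) l - X s (p s) l := by
  have h1 := hst.one_le
  have h2 := hst.lt
  have h3 := hst.le
  have hv : p s ≤ m := (hp.lt s h1 (by omega)).le
  obtain ⟨u, rfl⟩ : ∃ u, t = u + 1 := ⟨t - 1, by omega⟩
  have hlt : vertexKey n (X (u + 1)) (p s) < vertexKey n (X s) (p s) := by
    have hi := hp.improved (u + 1) (by omega) h3
    rw [hst.eq] at hi
    exact (H.vertexKey_lt (by omega) hv hi).trans_le
      (H.vertexKey_antitone (by omega) (by omega) hv)
  obtain ⟨r1, r2⟩ := H.ray_of_dominates h2.le h3 hv hlt fun i hi =>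
    H.follows_cycle hG hp (H.follows_artificial i) (fun j hj => (artificial_offset hi.le hj).ge)
      (fun v hv => by rw [H.artificial_init hv]; split_ifs <;> norm_num) hst
  refine ⟨r1, r2, fun l hl => sub_nonneg.2 ?_⟩
  refine H.follows_cycle hG hp (H.followsUpdates_apply (l := l) (by omega)) (fun j _ => ?_)
      (fun v hv => H.flow_nonneg (by omega) hv hl) hst
  unfold arcEntry; split_ifs <;> first | positivity | omega

theorem ray_of_root (H : BellmanFordTrace m n A c X imp arc)
    (hlt : vertexKey n (X (m + 1)) m < 0) :
    (∀ i < m, ∑ l ∈ Finset.range n, A i l * (X (m + 1) m l - X 0 m l) = 0) ∧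
      ∑ l ∈ Finset.range n, c l * (X (m + 1) m l - X 0 m l) < 0 ∧
      ∀ l < n, 0 ≤ X (m + 1) m l - X 0 m l := by
  have h0 : vertexKey n (X 0) m = 0 := by
    simp [vertexKey, H.init m le_rfl]
  obtain ⟨r1, r2⟩ := H.ray_of_dominates (Nat.zero_le _) le_rfl le_rfl (hlt.trans_eq h0.symm)
    fun i hi => by
      rw [H.artificial_init le_rfl, if_neg (by omega)]
      exact H.artificial_nonneg hi.le le_rfl le_rfl
  refine ⟨r1, r2, fun l hl => ?_⟩
  rw [H.init m le_rfl l (by omega), if_neg (by omega), sub_zero]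
  exact H.flow_nonneg le_rfl le_rfl hl

/-- Artificial supplies are stationary after `m` rounds, whatever the costs are. -/
theorem supply_stationary (H : BellmanFordTrace m n A c X imp arc) (hG : CycleWeightsGeOne m n A)
    {v : ℕ} (hv : v < m) : X m v (n + 1) ≤ X (m + 1) v (n + 1) := by
  by_contra! hcon
  obtain ⟨p, -, hp1, hp2⟩ := exists_path (A := A) (arc := arc)
    (fun t v => X t v (n + 1) < X (t - 1) v (n + 1))
    (fun t v ht hv h => H.exists_tail_supply_decreased ht hv.le h) m v le_rfl hv hcon
  have hp : ImprovementPath m A imp arc p := by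
    refine ⟨fun u h1 h2 => (hp1 u h1 h2).1, fun u h1 h2 => ?_, hp2⟩
    obtain ⟨u, rfl⟩ : ∃ w, u = w + 1 := ⟨u - 1, by omega⟩
    by_contra h
    exact (hp1 _ h1 h2).2.ne
      ((H.eq_of_imp_ne_one (by omega) (hp1 _ h1 h2).1.le h).2 _ (by omega))
  obtain ⟨s, t, hst⟩ := exists_lastRepetition hp.lt
  have h1 := hst.one_le
  have h2 := hst.lt
  have h3 := hst.le
  have hv : p s ≤ m := (hp.lt s h1 (by omega)).le
  have h4 : X s (p s) (n + 1) ≤ X t (p s) (n + 1) :=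
    H.follows_cycle hG hp (H.followsUpdates_apply (l := n + 1) (by omega))
      (fun j hj => by rw [arcEntry, if_neg (by omega), if_neg (by omega)])
      (fun v hv => H.artificial_total_nonneg (by omega) hv) hst
  have h5 := (hp1 t (by omega) h3).2
  rw [hst.eq] at h5
  have h6 := H.supply_antitone (s := s) (t := t - 1) (by omega) (by omega) hv
  linarith

/-! ### Primal and dual solutions from the values -/

theorem root_eq_zero (H : BellmanFordTrace m n A c X imp arc) {v j : ℕ} (hv : v < m) (hj : j < n)
    (hA : A v j = 1) : A m j = 0 :=
  le_antisymm (H.offhead j hj v hv.le hA m le_rfl (by omega)) (H.root j hj)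

/-- The artificial supplies always form a solution of the homogeneous dual system. -/
theorem supply_farkas (H : BellmanFordTrace m n A c X imp arc) (hG : CycleWeightsGeOne m n A)
    {j : ℕ} (hj : j < n) : ∑ k ∈ Finset.range m, A k j * X m k (n + 1) ≤ 0 := by
  obtain ⟨v, hv, hA⟩ := H.exists_head j hj
  rcases hv.lt_or_eq with hvm | rfl
  · have h1 := H.supply_le_candidate le_rfl hv hj hA
    have h2 := H.supply_stationary hG hvm
    have h3 : 0 ≤ reduced m n A c (X m) j (n + 1) := by linarith
    rw [reduced, Finset.sum_range_succ, H.root_eq_zero hvm hj hA] at h3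
    have h4 : arcEntry n c j (n + 1) = 0 := by simp [arcEntry]; omega
    rw [h4] at h3
    linarith
  · refine Finset.sum_nonpos fun k hk => ?_
    have hk := Finset.mem_range.1 hk
    exact mul_nonpos_of_nonpos_of_nonneg (H.offhead j hj v le_rfl hA k hk.le hk.ne)
      (H.artificial_total_nonneg (by omega) hk.le)

/-- If the iteration is stationary, then its values satisfy the dual constraints lexicographically:
tight constraints of the artificial supplies are satisfied by the costs. -/
theorem cost_feasible (H : BellmanFordTrace m n A c X imp arc)
    (hroot : ¬ vertexKey n (X (m + 1)) m < 0) (himp : ∀ v < m, imp (m + 1) v ≠ 1)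
    {j : ℕ} (hj : j < n) (hz : ∑ k ∈ Finset.range m, A k j * X m k (n + 1) = 0) :
    ∑ k ∈ Finset.range m, A k j * X m k n ≤ c j := by
  obtain ⟨v, hv, hA⟩ := H.exists_head j hj
  have e1 : arcEntry n c j (n + 1) = 0 := by simp [arcEntry]; omega
  have e2 : arcEntry n c j n = c j := by simp [arcEntry]; omega
  have key : 0 ≤ (toLex (-∑ k ∈ Finset.range m, A k j * X m k (n + 1),
      c j - ∑ k ∈ Finset.range m, A k j * X m k n) : ℝ ×ₗ ℝ) := by
    rcases hv.lt_or_eq with hvm | rfl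
    · rcases H.step m le_rfl v hv with h | h
      · have := h.2.2 j hj hA
        simpa [reducedKey, reduced, Finset.sum_range_succ, H.root_eq_zero hvm hj hA, e1, e2]
          using this
      · exact absurd h.1 (himp v hvm)
    · have h1 := (not_lt.1 hroot).trans (H.vertexKey_le_candidate le_rfl le_rfl hj hA)
      simp only [vertexKey, reducedKey, ← toLex_add, Prod.mk_add_mk] at h1
      have e3 : ∀ a b d : ℝ, a + (d - (b + a)) = d - b := fun a b d => by ring
      simpa [reduced, Finset.sum_range_succ, hA, e1, e2, e3] using h1
  rw [hz, neg_zero, ← toLex_zero, Prod.Lex.toLex_le_toLex] at key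
  rcases key with h | h
  · exact absurd h (lt_irrefl _)
  · have := h.2
    simp only [Prod.snd_zero] at this
    linarith

/-- If the demand needs no artificial supply, then the superposition of the derivations meets
it. -/
theorem primal_of_supply_eq_zero (H : BellmanFordTrace m n A c X imp arc) {b : ℕ → ℝ}
    (hb : ∀ i < m, 0 ≤ b i) (hz : ∑ i ∈ Finset.range m, b i * X m i (n + 1) = 0) {i : ℕ}
    (hi : i < m) :
    ∑ l ∈ Finset.range n, A i l * ∑ v ∈ Finset.range m, b v * X m v l = b i := by
  have hv0 : ∀ v ∈ Finset.range m, b v * artificial n A X i m v = 0 := by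
    intro v hv
    have hvm := Finset.mem_range.1 hv
    have h1 := (Finset.sum_eq_zero_iff_of_nonneg fun v hv => mul_nonneg
      (hb v (Finset.mem_range.1 hv)) (H.artificial_total_nonneg (by omega)
        (Finset.mem_range.1 hv).le)).1 hz v hv
    rcases mul_eq_zero.1 h1 with h | h
    · rw [h, zero_mul]
    · rw [H.artificial_sum (by omega) hvm.le, Finset.sum_eq_zero_iff_of_nonneg fun i hi =>
        H.artificial_nonneg (Finset.mem_range.1 hi).le (by omega) hvm.le] at h
      rw [h i (Finset.mem_range.2 hi), mul_zero]
  have h2 : ∀ v ∈ Finset.range m, b v * ∑ l ∈ Finset.range n, A i l * X m v l =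
      if v = i then b v else 0 := by
    intro v hv
    have := hv0 v hv
    simp only [artificial, mul_sub] at this
    rw [← sub_eq_zero.1 this]
    simp
  simp only [Finset.mul_sum]
  rw [Finset.sum_comm]
  simp only [Finset.mul_sum] at h2
  rw [Finset.sum_congr rfl fun v hv => (Finset.sum_congr rfl fun l _ => by ring).trans (h2 v hv)]
  simp [hi]

theorem primal_cost (H : BellmanFordTrace m n A c X imp arc) (b : ℕ → ℝ) :
    ∑ l ∈ Finset.range n, c l * ∑ v ∈ Finset.range m, b v * X m v l =
      ∑ v ∈ Finset.range m, b v * X m v n := by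
  simp only [Finset.mul_sum]
  rw [Finset.sum_comm]
  refine Finset.sum_congr rfl fun v hv => ?_
  rw [H.cost_sum (by omega) (Finset.mem_range.1 hv).le, Finset.mul_sum]
  exact Finset.sum_congr rfl fun l _ => by ring

end BellmanFordTrace

/-! ### Programs with counting loops only -/

/-- Programs whose only loops are counting loops: `forTo r b P` executes `P` with register `r`
running through `0, …, k - 1`, where `k` is the content of register `b`. -/
inductive CountingProgram where
  | skip
  | setReg (r : ℕ) (e : NatExpr)
  | storeNat (a : ℕ) (rs : List ℕ) (e : NatExpr)
  | storeReal (a : ℕ) (rs : List ℕ) (e : RealExpr)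
  | seq (P Q : CountingProgram)
  | cond (p : RAMTest) (P Q : CountingProgram)
  | forTo (r b : ℕ) (P : CountingProgram)

namespace CountingProgram

/-- The machine program of a counting program. -/
def compile : CountingProgram → RAMProgram
  | skip => .skip
  | setReg r e => .setReg r e
  | storeNat a rs e => .storeNat a rs e
  | storeReal a rs e => .storeReal a rs e
  | seq P Q => .seq P.compile Q.compile
  | cond p P Q => .cond p P.compile Q.compile
  | forTo r b P => .seq (.setReg r (.const 0)) (.loop (.natLt (.reg r) (.reg b))
      (.seq P.compile (.setReg r (.add (.reg r) (.const 1)))))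

open Classical in
/-- The final memory configuration; counting programs always halt. -/
noncomputable def run : CountingProgram → RAMState → RAMState
  | skip, s => s
  | setReg r e, s => s.setReg r (e.eval s)
  | storeNat a rs e, s => s.setNat a (rs.map s.reg) (e.eval s)
  | storeReal a rs e, s => s.setReal a (rs.map s.reg) (e.eval s)
  | seq P Q, s => Q.run (P.run s)
  | cond p P Q, s => if p.Holds s then P.run s else Q.run s
  | forTo r b P, s =>
      Nat.rec (s.setReg r 0) (fun i s' => (P.run s').setReg r (i + 1)) (s.reg b)

/-- A bound on the number of steps, if the registers that bound the loops hold the values `ρ`. -/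
def timeBound (ρ : ℕ → ℕ) : CountingProgram → ℕ
  | skip => 1
  | setReg _ e => 1 + e.cost
  | storeNat _ rs e => 1 + rs.length + e.cost
  | storeReal _ rs e => 1 + rs.length + e.cost
  | seq P Q => P.timeBound ρ + Q.timeBound ρ
  | cond p P Q => 1 + p.cost + (P.timeBound ρ + Q.timeBound ρ)
  | forTo _ b P => 6 + ρ b * (P.timeBound ρ + 8)

/-- The registers that are written. -/
def regs : CountingProgram → List ℕ
  | setReg r _ => [r]
  | seq P Q => P.regs ++ Q.regs
  | cond _ P Q => P.regs ++ Q.regs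
  | forTo r _ P => r :: P.regs
  | _ => []

/-- The arrays of natural numbers that are written. -/
def natArrs : CountingProgram → List ℕ
  | storeNat a _ _ => [a]
  | seq P Q => P.natArrs ++ Q.natArrs
  | cond _ P Q => P.natArrs ++ Q.natArrs
  | forTo _ _ P => P.natArrs
  | _ => []

/-- The arrays of reals that are written. -/
def realArrs : CountingProgram → List ℕ
  | storeReal a _ _ => [a]
  | seq P Q => P.realArrs ++ Q.realArrs
  | cond _ P Q => P.realArrs ++ Q.realArrs
  | forTo _ _ P => P.realArrs
  | _ => []

/-- Registers below `8` are parameters: they bound the loops and are never written. Loop bodies do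
not write the loop counter. -/
def WellFormed : CountingProgram → Prop
  | setReg r _ => 8 ≤ r
  | seq P Q => P.WellFormed ∧ Q.WellFormed
  | cond _ P Q => P.WellFormed ∧ Q.WellFormed
  | forTo r b P => 8 ≤ r ∧ b < 8 ∧ r ∉ P.regs ∧ P.WellFormed
  | _ => True

end CountingProgram

/-! ### Memory access after an assignment -/

namespace RAMState

@[simp] theorem setReg_reg (s : RAMState) (r k r' : ℕ) :
    (s.setReg r k).reg r' = if r' = r then k else s.reg r' := by
  simp [setReg, Function.update_apply]

@[simp] theorem setReg_natArr (s : RAMState) (r k : ℕ) : (s.setReg r k).natArr = s.natArr := rfl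

@[simp] theorem setReg_realArr (s : RAMState) (r k : ℕ) : (s.setReg r k).realArr = s.realArr := rfl

@[simp] theorem setNat_reg (s : RAMState) (a : ℕ) (is : List ℕ) (k : ℕ) :
    (s.setNat a is k).reg = s.reg := rfl

theorem setNat_natArr_of_ne (s : RAMState) {a a' : ℕ} (h : a' ≠ a) (is : List ℕ) (k : ℕ) :
    (s.setNat a is k).natArr a' = s.natArr a' := by
  simp [setNat, Function.update_of_ne h]

@[simp] theorem setNat_natArr (s : RAMState) (a : ℕ) (is : List ℕ) (k : ℕ) (a' : ℕ)
    (is' : List ℕ) : (s.setNat a is k).natArr a' is' =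
      if a' = a ∧ is' = is then k else s.natArr a' is' := by
  by_cases h : a' = a
  · subst h; simp [setNat, Function.update_apply]
  · simp [setNat, h]

@[simp] theorem setReal_reg (s : RAMState) (a : ℕ) (is : List ℕ) (x : ℝ) :
    (s.setReal a is x).reg = s.reg := rfl

theorem setReal_realArr_of_ne (s : RAMState) {a a' : ℕ} (h : a' ≠ a) (is : List ℕ) (x : ℝ) :
    (s.setReal a is x).realArr a' = s.realArr a' := by
  simp [setReal, Function.update_of_ne h]

@[simp] theorem setReal_realArr (s : RAMState) (a : ℕ) (is : List ℕ) (x : ℝ) (a' : ℕ)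
    (is' : List ℕ) : (s.setReal a is x).realArr a' is' =
      if a' = a ∧ is' = is then x else s.realArr a' is' := by
  by_cases h : a' = a
  · subst h; simp [setReal, Function.update_apply]
  · simp [setReal, h]

end RAMState

/-! ### Frame and loop rules -/

namespace CountingProgram

/-- The configurations agree outside the memory that `P` writes. -/
structure Unchanged (P : CountingProgram) (s s' : RAMState) : Prop where
  reg : ∀ r ∉ P.regs, s'.reg r = s.reg r
  natArr : ∀ a ∉ P.natArrs, s'.natArr a = s.natArr a
  realArr : ∀ a ∉ P.realArrs, s'.realArr a = s.realArr a

theorem Unchanged.forTo_iterate {r b : ℕ} {P : CountingProgram}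
    (hP : ∀ s, P.Unchanged s (P.run s)) (s : RAMState) (i : ℕ) :
    (forTo r b P).Unchanged s
      (Nat.rec (s.setReg r 0) (fun i s' => (P.run s').setReg r (i + 1)) i) := by
  induction i with
  | zero =>
    refine ⟨fun r' hr' => ?_, fun _ _ => rfl, fun _ _ => rfl⟩
    simp only [regs, List.mem_cons, not_or] at hr'
    simp [hr'.1]
  | succ i ih =>
    refine ⟨fun r' hr' => ?_, fun a ha => ?_, fun a ha => ?_⟩
    · rw [← ih.reg r' hr']
      simp only [regs, List.mem_cons, not_or] at hr'
      simp only [RAMState.setReg_reg, if_neg hr'.1]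
      exact (hP _).reg r' hr'.2
    · rw [← ih.natArr a ha]
      exact (hP _).natArr a ha
    · rw [← ih.realArr a ha]
      exact (hP _).realArr a ha

theorem unchanged_run (P : CountingProgram) (s : RAMState) : P.Unchanged s (P.run s) := by
  induction P generalizing s with
  | skip => exact ⟨fun _ _ => rfl, fun _ _ => rfl, fun _ _ => rfl⟩
  | setReg r e =>
    refine ⟨fun r' hr' => ?_, fun _ _ => rfl, fun _ _ => rfl⟩
    simp only [regs, List.mem_singleton] at hr'
    simp [run, hr']
  | storeNat a rs e =>
    refine ⟨fun _ _ => rfl, fun a' ha' => ?_, fun _ _ => rfl⟩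
    exact s.setNat_natArr_of_ne (by simpa [natArrs] using ha') _ _
  | storeReal a rs e =>
    refine ⟨fun _ _ => rfl, fun _ _ => rfl, fun a' ha' => ?_⟩
    exact s.setReal_realArr_of_ne (by simpa [realArrs] using ha') _ _
  | seq P Q hP hQ =>
    refine ⟨fun r hr => ?_, fun a ha => ?_, fun a ha => ?_⟩
    · simp only [regs, List.mem_append, not_or] at hr
      exact ((hQ _).reg r hr.2).trans ((hP s).reg r hr.1)
    · simp only [natArrs, List.mem_append, not_or] at ha
      exact ((hQ _).natArr a ha.2).trans ((hP s).natArr a ha.1)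
    · simp only [realArrs, List.mem_append, not_or] at ha
      exact ((hQ _).realArr a ha.2).trans ((hP s).realArr a ha.1)
  | cond p P Q hP hQ =>
    refine ⟨fun r hr => ?_, fun a ha => ?_, fun a ha => ?_⟩
    · simp only [regs, List.mem_append, not_or] at hr
      simp only [run]
      split_ifs
      · exact (hP s).reg r hr.1
      · exact (hQ s).reg r hr.2
    · simp only [natArrs, List.mem_append, not_or] at ha
      simp only [run]
      split_ifs
      · exact (hP s).natArr a ha.1
      · exact (hQ s).natArr a ha.2
    · simp only [realArrs, List.mem_append, not_or] at ha
      simp only [run]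
      split_ifs
      · exact (hP s).realArr a ha.1
      · exact (hQ s).realArr a ha.2
  | forTo r b P hP => exact Unchanged.forTo_iterate hP s _

/-- Invariants of counting loops. Memory that the loop does not write comes for free. -/
theorem run_forTo {r b : ℕ} {P : CountingProgram} {s : RAMState} (Inv : ℕ → RAMState → Prop)
    (h0 : Inv 0 (s.setReg r 0))
    (hs : ∀ i s', i < s.reg b → (forTo r b P).Unchanged s s' → s'.reg r = i → Inv i s' →
      Inv (i + 1) ((P.run s').setReg r (i + 1))) :
    Inv (s.reg b) ((forTo r b P).run s) := by
  suffices h : ∀ i ≤ s.reg b,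
      Inv i (Nat.rec (s.setReg r 0) (fun i s' => (P.run s').setReg r (i + 1)) i) from h _ le_rfl
  intro i
  induction i with
  | zero => intro _; exact h0
  | succ i ih =>
    intro hi
    refine hs i _ hi (Unchanged.forTo_iterate P.unchanged_run s i) ?_ (ih (by omega))
    cases i <;> simp

/-! ### Running time -/

theorem regs_of_wellFormed {P : CountingProgram} (h : P.WellFormed) : ∀ r ∈ P.regs, 8 ≤ r := by
  induction P with
  | skip => simp [regs]
  | setReg r e => simpa [regs, WellFormed] using h
  | storeNat => simp [regs]
  | storeReal => simp [regs]
  | seq P Q hP hQ =>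
    intro r hr
    rcases List.mem_append.1 hr with hr | hr
    · exact hP h.1 r hr
    · exact hQ h.2 r hr
  | cond p P Q hP hQ =>
    intro r hr
    rcases List.mem_append.1 hr with hr | hr
    · exact hP h.1 r hr
    · exact hQ h.2 r hr
  | forTo r b P hP =>
    intro r' hr
    rcases List.mem_cons.1 hr with rfl | hr
    · exact h.1
    · exact hP h.2.2.2 r' hr

theorem exec_compile {P : CountingProgram} (h : P.WellFormed) (ρ : ℕ → ℕ) (s : RAMState)
    (hρ : ∀ r < 8, s.reg r = ρ r) : ∃ t ≤ P.timeBound ρ, RAMExec P.compile s (P.run s) t := by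
  induction P generalizing s with
  | skip => exact ⟨1, le_rfl, .skip s⟩
  | setReg r e => exact ⟨_, le_rfl, .setReg r e s⟩
  | storeNat a rs e => exact ⟨_, le_rfl, .storeNat a rs e s⟩
  | storeReal a rs e => exact ⟨_, le_rfl, .storeReal a rs e s⟩
  | seq P Q hP hQ =>
    obtain ⟨t, ht, hPt⟩ := hP h.1 s hρ
    obtain ⟨t', ht', hQt⟩ := hQ h.2 (P.run s) fun r hr => by
      have hm : r ∉ P.regs := fun hm => by have := regs_of_wellFormed h.1 r hm; omega
      rw [(P.unchanged_run s).reg r hm, hρ r hr]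
    exact ⟨t + t', add_le_add ht ht', .seq hPt hQt⟩
  | cond p P Q hP hQ =>
    by_cases hp : p.Holds s
    · obtain ⟨t, ht, hPt⟩ := hP h.1 s hρ
      refine ⟨1 + p.cost + t, by simp only [timeBound]; omega, ?_⟩
      simp only [run, if_pos hp]
      exact .condTrue hp hPt
    · obtain ⟨t, ht, hQt⟩ := hQ h.2 s hρ
      refine ⟨1 + p.cost + t, by simp only [timeBound]; omega, ?_⟩
      simp only [run, if_neg hp]
      exact .condFalse hp hQt
  | forTo r b P hP =>
    obtain ⟨hr, hb, hrP, hwf⟩ := h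
    set S : ℕ → RAMState :=
      fun i => Nat.rec (s.setReg r 0) (fun i s' => (P.run s').setReg r (i + 1)) i with hS
    have hSu : ∀ i, (forTo r b P).Unchanged s (S i) :=
      fun i => Unchanged.forTo_iterate P.unchanged_run s i
    have hSr : ∀ i, (S i).reg r = i := by intro i; cases i <;> simp [S]
    have hSρ : ∀ i, ∀ r' < 8, (S i).reg r' = ρ r' := by
      intro i r' hr'
      rw [(hSu i).reg r' fun hm => ?_, hρ r' hr']
      rcases List.mem_cons.1 hm with h | h
      · omega
      · have := regs_of_wellFormed hwf r' h; omega
    -- The iterations that remain after the first `k - d` ones.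
    have key : ∀ d ≤ ρ b, ∃ t ≤ 4 + d * (P.timeBound ρ + 8),
        RAMExec (.loop (.natLt (.reg r) (.reg b))
          (.seq P.compile (.setReg r (.add (.reg r) (.const 1))))) (S (ρ b - d)) (S (ρ b)) t := by
      intro d
      induction d with
      | zero =>
        intro _
        refine ⟨_, le_of_eq ?_, .loopFalse ?_⟩
        · simp [RAMTest.cost, NatExpr.cost]
        · simp [RAMTest.Holds, NatExpr.eval, hSr, hSρ _ b hb]
      | succ d ih =>
        intro hd
        obtain ⟨t, ht, hloop⟩ := ih (by omega)
        obtain ⟨t', ht', hbody⟩ := hP hwf (S (ρ b - (d + 1))) (hSρ _)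
        have hinc : RAMExec (.setReg r (.add (.reg r) (.const 1))) (P.run (S (ρ b - (d + 1))))
            (S (ρ b - d)) 4 := by
          have h1 : S (ρ b - d) = (P.run (S (ρ b - (d + 1)))).setReg r
              (NatExpr.eval (P.run (S (ρ b - (d + 1)))) (.add (.reg r) (.const 1))) := by
            rw [show ρ b - d = ρ b - (d + 1) + 1 by omega]
            simp only [NatExpr.eval, (P.unchanged_run _).reg r hrP, hSr]
            rfl
          rw [h1]
          exact .setReg r (.add (.reg r) (.const 1)) _
        refine ⟨_, ?_, .loopTrue ?_ (.seq hbody hinc) hloop⟩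
        · simp only [RAMTest.cost, NatExpr.cost]
          rw [add_mul]
          omega
        · simp only [RAMTest.Holds, NatExpr.eval, hSr, hSρ _ b hb]
          omega
    obtain ⟨t, ht, hloop⟩ := key (ρ b) le_rfl
    rw [Nat.sub_self] at hloop
    refine ⟨1 + 1 + t, by simp only [timeBound]; omega, ?_⟩
    refine .seq (.setReg r (.const 0) s) ?_
    simp only [run, hρ b hb]
    exact hloop

end CountingProgram

/-! ### The algorithm -/

/-! Registers `0, …, 5` hold `m`, `n`, `m + 1`, `n + 2`, `n + 1` and `0`. The real arrays `0`, `1`,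
`2` hold the input, with the root as an additional row `m` of the matrix, and the real array `8` holds
the history `X` of the Bellman–Ford iteration; the natural arrays `0` and `1` record the improved
vertices and the improving arcs. -/

namespace CountingProgram

infixr:60 " ;; " => CountingProgram.seq

/-- Test whether the first pair of reals is lexicographically smaller than the second. -/
def lexLt (a b a' b' : RealExpr) : RAMTest :=
  .not (.and (.not (.realLt a a')) (.not (.and (.realEq a a') (.realLt b b'))))

/-- Add the root: row `m` of the matrix is the indicator of the columns without a head. -/
def rootRow : CountingProgram :=
  forTo 8 1 (storeReal 0 [0, 8] .one ;; forTo 9 0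
    (cond (.realLt .zero (.load 0 [9, 8])) (storeReal 0 [0, 8] .zero) skip))

/-- Every vertex except the root starts with one unit of artificial supply. -/
def initSupply : CountingProgram :=
  forTo 9 0 (storeReal 8 [5, 9, 4] .one)

/-- The reduced key of the column in register `10` in the round in register `8`. -/
def reducedCost : CountingProgram :=
  storeReal 11 [] .zero ;; storeReal 12 [] (.load 2 [10]) ;; forTo 11 2
    (storeReal 11 [] (.sub (.load 11 []) (.mul (.load 0 [11, 10]) (.load 8 [8, 11, 4]))) ;;
      storeReal 12 [] (.sub (.load 12 []) (.mul (.load 0 [11, 10]) (.load 8 [8, 11, 1]))))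

/-- Find the best improving column for the vertex in register `9`: register `12` tells whether
there is one, and register `13` holds it. -/
def scanColumns : CountingProgram :=
  setReg 12 (.const 0) ;; storeReal 9 [] .zero ;; storeReal 10 [] .zero ;; forTo 10 1
    (cond (.realEq (.load 0 [9, 10]) .one)
      (reducedCost ;; cond (lexLt (.load 11 []) (.load 12 []) (.load 9 []) (.load 10 []))
        (storeReal 9 [] (.load 11 []) ;; storeReal 10 [] (.load 12 []) ;;
          setReg 13 (.reg 10) ;; setReg 12 (.const 1)) skip) skip)

/-- Compute coordinate `l` (register `15`) of the new row of the vertex in register `9`. -/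
def updateEntry : CountingProgram :=
  storeReal 8 [14, 9, 15] (.load 8 [8, 9, 15]) ;;
    cond (.natEq (.reg 12) (.const 1))
      (cond (.natEq (.reg 15) (.reg 13))
          (storeReal 8 [14, 9, 15] (.add (.load 8 [14, 9, 15]) .one))
          (cond (.natEq (.reg 15) (.reg 1))
            (storeReal 8 [14, 9, 15] (.add (.load 8 [14, 9, 15]) (.load 2 [13]))) skip) ;;
        forTo 11 2 (storeReal 8 [14, 9, 15]
          (.sub (.load 8 [14, 9, 15]) (.mul (.load 0 [11, 13]) (.load 8 [8, 11, 15]))))) skip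

/-- Record the improvement of the vertex in register `9` and compute its new row. -/
def updateVertex : CountingProgram :=
  setReg 14 (.add (.reg 8) (.const 1)) ;; storeNat 0 [14, 9] (.reg 12) ;;
    storeNat 1 [14, 9] (.reg 13) ;; forTo 15 3 updateEntry

/-- The Bellman–Ford iteration. -/
def iteration : CountingProgram :=
  forTo 8 2 (forTo 9 2 (scanColumns ;; updateVertex))

/-- Follow improvements backwards from the vertex `p (m + 1)`; natural array `2` holds `p`. -/
def tracePath : CountingProgram :=
  forTo 8 0 (setReg 21 (.sub (.reg 0) (.reg 8)) ;; setReg 22 (.add (.reg 21) (.const 1)) ;;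
    setReg 23 (.load 2 [22]) ;; setReg 24 (.load 1 [22, 23]) ;; forTo 11 0
      (cond (.and (.realLt (.load 0 [11, 24]) .zero) (.natEq (.load 0 [21, 11]) (.const 1)))
        (storeNat 2 [21] (.reg 11)) skip))

/-- Find the last repetition `p s = p t`, `s < t`, of the path: register `16` tells that a ray has
been found, and registers `17`, `18`, `19` hold `p s`, `t`, `s`. -/
def findRepetition : CountingProgram :=
  forTo 8 2 (forTo 9 2 (setReg 21 (.add (.reg 9) (.const 1)) ;;
    cond (.and (.and (.natLt (.const 0) (.reg 8)) (.natLt (.reg 8) (.reg 21)))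
        (.natEq (.load 2 [8]) (.load 2 [21])))
      (setReg 16 (.const 1) ;; setReg 17 (.load 2 [8]) ;; setReg 18 (.reg 21) ;;
        setReg 19 (.reg 8)) skip))

/-- Find a vertex that is improved in the last round. -/
def findImproved : CountingProgram :=
  setReg 20 (.const 0) ;; forTo 9 0 (cond (.natEq (.load 0 [2, 9]) (.const 1))
    (setReg 20 (.const 1) ;; storeNat 2 [2] (.reg 9)) skip)

/-- Find two derivations of the same vertex whose difference is a ray, unless the iteration has
become stationary. -/
def findRay : CountingProgram :=
  setReg 16 (.const 0) ;; cond (lexLt (.load 8 [2, 0, 4]) (.load 8 [2, 0, 1]) .zero .zero)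
    (setReg 16 (.const 1) ;; setReg 17 (.reg 0) ;; setReg 18 (.reg 2) ;; setReg 19 (.const 0))
    (findImproved ;; cond (.natEq (.reg 20) (.const 1)) (tracePath ;; findRepetition) skip)

/-- The artificial supply that the demand `b` needs. -/
def totalSupply : CountingProgram :=
  storeReal 14 [] .zero ;; forTo 8 0
    (storeReal 14 [] (.add (.load 14 []) (.mul (.load 1 [8]) (.load 8 [0, 8, 4]))))

/-- The superposition of the derivations that meets the demand. -/
def writePrimal : CountingProgram :=
  forTo 8 1 (storeReal 3 [8] .zero ;; forTo 9 0
    (storeReal 3 [8] (.add (.load 3 [8]) (.mul (.load 1 [9]) (.load 8 [0, 9, 8])))))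

def writeFarkas : CountingProgram :=
  forTo 8 0 (storeReal 5 [8] (.load 8 [0, 8, 4]))

def writeRay : CountingProgram :=
  forTo 8 1 (storeReal 4 [8] (.sub (.load 8 [18, 17, 8]) (.load 8 [19, 17, 8])))

/-- The slack `α` of the column in register `10` for the artificial supplies, and its violation `β`
for the costs. -/
def slackViolation : CountingProgram :=
  storeReal 15 [] .zero ;; storeReal 16 [] (.sub .zero (.load 2 [10])) ;; forTo 11 0
    (storeReal 15 [] (.sub (.load 15 []) (.mul (.load 0 [11, 10]) (.load 8 [0, 11, 4]))) ;;
      storeReal 16 [] (.add (.load 16 []) (.mul (.load 0 [11, 10]) (.load 8 [0, 11, 1]))))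

/-- The largest ratio `N / D` of violation to slack (at least zero), found by
cross-multiplication. -/
def findRatio : CountingProgram :=
  storeReal 13 [] .zero ;; storeReal 7 [] .one ;; forTo 10 1 (slackViolation ;;
    cond (.and (.realLt .zero (.load 15 []))
        (.realLt (.mul (.load 13 []) (.load 15 [])) (.mul (.load 16 []) (.load 7 []))))
      (storeReal 13 [] (.load 16 []) ;; storeReal 7 [] (.load 15 [])) skip)

/-- The numerators of the costs plus `N / D` times the artificial supplies. -/
def writeDual : CountingProgram :=
  forTo 8 0 (storeReal 6 [8] (.add (.mul (.load 7 []) (.load 8 [0, 8, 1]))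
    (.mul (.load 13 []) (.load 8 [0, 8, 4]))))

/-- Put the number of the case into register `25`. -/
def decideCase : CountingProgram :=
  cond (.natEq (.reg 16) (.const 1))
    (cond (.realEq (.load 14 []) .zero) (setReg 25 (.const 3)) (setReg 25 (.const 4)))
    (cond (.realEq (.load 14 []) .zero) (setReg 25 (.const 1)) (setReg 25 (.const 2)))

/-- Write all certificates and the number of the case. Certificates that do not belong to the case
are written as well, but carry no meaning. -/
def writeOutput : CountingProgram :=
  totalSupply ;; writePrimal ;; writeFarkas ;; writeRay ;; findRatio ;; writeDual ;; decideCase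

/-- The algorithm, after the parameters have been set. -/
def leontief : CountingProgram :=
  rootRow ;; initSupply ;; iteration ;; findRay ;; writeOutput

theorem leontief_wellFormed : leontief.WellFormed := by
  simp [leontief, writeOutput, rootRow, initSupply, iteration, scanColumns, reducedCost,
    updateVertex, updateEntry, findRay, findImproved, tracePath, findRepetition, totalSupply,
    writePrimal, writeFarkas, writeRay, findRatio, slackViolation, writeDual, decideCase, WellFormed, regs]

theorem leontief_timeBound {m n : ℕ} (hm : 0 < m) (hn : 0 < n) {ρ : ℕ → ℕ} (h0 : ρ 0 = m)
    (h1 : ρ 1 = n) (h2 : ρ 2 = m + 1) (h3 : ρ 3 = n + 2) :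
    leontief.timeBound ρ ≤ 2600 * (m ^ 3 * n) := by
  simp only [leontief, writeOutput, rootRow, initSupply, iteration, scanColumns, reducedCost,
    updateVertex, updateEntry, findRay, findImproved, tracePath, findRepetition, totalSupply,
    writePrimal, writeFarkas, writeRay, findRatio, slackViolation, writeDual, decideCase, timeBound, lexLt,
    RAMTest.cost, NatExpr.cost, RealExpr.cost, List.length_cons, List.length_nil, h0, h1, h2, h3]
  have key : ∀ a ≤ 1, ∀ b ≤ 3, n ^ a * m ^ b ≤ m ^ 3 * n := fun a ha b hb =>
    (Nat.mul_le_mul (Nat.pow_le_pow_right hn ha) (Nat.pow_le_pow_right hm hb)).trans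
      (by rw [pow_one, mul_comm])
  have k00 := key 0 (by omega) 0 (by omega)
  have k01 := key 0 (by omega) 1 (by omega)
  have k02 := key 0 (by omega) 2 (by omega)
  have k03 := key 0 (by omega) 3 (by omega)
  have k10 := key 1 (by omega) 0 (by omega)
  have k11 := key 1 (by omega) 1 (by omega)
  have k12 := key 1 (by omega) 2 (by omega)
  ring_nf at k00 k01 k02 k03 k10 k11 k12 ⊢
  linarith

/-! ### Correctness of the iteration -/

theorem lexLt_holds {s : RAMState} {a b a' b' : RealExpr} : (lexLt a b a' b').Holds s ↔
    (toLex (a.eval s, b.eval s) : ℝ ×ₗ ℝ) < toLex (a'.eval s, b'.eval s) := by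
  simp only [lexLt, RAMTest.Holds, Prod.Lex.toLex_lt_toLex]
  tauto

theorem reducedCost_spec {m n t j : ℕ} {s : RAMState} (h1 : s.reg 1 = n) (h2 : s.reg 2 = m + 1)
    (h4 : s.reg 4 = n + 1) (h8 : s.reg 8 = t) (h10 : s.reg 10 = j) (hj : j < n) :
    (toLex ((reducedCost.run s).realArr 11 [], (reducedCost.run s).realArr 12 []) : ℝ ×ₗ ℝ) =
      reducedKey m n (fun k j => s.realArr 0 [k, j]) (fun j => s.realArr 2 [j])
        (fun v l => s.realArr 8 [t, v, l]) j := by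
  have key := run_forTo (r := 11) (b := 2)
    (P := storeReal 11 [] (.sub (.load 11 []) (.mul (.load 0 [11, 10]) (.load 8 [8, 11, 4]))) ;;
      storeReal 12 [] (.sub (.load 12 []) (.mul (.load 0 [11, 10]) (.load 8 [8, 11, 1]))))
    (s := (storeReal 11 [] .zero ;; storeReal 12 [] (.load 2 [10])).run s)
    (fun i s' =>
      s'.realArr 11 [] = 0 - ∑ k ∈ Finset.range i, s.realArr 0 [k, j] * s.realArr 8 [t, k, n + 1] ∧
      s'.realArr 12 [] =
        s.realArr 2 [j] - ∑ k ∈ Finset.range i, s.realArr 0 [k, j] * s.realArr 8 [t, k, n])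
    (by simp [run, RealExpr.eval, h10]) (by
      intro i s' hi hU hr ⟨I1, I2⟩
      have r1 : s'.reg 1 = n := (hU.reg 1 (by decide)).trans h1
      have r4 : s'.reg 4 = n + 1 := (hU.reg 4 (by decide)).trans h4
      have r8 : s'.reg 8 = t := (hU.reg 8 (by decide)).trans h8
      have r10 : s'.reg 10 = j := (hU.reg 10 (by decide)).trans h10
      have a0 : s'.realArr 0 = s.realArr 0 := hU.realArr 0 (by decide)
      have a8 : s'.realArr 8 = s.realArr 8 := hU.realArr 8 (by decide)
      simp [run, RealExpr.eval, r1, r4, r8, r10, hr, a0, a8, I1, I2, Finset.sum_range_succ]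
      constructor <;> ring)
  have h2' : ((storeReal 11 [] .zero ;; storeReal 12 [] (.load 2 [10])).run s).reg 2 = m + 1 := h2
  rw [h2'] at key
  obtain ⟨k1, k2⟩ := key
  have e1 : arcEntry n (fun j => s.realArr 2 [j]) j (n + 1) = 0 := by
    rw [arcEntry, if_neg (by omega), if_neg (by omega)]
  have e2 : arcEntry n (fun j => s.realArr 2 [j]) j n = s.realArr 2 [j] := by
    rw [arcEntry, if_neg (by omega), if_pos rfl]
  rw [reducedKey, reduced, reduced, e1, e2]
  exact congrArg toLex (Prod.ext k1 k2)

/-- The parameter registers hold the values that the algorithm expects. -/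
structure HasParams (m n : ℕ) (s : RAMState) : Prop where
  reg0 : s.reg 0 = m
  reg1 : s.reg 1 = n
  reg2 : s.reg 2 = m + 1
  reg3 : s.reg 3 = n + 2
  reg4 : s.reg 4 = n + 1
  reg5 : s.reg 5 = 0

theorem HasParams.of_eq {m n : ℕ} {s s' : RAMState} (h : HasParams m n s)
    (he : ∀ r < 8, s'.reg r = s.reg r) : HasParams m n s' :=
  ⟨(he 0 (by omega)).trans h.reg0, (he 1 (by omega)).trans h.reg1, (he 2 (by omega)).trans h.reg2,
    (he 3 (by omega)).trans h.reg3, (he 4 (by omega)).trans h.reg4, (he 5 (by omega)).trans h.reg5⟩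

theorem HasParams.unchanged {m n : ℕ} {s s' : RAMState} {P : CountingProgram}
    (h : HasParams m n s) (hU : P.Unchanged s s') (hP : ∀ r < 8, r ∉ P.regs) : HasParams m n s' :=
  h.of_eq fun r hr => hU.reg r (hP r hr)

theorem scanColumns_spec {m n t v : ℕ} {s : RAMState} (hs : HasParams m n s) (h8 : s.reg 8 = t)
    (h9 : s.reg 9 = v) {A : ℕ → ℕ → ℝ} {c : ℕ → ℝ} {X : ℕ → ℕ → ℝ}
    (hA : ∀ k j, s.realArr 0 [k, j] = A k j) (hc : ∀ j, s.realArr 2 [j] = c j)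
    (hX : ∀ k l, s.realArr 8 [t, k, l] = X k l) {s₁ : RAMState} (hs₁ : s₁ = scanColumns.run s) :
    (s₁.reg 12 = 0 ∧ ∀ j < n, A v j = 1 → 0 ≤ reducedKey m n A c X j) ∨
    (s₁.reg 12 = 1 ∧ s₁.reg 13 < n ∧ A v (s₁.reg 13) = 1 ∧
      reducedKey m n A c X (s₁.reg 13) < 0 ∧
      ∀ j < n, A v j = 1 → reducedKey m n A c X (s₁.reg 13) ≤ reducedKey m n A c X j) := by
  obtain rfl : A = fun k j => s.realArr 0 [k, j] := funext fun k => funext fun j => (hA k j).symm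
  obtain rfl : c = fun j => s.realArr 2 [j] := funext fun j => (hc j).symm
  obtain rfl : X = fun k l => s.realArr 8 [t, k, l] := funext fun k => funext fun l => (hX k l).symm
  set A : ℕ → ℕ → ℝ := fun k j => s.realArr 0 [k, j]
  set c : ℕ → ℝ := fun j => s.realArr 2 [j]
  set X : ℕ → ℕ → ℝ := fun k l => s.realArr 8 [t, k, l]
  have key := run_forTo (r := 10) (b := 1)
    (P := cond (.realEq (.load 0 [9, 10]) .one)
      (reducedCost ;; cond (lexLt (.load 11 []) (.load 12 []) (.load 9 []) (.load 10 []))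
        (storeReal 9 [] (.load 11 []) ;; storeReal 10 [] (.load 12 []) ;;
          setReg 13 (.reg 10) ;; setReg 12 (.const 1)) skip) skip)
    (s := (setReg 12 (.const 0) ;; storeReal 9 [] .zero ;; storeReal 10 [] .zero).run s)
    (fun i s' =>
      ((s'.reg 12 = 0 ∧ (toLex (s'.realArr 9 [], s'.realArr 10 []) : ℝ ×ₗ ℝ) = 0) ∨
        (s'.reg 12 = 1 ∧ s'.reg 13 < n ∧ A v (s'.reg 13) = 1 ∧
          (toLex (s'.realArr 9 [], s'.realArr 10 []) : ℝ ×ₗ ℝ) =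
            reducedKey m n A c X (s'.reg 13) ∧
          reducedKey m n A c X (s'.reg 13) < 0)) ∧
      ∀ j < i, A v j = 1 →
        (toLex (s'.realArr 9 [], s'.realArr 10 []) : ℝ ×ₗ ℝ) ≤ reducedKey m n A c X j)
    (by simp [run, RealExpr.eval, NatExpr.eval]) (by
      intro i s' hi hU hr ⟨I1, I2⟩
      have r1 : s'.reg 1 = n := (hU.reg 1 (by decide)).trans hs.reg1
      have r2 : s'.reg 2 = m + 1 := (hU.reg 2 (by decide)).trans hs.reg2
      have r4 : s'.reg 4 = n + 1 := (hU.reg 4 (by decide)).trans hs.reg4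
      have r8 : s'.reg 8 = t := (hU.reg 8 (by decide)).trans h8
      have r9 : s'.reg 9 = v := (hU.reg 9 (by decide)).trans h9
      have a0 : s'.realArr 0 = s.realArr 0 := hU.realArr 0 (by decide)
      have a2 : s'.realArr 2 = s.realArr 2 := hU.realArr 2 (by decide)
      have a8 : s'.realArr 8 = s.realArr 8 := hU.realArr 8 (by decide)
      have hin : i < n := lt_of_lt_of_eq hi hs.reg1
      have hred := reducedCost_spec r1 r2 r4 r8 hr hin
      rw [a0, a2, a8] at hred
      have hU' := reducedCost.unchanged_run s'
      have u9 : (reducedCost.run s').realArr 9 = s'.realArr 9 := hU'.realArr 9 (by decide)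
      have u10 : (reducedCost.run s').realArr 10 = s'.realArr 10 := hU'.realArr 10 (by decide)
      have v10 : (reducedCost.run s').reg 10 = i := (hU'.reg 10 (by decide)).trans hr
      have v12 : (reducedCost.run s').reg 12 = s'.reg 12 := hU'.reg 12 (by decide)
      have v13 : (reducedCost.run s').reg 13 = s'.reg 13 := hU'.reg 13 (by decide)
      have hcond : (RAMTest.realEq (.load 0 [9, 10]) .one).Holds s' ↔ A v i = 1 := by
        simp [RAMTest.Holds, RealExpr.eval, r9, hr, a0, A]
      simp only [run, hcond, lexLt_holds, RealExpr.eval, List.map_nil, hred, u9, u10]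
      by_cases h1 : A v i = 1
      · rw [if_pos h1]
        split_ifs with h2
        · simp only [RAMState.setReg_reg, RAMState.setReg_realArr, RAMState.setReal_realArr,
            NatExpr.eval, RAMState.setReal_reg, v10]
          simp only [and_true, if_true, Nat.reduceEqDiff, if_false]
          have h3 : reducedKey m n A c X i < 0 := by
            rcases I1 with h | h
            · exact h2.trans_eq h.2
            · exact h2.trans (h.2.2.2.1.trans_lt h.2.2.2.2)
          refine ⟨Or.inr ⟨trivial, hin, h1, hred, h3⟩, fun j hj hA => ?_⟩
          rw [hred]
          rcases Nat.lt_succ_iff_lt_or_eq.1 hj with hj | rfl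
          · exact h2.le.trans (I2 j hj hA)
          · exact le_rfl
        · simp only [RAMState.setReg_reg, RAMState.setReg_realArr, u9, u10, v12, v13]
          refine ⟨I1, fun j hj hA => ?_⟩
          rcases Nat.lt_succ_iff_lt_or_eq.1 hj with hj | rfl
          · exact I2 j hj hA
          · exact not_lt.1 h2
      · rw [if_neg h1]
        simp only [RAMState.setReg_reg, RAMState.setReg_realArr]
        refine ⟨I1, fun j hj hA => ?_⟩
        rcases Nat.lt_succ_iff_lt_or_eq.1 hj with hj | rfl
        · exact I2 j hj hA
        · exact absurd hA h1)
  have hn : ((setReg 12 (.const 0) ;; storeReal 9 [] .zero ;; storeReal 10 [] .zero).run s).reg 1 =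
    n := hs.reg1
  rw [hn] at key
  have hrun : s₁ = _ := hs₁
  rw [show scanColumns.run s = (forTo 10 1 _).run ((setReg 12 (.const 0) ;; storeReal 9 [] .zero ;;
    storeReal 10 [] .zero).run s) from rfl] at hrun
  rw [← hrun] at key
  obtain ⟨k1, k2⟩ := key
  rcases k1 with k1 | k1
  · left
    refine ⟨k1.1, fun j hj hA => ?_⟩
    rw [← k1.2]
    exact k2 j hj hA
  · right
    refine ⟨k1.1, k1.2.1, k1.2.2.1, k1.2.2.2.2, fun j hj hA => ?_⟩
    rw [← k1.2.2.2.1]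
    exact k2 j hj hA

theorem updateLoop_spec {m n t v j l : ℕ} {s : RAMState} (hs : HasParams m n s)
    (h8 : s.reg 8 = t) (h9 : s.reg 9 = v) (h13 : s.reg 13 = j) (h14 : s.reg 14 = t + 1)
    (h15 : s.reg 15 = l) (is : List ℕ) :
    ((forTo 11 2 (storeReal 8 [14, 9, 15] (.sub (.load 8 [14, 9, 15])
      (.mul (.load 0 [11, 13]) (.load 8 [8, 11, 15]))))).run s).realArr 8 is =
    if is = [t + 1, v, l] then s.realArr 8 [t + 1, v, l] -
      ∑ k ∈ Finset.range (m + 1), s.realArr 0 [k, j] * s.realArr 8 [t, k, l]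
    else s.realArr 8 is := by
  have key := run_forTo (r := 11) (b := 2)
    (P := storeReal 8 [14, 9, 15] (.sub (.load 8 [14, 9, 15])
      (.mul (.load 0 [11, 13]) (.load 8 [8, 11, 15])))) (s := s)
    (fun i s' => ∀ is, s'.realArr 8 is = if is = [t + 1, v, l] then s.realArr 8 [t + 1, v, l] -
      ∑ k ∈ Finset.range i, s.realArr 0 [k, j] * s.realArr 8 [t, k, l] else s.realArr 8 is)
    (by
      intro is
      simp only [RAMState.setReg_realArr, Finset.range_zero, Finset.sum_empty, sub_zero]
      split_ifs with h
      · rw [h]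
      · rfl) (by
      intro i s' hi hU hr I is
      have r8 : s'.reg 8 = t := (hU.reg 8 (by decide)).trans h8
      have r9 : s'.reg 9 = v := (hU.reg 9 (by decide)).trans h9
      have r13 : s'.reg 13 = j := (hU.reg 13 (by decide)).trans h13
      have r14 : s'.reg 14 = t + 1 := (hU.reg 14 (by decide)).trans h14
      have r15 : s'.reg 15 = l := (hU.reg 15 (by decide)).trans h15
      have a0 : s'.realArr 0 = s.realArr 0 := hU.realArr 0 (by decide)
      simp only [run, RAMState.setReg_realArr, RAMState.setReal_realArr, true_and, List.map_cons,
        List.map_nil, r8, r9, r13, r14, r15, hr, RealExpr.eval, a0, I]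
      simp only [if_true, List.cons.injEq, Nat.left_eq_add, one_ne_zero, false_and, if_false,
        Finset.sum_range_succ]
      split_ifs
      · ring
      · rfl)
  rw [hs.reg2] at key
  exact key is

theorem updateEntry_spec {m n t v j l : ℕ} {s : RAMState} (hs : HasParams m n s)
    (h8 : s.reg 8 = t) (h9 : s.reg 9 = v) (h13 : s.reg 13 = j) (h14 : s.reg 14 = t + 1)
    (h15 : s.reg 15 = l) (is : List ℕ) :
    (updateEntry.run s).realArr 8 is = if is = [t + 1, v, l] then
      s.realArr 8 [t, v, l] + (if s.reg 12 = 1 then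
        reduced m n (fun k j => s.realArr 0 [k, j]) (fun j => s.realArr 2 [j])
          (fun k l => s.realArr 8 [t, k, l]) j l else 0) else s.realArr 8 is := by
  simp only [updateEntry, run, RAMTest.Holds, NatExpr.eval, RAMState.setReal_reg, List.map_cons,
    List.map_nil, h8, h9, h13, h14, h15, RealExpr.eval, hs.reg1]
  by_cases h12 : s.reg 12 = 1
  · rw [if_pos h12, if_pos h12]
    have hstate : ∀ s₁ : RAMState, s₁.reg = s.reg → (∀ is, s₁.realArr 8 is =
        if is = [t + 1, v, l] then s.realArr 8 [t, v, l] + arcEntry n (fun j => s.realArr 2 [j]) j l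
        else s.realArr 8 is) → s₁.realArr 0 = s.realArr 0 →
        ((forTo 11 2 (storeReal 8 [14, 9, 15] (.sub (.load 8 [14, 9, 15])
          (.mul (.load 0 [11, 13]) (.load 8 [8, 11, 15]))))).run s₁).realArr 8 is =
        if is = [t + 1, v, l] then s.realArr 8 [t, v, l] +
          reduced m n (fun k j => s.realArr 0 [k, j]) (fun j => s.realArr 2 [j])
            (fun k l => s.realArr 8 [t, k, l]) j l else s.realArr 8 is := by
      intro s₁ hreg hreal h0
      rw [updateLoop_spec (hs.of_eq fun r _ => congrFun hreg r) ((congrFun hreg 8).trans h8)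
        ((congrFun hreg 9).trans h9) ((congrFun hreg 13).trans h13)
        ((congrFun hreg 14).trans h14) ((congrFun hreg 15).trans h15)]
      simp only [hreal, h0, if_true, List.cons.injEq, Nat.left_eq_add, one_ne_zero, false_and,
        if_false, reduced]
      split_ifs
      · ring
      · rfl
    refine hstate _ ?_ (fun is => ?_) ?_
    · split_ifs <;> rfl
    · unfold arcEntry
      split_ifs with h1 h2 h3 h3 h4 <;> simp_all
    · split_ifs <;>
        simp [RAMState.setReal_realArr_of_ne _ (show 0 ≠ 8 by decide)]
  · rw [if_neg h12, if_neg h12, RAMState.setReal_realArr]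
    simp

/-- The configuration after the update of the vertex `v` in round `t`. -/
theorem updateVertex_spec {m n t v : ℕ} {s : RAMState} (hs : HasParams m n s)
    (h8 : s.reg 8 = t) (h9 : s.reg 9 = v) {s₁ : RAMState} (hs₁ : s₁ = updateVertex.run s) :
    (∀ is, s₁.natArr 0 is = if is = [t + 1, v] then s.reg 12 else s.natArr 0 is) ∧
    (∀ is, s₁.natArr 1 is = if is = [t + 1, v] then s.reg 13 else s.natArr 1 is) ∧
    (∀ l < n + 2, s₁.realArr 8 [t + 1, v, l] = s.realArr 8 [t, v, l] + (if s.reg 12 = 1 then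
        reduced m n (fun k j => s.realArr 0 [k, j]) (fun j => s.realArr 2 [j])
          (fun k l => s.realArr 8 [t, k, l]) (s.reg 13) l else 0)) ∧
    (∀ is, (∀ l, is ≠ [t + 1, v, l]) → s₁.realArr 8 is = s.realArr 8 is) := by
  set s₀ := (setReg 14 (.add (.reg 8) (.const 1)) ;; storeNat 0 [14, 9] (.reg 12) ;;
    storeNat 1 [14, 9] (.reg 13)).run s with hs₀
  have hreg : ∀ r, r ≠ 14 → s₀.reg r = s.reg r := fun r hr =>
    ((setReg 14 (.add (.reg 8) (.const 1)) ;; storeNat 0 [14, 9] (.reg 12) ;;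
      storeNat 1 [14, 9] (.reg 13)).unchanged_run s).reg r (by simpa [regs] using hr)
  have h14 : s₀.reg 14 = t + 1 := by simp [hs₀, run, NatExpr.eval, h8]
  have hreal : s₀.realArr = s.realArr := rfl
  have hp : HasParams m n s₀ := hs.of_eq fun r hr => hreg r (by omega)
  have hrun : s₁ = (forTo 15 3 updateEntry).run s₀ := hs₁
  have key := run_forTo (r := 15) (b := 3) (P := updateEntry) (s := s₀)
    (fun i s' => (∀ l < i, s'.realArr 8 [t + 1, v, l] = s.realArr 8 [t, v, l] +
      (if s.reg 12 = 1 then reduced m n (fun k j => s.realArr 0 [k, j]) (fun j => s.realArr 2 [j])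
          (fun k l => s.realArr 8 [t, k, l]) (s.reg 13) l else 0)) ∧
      (∀ is, (∀ l, is ≠ [t + 1, v, l]) → s'.realArr 8 is = s.realArr 8 is))
    (by simp [hreal]) (by
      intro i s' hi hU hr ⟨I1, I2⟩
      have r8 : s'.reg 8 = t := ((hU.reg 8 (by decide)).trans (hreg 8 (by decide))).trans h8
      have r9 : s'.reg 9 = v := ((hU.reg 9 (by decide)).trans (hreg 9 (by decide))).trans h9
      have r12 : s'.reg 12 = s.reg 12 := (hU.reg 12 (by decide)).trans (hreg 12 (by decide))
      have r13 : s'.reg 13 = s.reg 13 := (hU.reg 13 (by decide)).trans (hreg 13 (by decide))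
      have r14 : s'.reg 14 = t + 1 := (hU.reg 14 (by decide)).trans h14
      have a0 : s'.realArr 0 = s.realArr 0 := hU.realArr 0 (by decide)
      have a2 : s'.realArr 2 = s.realArr 2 := hU.realArr 2 (by decide)
      have a8 : ∀ k l, s'.realArr 8 [t, k, l] = s.realArr 8 [t, k, l] :=
        fun k l => I2 _ (by simp)
      have hp' : HasParams m n s' := hp.unchanged hU (by decide)
      have hE := updateEntry_spec hp' r8 r9 r13 r14 hr
      simp only [a0, a2, a8, r12] at hE
      simp only [RAMState.setReg_realArr]
      constructor
      · intro l hl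
        rw [hE]
        rcases Nat.lt_succ_iff_lt_or_eq.1 hl with hl | rfl
        · rw [if_neg (by simp; omega), I1 l hl]
        · rw [if_pos rfl]
      · intro is his
        rw [hE, if_neg (his i), I2 is his])
  rw [hp.reg3, ← hrun] at key
  have hU := (forTo 15 3 updateEntry).unchanged_run s₀
  rw [← hrun] at hU
  refine ⟨fun is => ?_, fun is => ?_, key.1, key.2⟩
  · rw [hU.natArr 0 (by decide)]
    simp [hs₀, run, NatExpr.eval, h8, h9]
  · rw [hU.natArr 1 (by decide)]
    simp [hs₀, run, NatExpr.eval, h8, h9]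

/-- The update of the vertex `v` in round `t` has been carried out in the configuration `s`. -/
def UpdateDone (m n : ℕ) (s : RAMState) (t v : ℕ) : Prop :=
  UpdateSpec m n (fun k j => s.realArr 0 [k, j]) (fun j => s.realArr 2 [j])
    (fun k l => s.realArr 8 [t, k, l]) (fun l => s.realArr 8 [t + 1, v, l])
    (s.natArr 0 [t + 1, v]) (s.natArr 1 [t + 1, v]) v

theorem vertexStep_spec {m n t v : ℕ} {s : RAMState} (hs : HasParams m n s)
    (h8 : s.reg 8 = t) (h9 : s.reg 9 = v) {s₁ : RAMState}
    (hs₁ : s₁ = (scanColumns ;; updateVertex).run s) :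
    UpdateDone m n s₁ t v ∧
    (∀ t' v', (t', v') ≠ (t + 1, v) → s₁.natArr 0 [t', v'] = s.natArr 0 [t', v'] ∧
      s₁.natArr 1 [t', v'] = s.natArr 1 [t', v'] ∧
      ∀ l, s₁.realArr 8 [t', v', l] = s.realArr 8 [t', v', l]) := by
  set s₀ := scanColumns.run s with hs₀
  have hU := scanColumns.unchanged_run s
  rw [← hs₀] at hU
  have hp : HasParams m n s₀ := hs.unchanged hU (by decide)
  obtain ⟨u1, u2, u3, u4⟩ := updateVertex_spec hp ((hU.reg 8 (by decide)).trans h8)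
    ((hU.reg 9 (by decide)).trans h9) (s₁ := s₁) hs₁
  have hU' := (scanColumns ;; updateVertex).unchanged_run s
  rw [← hs₁] at hU'
  have a0 : s₁.realArr 0 = s.realArr 0 := hU'.realArr 0 (by decide)
  have a2 : s₁.realArr 2 = s.realArr 2 := hU'.realArr 2 (by decide)
  have b0 : s₀.realArr 0 = s.realArr 0 := hU.realArr 0 (by decide)
  have b2 : s₀.realArr 2 = s.realArr 2 := hU.realArr 2 (by decide)
  have b8 : s₀.realArr 8 = s.realArr 8 := hU.realArr 8 (by decide)
  have n0 : s₀.natArr 0 = s.natArr 0 := hU.natArr 0 (by decide)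
  have n1 : s₀.natArr 1 = s.natArr 1 := hU.natArr 1 (by decide)
  have a8 : ∀ k l, s₁.realArr 8 [t, k, l] = s.realArr 8 [t, k, l] := fun k l => by
    rw [u4 _ (by simp), b8]
  constructor
  · have hscan := scanColumns_spec hs h8 h9 (fun _ _ => rfl) (fun _ => rfl) (fun _ _ => rfl) hs₀
    simp only [UpdateDone, UpdateSpec, a0, a2, a8, u1, u2, if_true]
    simp only [b0, b2, b8] at u3
    rcases hscan with h | h
    · refine Or.inl ⟨h.1, fun l hl => ?_, h.2⟩
      rw [u3 l hl, h.1]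
      simp
    · refine Or.inr ⟨h.1, h.2.1, h.2.2.1, h.2.2.2.1, h.2.2.2.2, fun l hl => ?_⟩
      rw [u3 l hl, if_pos h.1]
  · intro t' v' hne
    have hne' : [t', v'] ≠ [t + 1, v] := fun h => hne (by simpa using h)
    refine ⟨?_, ?_, fun l => ?_⟩
    · rw [u1, if_neg hne', n0]
    · rw [u2, if_neg hne', n1]
    · rw [u4 _ fun l' h => hne (by simp at h; simp [h.1, h.2.1]), b8]

theorem UpdateDone.of_eq {m n t v : ℕ} {s s' : RAMState} (h : UpdateDone m n s t v)
    (h0 : s'.realArr 0 = s.realArr 0) (h2 : s'.realArr 2 = s.realArr 2)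
    (h8 : ∀ k l, s'.realArr 8 [t, k, l] = s.realArr 8 [t, k, l])
    (h8' : ∀ l, s'.realArr 8 [t + 1, v, l] = s.realArr 8 [t + 1, v, l])
    (hn0 : s'.natArr 0 [t + 1, v] = s.natArr 0 [t + 1, v])
    (hn1 : s'.natArr 1 [t + 1, v] = s.natArr 1 [t + 1, v]) : UpdateDone m n s' t v := by
  unfold UpdateDone at h ⊢
  simpa only [h0, h2, h8, h8', hn0, hn1] using h

theorem round_spec {m n t : ℕ} {s : RAMState} (hs : HasParams m n s) (h8 : s.reg 8 = t)
    {s₁ : RAMState} (hs₁ : s₁ = (forTo 9 2 (scanColumns ;; updateVertex)).run s) :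
    (∀ v ≤ m, UpdateDone m n s₁ t v) ∧
    (∀ t' v', t' ≠ t + 1 → s₁.natArr 0 [t', v'] = s.natArr 0 [t', v'] ∧
      s₁.natArr 1 [t', v'] = s.natArr 1 [t', v'] ∧
      ∀ l, s₁.realArr 8 [t', v', l] = s.realArr 8 [t', v', l]) := by
  have key := run_forTo (r := 9) (b := 2) (P := scanColumns ;; updateVertex) (s := s)
    (fun i s' => (∀ v < i, UpdateDone m n s' t v) ∧
      (∀ t' v', t' ≠ t + 1 → s'.natArr 0 [t', v'] = s.natArr 0 [t', v'] ∧
        s'.natArr 1 [t', v'] = s.natArr 1 [t', v'] ∧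
        ∀ l, s'.realArr 8 [t', v', l] = s.realArr 8 [t', v', l])) (by simp) (by
      intro i s' hi hU hr ⟨I1, I2⟩
      have hp : HasParams m n s' := hs.unchanged hU (by decide)
      have r8 : s'.reg 8 = t := (hU.reg 8 (by decide)).trans h8
      obtain ⟨v1, v2⟩ := vertexStep_spec hp r8 hr rfl
      have hU' := (scanColumns ;; updateVertex).unchanged_run s'
      constructor
      · intro v hv
        refine UpdateDone.of_eq (s := (scanColumns ;; updateVertex).run s') ?_ rfl rfl
          (fun _ _ => rfl) (fun _ => rfl) rfl rfl
        rcases Nat.lt_succ_iff_lt_or_eq.1 hv with hv | rfl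
        · obtain ⟨w1, w2, w3⟩ := v2 (t + 1) v (by simp; omega)
          exact (I1 v hv).of_eq (hU'.realArr 0 (by decide)) (hU'.realArr 2 (by decide))
            (fun k l => (v2 t k (by simp)).2.2 l) w3 w1 w2
        · exact v1
      · intro t' v' ht
        obtain ⟨w1, w2, w3⟩ := v2 t' v' (by simp [ht])
        obtain ⟨x1, x2, x3⟩ := I2 t' v' ht
        exact ⟨w1.trans x1, w2.trans x2, fun l => (w3 l).trans (x3 l)⟩)
  rw [hs.reg2, ← hs₁] at key
  exact ⟨fun v hv => key.1 v (by omega), key.2⟩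

theorem iteration_spec {m n : ℕ} {s : RAMState} (hs : HasParams m n s) {s₁ : RAMState}
    (hs₁ : s₁ = iteration.run s) :
    (∀ t ≤ m, ∀ v ≤ m, UpdateDone m n s₁ t v) ∧
      ∀ v l, s₁.realArr 8 [0, v, l] = s.realArr 8 [0, v, l] := by
  have key := run_forTo (r := 8) (b := 2) (P := forTo 9 2 (scanColumns ;; updateVertex)) (s := s)
    (fun i s' => (∀ t < i, ∀ v ≤ m, UpdateDone m n s' t v) ∧
      ∀ v l, s'.realArr 8 [0, v, l] = s.realArr 8 [0, v, l]) (by simp) (by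
      intro i s' hi hU hr ⟨I1, I2⟩
      have hp : HasParams m n s' := hs.unchanged hU (by decide)
      obtain ⟨v1, v2⟩ := round_spec hp hr rfl
      have hU' := (forTo 9 2 (scanColumns ;; updateVertex)).unchanged_run s'
      constructor
      · intro t ht v hv
        refine UpdateDone.of_eq (s := (forTo 9 2 (scanColumns ;; updateVertex)).run s') ?_ rfl rfl
          (fun _ _ => rfl) (fun _ => rfl) rfl rfl
        rcases Nat.lt_succ_iff_lt_or_eq.1 ht with ht | rfl
        · obtain ⟨w1, w2, w3⟩ := v2 (t + 1) v (by omega)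
          exact (I1 t ht v hv).of_eq (hU'.realArr 0 (by decide)) (hU'.realArr 2 (by decide))
            (fun k l => (v2 t k (by omega)).2.2 l) w3 w1 w2
        · exact v1 v hv
      · intro v l
        exact ((v2 0 v (by omega)).2.2 l).trans (I2 v l))
  rw [hs.reg2, show (forTo 8 2 (forTo 9 2 (scanColumns ;; updateVertex))).run s = s₁ from hs₁.symm]
    at key
  exact ⟨fun t ht v hv => key.1 t (by omega) v hv, key.2⟩

theorem run_cond_pos {p : RAMTest} {P Q : CountingProgram} {s : RAMState} (h : p.Holds s) :
    (cond p P Q).run s = P.run s :=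
  if_pos h

theorem run_cond_neg {p : RAMTest} {P Q : CountingProgram} {s : RAMState} (h : ¬ p.Holds s) :
    (cond p P Q).run s = Q.run s :=
  if_neg h

open Classical in
theorem rootRow_spec {m n : ℕ} {s : RAMState} (hs : HasParams m n s) {s₁ : RAMState}
    (hs₁ : s₁ = rootRow.run s) :
    (∀ j < n, s₁.realArr 0 [m, j] = if ∃ i < m, 0 < s.realArr 0 [i, j] then 0 else 1) ∧
      ∀ i j, i ≠ m → s₁.realArr 0 [i, j] = s.realArr 0 [i, j] := by
  have key := run_forTo (r := 8) (b := 1) (P := storeReal 0 [0, 8] .one ;; forTo 9 0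
    (cond (.realLt .zero (.load 0 [9, 8])) (storeReal 0 [0, 8] .zero) skip)) (s := s)
    (fun j s' => (∀ j' < j, s'.realArr 0 [m, j'] =
        if ∃ i < m, 0 < s.realArr 0 [i, j'] then 0 else 1) ∧
      ∀ i j, i ≠ m → s'.realArr 0 [i, j] = s.realArr 0 [i, j]) (by simp) (by
      intro j s' hj hU hr ⟨I1, I2⟩
      have hp : HasParams m n s' := hs.unchanged hU (by decide)
      have key := run_forTo (r := 9) (b := 0)
        (P := cond (.realLt .zero (.load 0 [9, 8])) (storeReal 0 [0, 8] .zero) skip)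
        (s := (storeReal 0 [0, 8] .one).run s')
        (fun k s'' => (s''.realArr 0 [m, j] = if ∃ i < k, 0 < s.realArr 0 [i, j] then 0 else 1) ∧
          ∀ i j', (i ≠ m ∨ j' ≠ j) → s''.realArr 0 [i, j'] = s'.realArr 0 [i, j'])
        (by
          simp only [run, RAMState.setReg_realArr, RAMState.setReal_realArr, RealExpr.eval,
            List.map_cons, List.map_nil, hp.reg0, hr]
          refine ⟨by simp, fun i j' h => ?_⟩
          rw [if_neg]
          simp only [List.cons.injEq]
          tauto) (by
          intro k s'' hk hU' hr' ⟨J1, J2⟩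
          have r0 : s''.reg 0 = m := (hU'.reg 0 (by decide)).trans hp.reg0
          have r8 : s''.reg 8 = j := (hU'.reg 8 (by decide)).trans hr
          have hkm : k < m := hk.trans_eq hp.reg0
          have hkj : s''.realArr 0 [k, j] = s.realArr 0 [k, j] :=
            (J2 k j (Or.inl hkm.ne)).trans (I2 k j hkm.ne)
          simp only [run, RAMTest.Holds, RealExpr.eval, List.map_cons, List.map_nil, hr', r8,
            RAMState.setReg_realArr, hkj, r0]
          split_ifs with h1 h2 h2
          · refine ⟨by simp, fun i j' h => ?_⟩
            rw [RAMState.setReal_realArr, if_neg, J2 i j' h]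
            simp only [List.cons.injEq]
            tauto
          · exact absurd ⟨k, by omega, h1⟩ h2
          · refine ⟨?_, J2⟩
            rw [J1, if_pos]
            obtain ⟨i, hi, hi'⟩ := h2
            refine ⟨i, lt_of_le_of_ne (by omega) ?_, hi'⟩
            rintro rfl
            exact h1 hi'
          · refine ⟨?_, J2⟩
            rw [J1, if_neg]
            rintro ⟨i, hi, hi'⟩
            exact h2 ⟨i, by omega, hi'⟩)
      rw [show ((storeReal 0 [0, 8] .one).run s').reg 0 = m from hp.reg0] at key
      obtain ⟨J1, J2⟩ := key
      constructor
      · intro j' hj'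
        rcases Nat.lt_succ_iff_lt_or_eq.1 hj' with hj' | rfl
        · exact (J2 m j' (Or.inr hj'.ne)).trans (I1 j' hj')
        · exact J1
      · intro i j' hi
        exact (J2 i j' (Or.inl hi)).trans (I2 i j' hi))
  rw [hs.reg1] at key
  rw [hs₁]
  exact key

theorem initSupply_spec {m n : ℕ} {s : RAMState} (hs : HasParams m n s) {s₁ : RAMState}
    (hs₁ : s₁ = initSupply.run s) (v l : ℕ) : s₁.realArr 8 [0, v, l] =
      if l = n + 1 ∧ v < m then 1 else s.realArr 8 [0, v, l] := by
  have key := run_forTo (r := 9) (b := 0) (P := storeReal 8 [5, 9, 4] .one) (s := s)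
    (fun i s' => ∀ v l, s'.realArr 8 [0, v, l] =
      if l = n + 1 ∧ v < i then 1 else s.realArr 8 [0, v, l]) (by simp) (by
      intro i s' hi hU hr I v l
      have hp : HasParams m n s' := hs.unchanged hU (by decide)
      simp only [run, RAMState.setReg_realArr, RAMState.setReal_realArr, List.map_cons,
        List.map_nil, hr, hp.reg5, hp.reg4, RealExpr.eval, I]
      by_cases hl : l = n + 1 <;> by_cases hv : v = i
      · simp [hl, hv]
      · have : v < i + 1 ↔ v < i := by omega
        simp [hl, hv, this]
      · simp [hl]
      · simp [hl])
  rw [hs.reg0] at key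
  rw [hs₁]
  exact key v l

/-! ### Correctness of the search for a ray -/

theorem findImproved_spec {m n : ℕ} {s : RAMState} (hs : HasParams m n s) {s₁ : RAMState}
    (hs₁ : s₁ = findImproved.run s) :
    (s₁.reg 20 = 1 ∧ s₁.natArr 2 [m + 1] < m ∧ s.natArr 0 [m + 1, s₁.natArr 2 [m + 1]] = 1) ∨
      (s₁.reg 20 = 0 ∧ ∀ v < m, s.natArr 0 [m + 1, v] ≠ 1) := by
  have key := run_forTo (r := 9) (b := 0) (P := cond (.natEq (.load 0 [2, 9]) (.const 1))
    (setReg 20 (.const 1) ;; storeNat 2 [2] (.reg 9)) skip) (s := (setReg 20 (.const 0)).run s)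
    (fun i s' => (s'.reg 20 = 1 ∧ s'.natArr 2 [m + 1] < m ∧
      s.natArr 0 [m + 1, s'.natArr 2 [m + 1]] = 1) ∨
      (s'.reg 20 = 0 ∧ ∀ v < i, s.natArr 0 [m + 1, v] ≠ 1)) (by simp [run, NatExpr.eval]) (by
      intro i s' hi hU hr I
      have r2 : s'.reg 2 = m + 1 := (hU.reg 2 (by decide)).trans hs.reg2
      have n0 : s'.natArr 0 = s.natArr 0 := hU.natArr 0 (by decide)
      have him : i < m := hi.trans_eq hs.reg0
      simp only [run, RAMTest.Holds, NatExpr.eval, List.map_cons, List.map_nil, r2, hr, n0]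
      split_ifs with h
      · left
        simp [r2, hr, him, h]
      · simp only [RAMState.setReg_reg, RAMState.setReg_natArr]
        refine I.imp id fun I => ⟨I.1, fun v hv => ?_⟩
        rcases Nat.lt_succ_iff_lt_or_eq.1 hv with hv | rfl
        · exact I.2 v hv
        · exact h)
  rw [show ((setReg 20 (.const 0)).run s).reg 0 = m from hs.reg0] at key
  rw [hs₁]
  exact key

/-- Predecessors always exist, so following them backwards yields an improvement path. -/
theorem tracePath_spec {m n : ℕ} {s : RAMState} (hs : HasParams m n s) {A : ℕ → ℕ → ℝ} {c : ℕ → ℝ}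
    {X : ℕ → ℕ → ℕ → ℝ} {imp arc : ℕ → ℕ → ℕ} (H : BellmanFordTrace m n A c X imp arc)
    (hA : ∀ k j, s.realArr 0 [k, j] = A k j) (himp : ∀ t v, s.natArr 0 [t, v] = imp t v)
    (harc : ∀ t v, s.natArr 1 [t, v] = arc t v) (hlt : s.natArr 2 [m + 1] < m)
    (hi : imp (m + 1) (s.natArr 2 [m + 1]) = 1) {s₁ : RAMState} (hs₁ : s₁ = tracePath.run s) :
    ImprovementPath m A imp arc fun u => s₁.natArr 2 [u] := by
  have key := run_forTo (r := 8) (b := 0) (P := setReg 21 (.sub (.reg 0) (.reg 8)) ;;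
    setReg 22 (.add (.reg 21) (.const 1)) ;;
    setReg 23 (.load 2 [22]) ;; setReg 24 (.load 1 [22, 23]) ;; forTo 11 0
      (cond (.and (.realLt (.load 0 [11, 24]) .zero) (.natEq (.load 0 [21, 11]) (.const 1)))
        (storeNat 2 [21] (.reg 11)) skip)) (s := s)
    (fun i s' => ∀ u, m + 1 - i ≤ u → u ≤ m + 1 → s'.natArr 2 [u] < m ∧
      imp u (s'.natArr 2 [u]) = 1 ∧
      (u ≤ m → A (s'.natArr 2 [u]) (arc (u + 1) (s'.natArr 2 [u + 1])) < 0))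
    (by
      intro u h1 h2
      obtain rfl : u = m + 1 := by omega
      exact ⟨hlt, hi, fun h => by omega⟩) (by
      intro i s' hi' hU hr I
      have hp : HasParams m n s' := hs.unchanged hU (by decide)
      have him : i < m := hi'.trans_eq hs.reg0
      have a0 : s'.realArr 0 = s.realArr 0 := hU.realArr 0 (by decide)
      have n0 : s'.natArr 0 = s.natArr 0 := hU.natArr 0 (by decide)
      have n1 : s'.natArr 1 = s.natArr 1 := hU.natArr 1 (by decide)
      obtain ⟨w, hw⟩ : ∃ w, m - i = w + 1 := ⟨m - i - 1, by omega⟩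
      obtain ⟨J1, J2, -⟩ := I (w + 2) (by omega) (by omega)
      obtain ⟨k₀, hk₀, hk₁, hk₂⟩ := H.exists_tail_improved (by omega) J1.le J2
      set v := s'.natArr 2 [w + 2] with hv
      set s'' := (setReg 21 (.sub (.reg 0) (.reg 8)) ;; setReg 22 (.add (.reg 21) (.const 1)) ;;
        setReg 23 (.load 2 [22]) ;; setReg 24 (.load 1 [22, 23])).run s' with hs''
      have r21 : s''.reg 21 = w + 1 := by
        simp [hs'', run, NatExpr.eval, hp.reg0, hr, hw]
      have r24 : s''.reg 24 = arc (w + 2) v := by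
        simp [hs'', run, NatExpr.eval, hp.reg0, hr, hw, n1, harc, v]
      have r0 : s''.reg 0 = m := hp.reg0
      have key := run_forTo (r := 11) (b := 0) (P := cond
          (.and (.realLt (.load 0 [11, 24]) .zero) (.natEq (.load 0 [21, 11]) (.const 1)))
          (storeNat 2 [21] (.reg 11)) skip) (s := s'')
        (fun k t => (∀ u, u ≠ w + 1 → t.natArr 2 [u] = s'.natArr 2 [u]) ∧
          (∀ k' < k, A k' (arc (w + 2) v) < 0 → imp (w + 1) k' = 1 →
            t.natArr 2 [w + 1] < m ∧ A (t.natArr 2 [w + 1]) (arc (w + 2) v) < 0 ∧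
              imp (w + 1) (t.natArr 2 [w + 1]) = 1)) (by simp; intros; rfl) (by
          intro k t hk hU' hr' ⟨K1, K2⟩
          have q21 : t.reg 21 = w + 1 := (hU'.reg 21 (by decide)).trans r21
          have q24 : t.reg 24 = arc (w + 2) v := (hU'.reg 24 (by decide)).trans r24
          have b0 : t.realArr 0 = s.realArr 0 := (hU'.realArr 0 (by decide)).trans a0
          have c0 : t.natArr 0 = s.natArr 0 := (hU'.natArr 0 (by decide)).trans n0
          have hkm : k < m := hk.trans_eq r0
          simp only [run, RAMTest.Holds, RealExpr.eval, NatExpr.eval, List.map_cons, List.map_nil,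
            q21, q24, b0, c0, hr', hA, himp]
          split_ifs with h
          · constructor
            · intro u hu
              simp [hu, K1 u hu]
            · intro k' _ _ _
              simpa using ⟨hkm, h⟩
          · refine ⟨K1, fun k' hk' h1 h2 => ?_⟩
            rcases Nat.lt_succ_iff_lt_or_eq.1 hk' with hk' | rfl
            · exact K2 k' hk' h1 h2
            · exact absurd ⟨h1, h2⟩ h)
      rw [r0] at key
      obtain ⟨K1, K2⟩ := key
      have K3 := K2 k₀ hk₀ hk₁ hk₂
      intro u hu1 hu2
      change (RAMState.natArr ((forTo 11 0 _).run s'') 2 [u]) < m ∧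
        imp u (RAMState.natArr ((forTo 11 0 _).run s'') 2 [u]) = 1 ∧
        (u ≤ m → A (RAMState.natArr ((forTo 11 0 _).run s'') 2 [u])
          (arc (u + 1) (RAMState.natArr ((forTo 11 0 _).run s'') 2 [u + 1])) < 0)
      rcases eq_or_ne u (w + 1) with rfl | hne
      · rw [K1 (w + 1 + 1) (by omega)]
        exact ⟨K3.1, K3.2.2, fun _ => K3.2.1⟩
      · rw [K1 u hne, K1 (u + 1) (by omega)]
        exact I u (by omega) hu2)
  rw [hs.reg0, show (forTo 8 0 _).run s = s₁ from hs₁.symm] at key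
  refine ⟨fun u h1 h2 => (key u (by omega) h2).1, fun u h1 h2 => (key u (by omega) h2).2.1,
    fun u h1 h2 => (key u (by omega) (by omega)).2.2 h2⟩

/-- The state of the search for the last repetition of `p`, after the pairs in `D` have been
visited. -/
def SearchInv (m : ℕ) (p : ℕ → ℕ) (D : ℕ → ℕ → Prop) (s : RAMState) : Prop :=
  (s.reg 16 = 0 ∧ ∀ s' t', 1 ≤ s' → s' < t' → t' ≤ m + 1 → p t' = p s' → ¬ D s' t') ∨
    (s.reg 16 = 1 ∧ s.reg 17 = p (s.reg 19) ∧ 1 ≤ s.reg 19 ∧ s.reg 19 < s.reg 18 ∧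
      s.reg 18 ≤ m + 1 ∧ p (s.reg 18) = p (s.reg 19) ∧ D (s.reg 19) (s.reg 18) ∧
      ∀ s' t', 1 ≤ s' → s' < t' → t' ≤ m + 1 → p t' = p s' → D s' t' → s' ≤ s.reg 19)

theorem SearchInv.congr {m : ℕ} {p : ℕ → ℕ} {D D' : ℕ → ℕ → Prop} {s s' : RAMState}
    (h : SearchInv m p D s)
    (hD : ∀ i j, 1 ≤ i → i < j → j ≤ m + 1 → p j = p i → (D i j ↔ D' i j))
    (h16 : s'.reg 16 = s.reg 16) (h17 : s'.reg 17 = s.reg 17) (h18 : s'.reg 18 = s.reg 18)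
    (h19 : s'.reg 19 = s.reg 19) : SearchInv m p D' s' := by
  unfold SearchInv at h ⊢
  rw [h16, h17, h18, h19]
  rcases h with h | h
  · exact Or.inl ⟨h.1, fun i j a b c d => (hD i j a b c d).not.1 (h.2 i j a b c d)⟩
  · obtain ⟨h1, h2, h3, h4, h5, h6, h7, h8⟩ := h
    exact Or.inr ⟨h1, h2, h3, h4, h5, h6, (hD _ _ h3 h4 h5 h6).1 h7,
      fun i j a b c d e => h8 i j a b c d ((hD i j a b c d).2 e)⟩

theorem findRepetition_spec {m n : ℕ} {s : RAMState} (hs : HasParams m n s) {p : ℕ → ℕ}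
    (hp : ∀ u, s.natArr 2 [u] = p u) (hlt : ∀ u, 1 ≤ u → u ≤ m + 1 → p u < m)
    (h16 : s.reg 16 = 0) {s₁ : RAMState} (hs₁ : s₁ = findRepetition.run s) :
    s₁.reg 16 = 1 ∧ s₁.reg 17 = p (s₁.reg 19) ∧ LastRepetition m p (s₁.reg 19) (s₁.reg 18) := by
  have key := run_forTo (r := 8) (b := 2) (P := forTo 9 2 (setReg 21 (.add (.reg 9) (.const 1)) ;;
    cond (.and (.and (.natLt (.const 0) (.reg 8)) (.natLt (.reg 8) (.reg 21)))
        (.natEq (.load 2 [8]) (.load 2 [21])))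
      (setReg 16 (.const 1) ;; setReg 17 (.load 2 [8]) ;; setReg 18 (.reg 21) ;;
        setReg 19 (.reg 8)) skip)) (s := s)
    (fun i s' => SearchInv m p (fun i' _ => i' < i) s')
    (Or.inl ⟨by simpa using h16, by simp⟩) (by
      intro i s' hi hU hr I
      have hq : HasParams m n s' := hs.unchanged hU (by decide)
      have n2 : s'.natArr 2 = s.natArr 2 := hU.natArr 2 (by decide)
      have key := run_forTo (r := 9) (b := 2) (P := setReg 21 (.add (.reg 9) (.const 1)) ;;
        cond (.and (.and (.natLt (.const 0) (.reg 8)) (.natLt (.reg 8) (.reg 21)))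
            (.natEq (.load 2 [8]) (.load 2 [21])))
          (setReg 16 (.const 1) ;; setReg 17 (.load 2 [8]) ;; setReg 18 (.reg 21) ;;
            setReg 19 (.reg 8)) skip) (s := s')
        (fun j t => SearchInv m p (fun i' j' => i' < i ∨ (i' = i ∧ j' < j + 1)) t)
        (I.congr (by omega) (by simp) (by simp) (by simp) (by simp)) (by
          intro j t hj hU' hr' J
          have r8 : t.reg 8 = i := (hU'.reg 8 (by decide)).trans hr
          have c2 : t.natArr 2 = s.natArr 2 := (hU'.natArr 2 (by decide)).trans n2
          have hjm : j < m + 1 := hj.trans_eq hq.reg2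
          simp only [run, RAMTest.Holds, NatExpr.eval, List.map_cons, List.map_nil,
            RAMState.setReg_reg, RAMState.setReg_natArr, r8, hr', c2, hp, if_true,
            Nat.reduceEqDiff, if_false]
          split_ifs with h
          · right
            simp only [RAMState.setReg_reg, if_true, Nat.reduceEqDiff, if_false]
            refine ⟨trivial, trivial, by omega, by omega, by omega, h.2.symm,
              Or.inr ⟨trivial, Nat.lt_succ_self _⟩, ?_⟩
            intro i' j' _ _ _ _ hD
            omega
          · refine J.congr (fun i' j' h1 h2 h3 h4 => ?_) (by simp) (by simp) (by simp) (by simp)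
            have : ¬ (i' = i ∧ j' = j + 1) := by
              rintro ⟨rfl, rfl⟩
              exact h ⟨⟨by omega, by omega⟩, h4.symm⟩
            omega)
      rw [hq.reg2] at key
      exact key.congr (by omega) (by simp) (by simp) (by simp) (by simp))
  rw [hs.reg2, show (forTo 8 2 _).run s = s₁ from hs₁.symm] at key
  rcases key with h | ⟨h1, h2, h3, h4, h5, h6, -, h8⟩
  · obtain ⟨i, j, a, b, c, d⟩ := exists_repetition hlt
    exact absurd (by omega) (h.2 i j a b c d)
  · exact ⟨h1, h2, h3, h4, h5, h6, fun i j a b c d => h8 i j a b c d (by omega)⟩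

theorem findRay_spec {m n : ℕ} {s : RAMState} (hs : HasParams m n s) {A : ℕ → ℕ → ℝ} {c : ℕ → ℝ}
    {X : ℕ → ℕ → ℕ → ℝ} {imp arc : ℕ → ℕ → ℕ} (H : BellmanFordTrace m n A c X imp arc)
    (hG : CycleWeightsGeOne m n A)
    (hA : ∀ k j, s.realArr 0 [k, j] = A k j) (himp : ∀ t v, s.natArr 0 [t, v] = imp t v)
    (harc : ∀ t v, s.natArr 1 [t, v] = arc t v) (hX : ∀ t v l, s.realArr 8 [t, v, l] = X t v l)
    {s₁ : RAMState} (hs₁ : s₁ = findRay.run s) :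
    (s₁.reg 16 = 1 ∧
      (∀ i < m, ∑ l ∈ Finset.range n, A i l *
        (X (s₁.reg 18) (s₁.reg 17) l - X (s₁.reg 19) (s₁.reg 17) l) = 0) ∧
      ∑ l ∈ Finset.range n, c l *
        (X (s₁.reg 18) (s₁.reg 17) l - X (s₁.reg 19) (s₁.reg 17) l) < 0 ∧
      ∀ l < n, 0 ≤ X (s₁.reg 18) (s₁.reg 17) l - X (s₁.reg 19) (s₁.reg 17) l) ∨
    (s₁.reg 16 = 0 ∧ ¬ vertexKey n (X (m + 1)) m < 0 ∧ ∀ v < m, imp (m + 1) v ≠ 1) := by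
  set s₂ := (setReg 16 (.const 0)).run s with hs₂
  have p₂ : HasParams m n s₂ := hs.unchanged (unchanged_run _ s) (by decide)
  have hroot : (lexLt (.load 8 [2, 0, 4]) (.load 8 [2, 0, 1]) .zero .zero).Holds s₂ ↔
      vertexKey n (X (m + 1)) m < 0 := by
    rw [lexLt_holds]
    simp only [RealExpr.eval, List.map_cons, List.map_nil, p₂.reg0, p₂.reg1, p₂.reg2, p₂.reg4]
    rw [show s₂.realArr = s.realArr from rfl, hX, hX]
    rfl
  have hrun : s₁ = (cond (lexLt (.load 8 [2, 0, 4]) (.load 8 [2, 0, 1]) .zero .zero)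
    (setReg 16 (.const 1) ;; setReg 17 (.reg 0) ;; setReg 18 (.reg 2) ;; setReg 19 (.const 0))
    (findImproved ;;
      cond (.natEq (.reg 20) (.const 1)) (tracePath ;; findRepetition) skip)).run s₂ := hs₁
  by_cases h1 : vertexKey n (X (m + 1)) m < 0
  · left
    rw [run_cond_pos (hroot.2 h1)] at hrun
    have e16 : s₁.reg 16 = 1 := by simp [hrun, run, NatExpr.eval]
    have e17 : s₁.reg 17 = m := by simp [hrun, run, NatExpr.eval, p₂.reg0]
    have e18 : s₁.reg 18 = m + 1 := by simp [hrun, run, NatExpr.eval, p₂.reg2]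
    have e19 : s₁.reg 19 = 0 := by simp [hrun, run, NatExpr.eval]
    rw [e16, e17, e18, e19]
    exact ⟨rfl, H.ray_of_root h1⟩
  rw [run_cond_neg (hroot.not.2 h1)] at hrun
  have U₃ := findImproved.unchanged_run s₂
  have spec₃ := findImproved_spec p₂ rfl
  set s₃ := findImproved.run s₂ with hs₃
  have r16 : s₃.reg 16 = 0 := by
    rw [U₃.reg 16 (by decide)]
    simp [hs₂, run, NatExpr.eval]
  have e0 : ∀ t v, s₂.natArr 0 [t, v] = imp t v := himp
  replace hrun : s₁ =
    (cond (.natEq (.reg 20) (.const 1)) (tracePath ;; findRepetition) skip).run s₃ := hrun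
  rcases spec₃ with ⟨h20, hlt, hi⟩ | ⟨h20, hno⟩
  · left
    rw [run_cond_pos (show (RAMTest.natEq (.reg 20) (.const 1)).Holds s₃ from h20)] at hrun
    have U₄ := tracePath.unchanged_run s₃
    have p₃ : HasParams m n s₃ := p₂.unchanged U₃ (by decide)
    rw [e0] at hi
    have hpath := tracePath_spec p₃ H
      (fun k j => by rw [U₃.realArr 0 (by decide)]; exact hA k j)
      (fun t v => by rw [U₃.natArr 0 (by decide)]; exact himp t v)
      (fun t v => by rw [U₃.natArr 1 (by decide)]; exact harc t v) hlt hi rfl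
    set s₄ := tracePath.run s₃ with hs₄
    have p₄ : HasParams m n s₄ := p₃.unchanged U₄ (by decide)
    obtain ⟨f1, f2, f3⟩ := findRepetition_spec p₄ (fun _ => rfl) hpath.lt
      ((U₄.reg 16 (by decide)).trans r16) hrun
    refine ⟨f1, ?_⟩
    rw [f2]
    exact H.ray_of_cycle hG hpath f3
  · right
    rw [run_cond_neg (show ¬ (RAMTest.natEq (.reg 20) (.const 1)).Holds s₃ by
      simp [RAMTest.Holds, NatExpr.eval, h20])] at hrun
    rw [hrun]
    exact ⟨r16, h1, fun v hv => by rw [← himp]; exact hno v hv⟩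

/-! ### Correctness of the output -/

theorem totalSupply_spec {m n : ℕ} {s : RAMState} (hs : HasParams m n s) {s₁ : RAMState}
    (hs₁ : s₁ = totalSupply.run s) : s₁.realArr 14 [] =
      ∑ i ∈ Finset.range m, s.realArr 1 [i] * s.realArr 8 [m, i, n + 1] := by
  have key := run_forTo (r := 8) (b := 0)
    (P := storeReal 14 [] (.add (.load 14 []) (.mul (.load 1 [8]) (.load 8 [0, 8, 4]))))
    (s := (storeReal 14 [] .zero).run s)
    (fun i s' => s'.realArr 14 [] =
      ∑ i ∈ Finset.range i, s.realArr 1 [i] * s.realArr 8 [m, i, n + 1])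
    (by simp [run, RealExpr.eval]) (by
      intro i s' hi hU hr I
      have r0 : s'.reg 0 = m := (hU.reg 0 (by decide)).trans hs.reg0
      have r4 : s'.reg 4 = n + 1 := (hU.reg 4 (by decide)).trans hs.reg4
      have a1 : s'.realArr 1 = s.realArr 1 := hU.realArr 1 (by decide)
      have a8 : s'.realArr 8 = s.realArr 8 := hU.realArr 8 (by decide)
      simp [run, RealExpr.eval, r0, r4, hr, a1, a8, I, Finset.sum_range_succ])
  rw [show ((storeReal 14 [] .zero).run s).reg 0 = m from hs.reg0,
    show (forTo 8 0 _).run _ = s₁ from hs₁.symm] at key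
  exact key

theorem writePrimal_spec {m n : ℕ} {s : RAMState} (hs : HasParams m n s) {s₁ : RAMState}
    (hs₁ : s₁ = writePrimal.run s) {j : ℕ} (hj : j < n) : s₁.realArr 3 [j] =
      ∑ i ∈ Finset.range m, s.realArr 1 [i] * s.realArr 8 [m, i, j] := by
  have key := run_forTo (r := 8) (b := 1) (P := storeReal 3 [8] .zero ;; forTo 9 0
    (storeReal 3 [8] (.add (.load 3 [8]) (.mul (.load 1 [9]) (.load 8 [0, 9, 8]))))) (s := s)
    (fun j s' => ∀ j' < j, s'.realArr 3 [j'] =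
      ∑ i ∈ Finset.range m, s.realArr 1 [i] * s.realArr 8 [m, i, j']) (by simp) (by
      intro j s' hj hU hr I
      have hp : HasParams m n s' := hs.unchanged hU (by decide)
      have a1 : s'.realArr 1 = s.realArr 1 := hU.realArr 1 (by decide)
      have a8 : s'.realArr 8 = s.realArr 8 := hU.realArr 8 (by decide)
      have key := run_forTo (r := 9) (b := 0)
        (P := storeReal 3 [8] (.add (.load 3 [8]) (.mul (.load 1 [9]) (.load 8 [0, 9, 8]))))
        (s := (storeReal 3 [8] .zero).run s')
        (fun i t => (t.realArr 3 [j] =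
          ∑ i ∈ Finset.range i, s.realArr 1 [i] * s.realArr 8 [m, i, j]) ∧
          ∀ j', j' ≠ j → t.realArr 3 [j'] = s'.realArr 3 [j'])
        (by
          simp only [run, RAMState.setReg_realArr, RAMState.setReal_realArr, List.map_cons,
            List.map_nil, hr, RealExpr.eval]
          exact ⟨by simp, fun j' hj' => by simp [hj']⟩) (by
          intro i t hi hU' hr' ⟨J1, J2⟩
          have r0 : t.reg 0 = m := (hU'.reg 0 (by decide)).trans hp.reg0
          have r8 : t.reg 8 = j := (hU'.reg 8 (by decide)).trans hr
          have b1 : t.realArr 1 = s.realArr 1 := (hU'.realArr 1 (by decide)).trans a1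
          have b8 : t.realArr 8 = s.realArr 8 := (hU'.realArr 8 (by decide)).trans a8
          simp only [run, RAMState.setReg_realArr, RAMState.setReal_realArr, List.map_cons,
            List.map_nil, hr', r0, r8, b1, b8, RealExpr.eval, J1, Finset.sum_range_succ]
          exact ⟨by simp, fun j' hj' => by simp [hj', J2 j' hj']⟩)
      rw [show ((storeReal 3 [8] .zero).run s').reg 0 = m from hp.reg0] at key
      obtain ⟨J1, J2⟩ := key
      intro j' hj'
      rcases Nat.lt_succ_iff_lt_or_eq.1 hj' with hj' | rfl
      · exact (J2 j' hj'.ne).trans (I j' hj')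
      · exact J1)
  rw [hs.reg1, show (forTo 8 1 _).run _ = s₁ from hs₁.symm] at key
  exact key j hj

theorem writeFarkas_spec {m n : ℕ} {s : RAMState} (hs : HasParams m n s) {s₁ : RAMState}
    (hs₁ : s₁ = writeFarkas.run s) {i : ℕ} (hi : i < m) :
    s₁.realArr 5 [i] = s.realArr 8 [m, i, n + 1] := by
  have key := run_forTo (r := 8) (b := 0) (P := storeReal 5 [8] (.load 8 [0, 8, 4])) (s := s)
    (fun i s' => ∀ i' < i, s'.realArr 5 [i'] = s.realArr 8 [m, i', n + 1]) (by simp) (by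
      intro i s' hi hU hr I i' hi'
      have hp : HasParams m n s' := hs.unchanged hU (by decide)
      have a8 : s'.realArr 8 = s.realArr 8 := hU.realArr 8 (by decide)
      rcases Nat.lt_succ_iff_lt_or_eq.1 hi' with hi' | rfl
      · simp [run, hr, hi'.ne, I i' hi']
      · simp [run, RealExpr.eval, hr, hp.reg0, hp.reg4, a8])
  rw [hs.reg0, show (forTo 8 0 _).run _ = s₁ from hs₁.symm] at key
  exact key i hi

theorem writeRay_spec {m n : ℕ} {s : RAMState} (hs : HasParams m n s) {s₁ : RAMState}
    (hs₁ : s₁ = writeRay.run s) {j : ℕ} (hj : j < n) :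
    s₁.realArr 4 [j] = s.realArr 8 [s.reg 18, s.reg 17, j] -
      s.realArr 8 [s.reg 19, s.reg 17, j] := by
  have key := run_forTo (r := 8) (b := 1)
    (P := storeReal 4 [8] (.sub (.load 8 [18, 17, 8]) (.load 8 [19, 17, 8]))) (s := s)
    (fun j s' => ∀ j' < j, s'.realArr 4 [j'] = s.realArr 8 [s.reg 18, s.reg 17, j'] -
      s.realArr 8 [s.reg 19, s.reg 17, j']) (by simp) (by
      intro j s' hj hU hr I j' hj'
      have r17 : s'.reg 17 = s.reg 17 := hU.reg 17 (by decide)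
      have r18 : s'.reg 18 = s.reg 18 := hU.reg 18 (by decide)
      have r19 : s'.reg 19 = s.reg 19 := hU.reg 19 (by decide)
      have a8 : s'.realArr 8 = s.realArr 8 := hU.realArr 8 (by decide)
      rcases Nat.lt_succ_iff_lt_or_eq.1 hj' with hj' | rfl
      · simp [run, hr, hj'.ne, I j' hj']
      · simp [run, RealExpr.eval, hr, r17, r18, r19, a8])
  rw [hs.reg1, show (forTo 8 1 _).run _ = s₁ from hs₁.symm] at key
  exact key j hj

theorem slackViolation_spec {m n j : ℕ} {s : RAMState} (hs : HasParams m n s) (h10 : s.reg 10 = j)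
    {s₁ : RAMState} (hs₁ : s₁ = slackViolation.run s) :
    s₁.realArr 15 [] = 0 - ∑ k ∈ Finset.range m, s.realArr 0 [k, j] * s.realArr 8 [m, k, n + 1] ∧
    s₁.realArr 16 [] = 0 - s.realArr 2 [j] +
      ∑ k ∈ Finset.range m, s.realArr 0 [k, j] * s.realArr 8 [m, k, n] := by
  have key := run_forTo (r := 11) (b := 0)
    (P := storeReal 15 [] (.sub (.load 15 []) (.mul (.load 0 [11, 10]) (.load 8 [0, 11, 4]))) ;;
      storeReal 16 [] (.add (.load 16 []) (.mul (.load 0 [11, 10]) (.load 8 [0, 11, 1]))))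
    (s := (storeReal 15 [] .zero ;; storeReal 16 [] (.sub .zero (.load 2 [10]))).run s)
    (fun i s' =>
      s'.realArr 15 [] = 0 - ∑ k ∈ Finset.range i, s.realArr 0 [k, j] * s.realArr 8 [m, k, n + 1] ∧
      s'.realArr 16 [] = 0 - s.realArr 2 [j] +
        ∑ k ∈ Finset.range i, s.realArr 0 [k, j] * s.realArr 8 [m, k, n])
    (by simp [run, RealExpr.eval, h10]) (by
      intro i s' hi hU hr ⟨I1, I2⟩
      have r0 : s'.reg 0 = m := (hU.reg 0 (by decide)).trans hs.reg0
      have r1 : s'.reg 1 = n := (hU.reg 1 (by decide)).trans hs.reg1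
      have r4 : s'.reg 4 = n + 1 := (hU.reg 4 (by decide)).trans hs.reg4
      have r10 : s'.reg 10 = j := (hU.reg 10 (by decide)).trans h10
      have a0 : s'.realArr 0 = s.realArr 0 := hU.realArr 0 (by decide)
      have a8 : s'.realArr 8 = s.realArr 8 := hU.realArr 8 (by decide)
      simp [run, RealExpr.eval, r0, r1, r4, r10, hr, a0, a8, I1, I2, Finset.sum_range_succ]
      constructor <;> ring)
  rw [show ((storeReal 15 [] .zero ;; storeReal 16 [] (.sub .zero (.load 2 [10]))).run s).reg 0 = m
    from hs.reg0] at key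
  rw [hs₁]
  exact key

theorem findRatio_spec {m n : ℕ} {s : RAMState} (hs : HasParams m n s) {s₁ : RAMState}
    (hs₁ : s₁ = findRatio.run s) : 0 ≤ s₁.realArr 13 [] ∧ 0 < s₁.realArr 7 [] ∧
      ∀ j < n, 0 < 0 - ∑ k ∈ Finset.range m, s.realArr 0 [k, j] * s.realArr 8 [m, k, n + 1] →
        (0 - s.realArr 2 [j] + ∑ k ∈ Finset.range m, s.realArr 0 [k, j] * s.realArr 8 [m, k, n]) *
          s₁.realArr 7 [] ≤ s₁.realArr 13 [] *
          (0 - ∑ k ∈ Finset.range m, s.realArr 0 [k, j] * s.realArr 8 [m, k, n + 1]) := by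
  set α : ℕ → ℝ := fun j =>
    0 - ∑ k ∈ Finset.range m, s.realArr 0 [k, j] * s.realArr 8 [m, k, n + 1] with hα
  set β : ℕ → ℝ := fun j =>
    0 - s.realArr 2 [j] + ∑ k ∈ Finset.range m, s.realArr 0 [k, j] * s.realArr 8 [m, k, n] with hβ
  have key := run_forTo (r := 10) (b := 1) (P := slackViolation ;;
    cond (.and (.realLt .zero (.load 15 []))
        (.realLt (.mul (.load 13 []) (.load 15 [])) (.mul (.load 16 []) (.load 7 []))))
      (storeReal 13 [] (.load 16 []) ;; storeReal 7 [] (.load 15 [])) skip)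
    (s := (storeReal 13 [] .zero ;; storeReal 7 [] .one).run s)
    (fun i s' => 0 ≤ s'.realArr 13 [] ∧ 0 < s'.realArr 7 [] ∧
      ∀ j < i, 0 < α j → β j * s'.realArr 7 [] ≤ s'.realArr 13 [] * α j)
    (by simp [run, RealExpr.eval]) (by
      intro i s' hi hU hr ⟨I1, I2, I3⟩
      have hp : HasParams m n s' := HasParams.unchanged
        (s := (storeReal 13 [] .zero ;; storeReal 7 [] .one).run s)
        ⟨hs.reg0, hs.reg1, hs.reg2, hs.reg3, hs.reg4, hs.reg5⟩ hU (by decide)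
      have a0 : s'.realArr 0 = s.realArr 0 := hU.realArr 0 (by decide)
      have a2 : s'.realArr 2 = s.realArr 2 := hU.realArr 2 (by decide)
      have a8 : s'.realArr 8 = s.realArr 8 := hU.realArr 8 (by decide)
      obtain ⟨e1, e2⟩ := slackViolation_spec hp hr rfl
      rw [a0, a8] at e1
      rw [a0, a2, a8] at e2
      have U := slackViolation.unchanged_run s'
      have u13 : (slackViolation.run s').realArr 13 = s'.realArr 13 := U.realArr 13 (by decide)
      have u7 : (slackViolation.run s').realArr 7 = s'.realArr 7 := U.realArr 7 (by decide)
      simp only [run, RAMTest.Holds, RealExpr.eval, List.map_nil, e1, e2, u13, u7]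
      change (0 ≤ _ ∧ 0 < _ ∧ _)
      split_ifs with h
      · simp only [RAMState.setReg_realArr, RAMState.setReal_realArr, Nat.reduceEqDiff,
          if_false, if_true, and_true, e1]
        change 0 < α i ∧ s'.realArr 13 [] * α i < β i * s'.realArr 7 [] at h
        change 0 ≤ β i ∧ 0 < α i ∧ ∀ j < i + 1, 0 < α j → β j * α i ≤ β i * α j
        refine ⟨?_, h.1, fun j hj hαj => ?_⟩
        · have : 0 < β i * s'.realArr 7 [] := (mul_nonneg I1 h.1.le).trans_lt h.2
          exact (pos_of_mul_pos_left this I2.le).le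
        · rcases Nat.lt_succ_iff_lt_or_eq.1 hj with hj | rfl
          · have h1 := mul_le_mul_of_nonneg_right (I3 j hj hαj) h.1.le
            have h2 := mul_le_mul_of_nonneg_right h.2.le hαj.le
            -- Compare the ratios `β j / α j ≤ N / D < β i / α i`.
            refine le_of_mul_le_mul_right ?_ I2
            linarith
          · exact le_rfl
      · simp only [RAMState.setReg_realArr, u13, u7]
        refine ⟨I1, I2, fun j hj hαj => ?_⟩
        rcases Nat.lt_succ_iff_lt_or_eq.1 hj with hj | rfl
        · exact I3 j hj hαj
        · exact not_lt.1 fun h' => h ⟨hαj, h'⟩)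
  rw [show ((storeReal 13 [] .zero ;; storeReal 7 [] .one).run s).reg 1 = n
    from hs.reg1] at key
  rw [hs₁]
  exact key

theorem writeDual_spec {m n : ℕ} {s : RAMState} (hs : HasParams m n s) {s₁ : RAMState}
    (hs₁ : s₁ = writeDual.run s) {i : ℕ} (hi : i < m) :
    s₁.realArr 6 [i] = s.realArr 7 [] * s.realArr 8 [m, i, n] +
      s.realArr 13 [] * s.realArr 8 [m, i, n + 1] := by
  have key := run_forTo (r := 8) (b := 0) (P := storeReal 6 [8]
    (.add (.mul (.load 7 []) (.load 8 [0, 8, 1])) (.mul (.load 13 []) (.load 8 [0, 8, 4]))))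
    (s := s) (fun i s' => ∀ i' < i, s'.realArr 6 [i'] = s.realArr 7 [] * s.realArr 8 [m, i', n] +
      s.realArr 13 [] * s.realArr 8 [m, i', n + 1]) (by simp) (by
      intro i s' hi hU hr I i' hi'
      have hp : HasParams m n s' := hs.unchanged hU (by decide)
      have a8 : s'.realArr 8 = s.realArr 8 := hU.realArr 8 (by decide)
      have a7 : s'.realArr 7 = s.realArr 7 := hU.realArr 7 (by decide)
      have a13 : s'.realArr 13 = s.realArr 13 := hU.realArr 13 (by decide)
      rcases Nat.lt_succ_iff_lt_or_eq.1 hi' with hi' | rfl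
      · simp [run, hr, hi'.ne, I i' hi']
      · simp [run, RealExpr.eval, hr, hp.reg0, hp.reg1, hp.reg4, a8, a7, a13])
  rw [hs.reg0, show (forTo 8 0 _).run _ = s₁ from hs₁.symm] at key
  exact key i hi

/-- The constraint with slack `α` for the artificial supplies and violation `β` for the costs holds
after `N / D` times the artificial supplies are added to the costs. -/
theorem le_of_ratio {α β N D : ℝ} (hD : 0 < D) (hα : 0 ≤ α) (h0 : α = 0 → β ≤ 0)
    (h : 0 < α → β * D ≤ N * α) : β * D ≤ N * α := by
  rcases hα.eq_or_lt with h' | h'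
  · rw [← h', mul_zero]
    exact mul_nonpos_of_nonpos_of_nonneg (h0 h'.symm) hD.le
  · exact h h'

theorem writeOutput_spec {m n : ℕ} {s : RAMState} (hs : HasParams m n s) {A : ℕ → ℕ → ℝ}
    {b c : ℕ → ℝ} {X : ℕ → ℕ → ℕ → ℝ} {imp arc : ℕ → ℕ → ℕ}
    (H : BellmanFordTrace m n A c X imp arc) (hG : CycleWeightsGeOne m n A)
    (hA : ∀ k j, s.realArr 0 [k, j] = A k j) (hb : ∀ i, s.realArr 1 [i] = b i)
    (hc : ∀ j, s.realArr 2 [j] = c j) (hX : ∀ t v l, s.realArr 8 [t, v, l] = X t v l)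
    (hfix : s.reg 16 = 0 → ¬ vertexKey n (X (m + 1)) m < 0 ∧ ∀ v < m, imp (m + 1) v ≠ 1)
    {s₁ : RAMState} (hs₁ : s₁ = writeOutput.run s) :
    (∀ j < n, s₁.realArr 3 [j] = ∑ i ∈ Finset.range m, b i * X m i j) ∧
    (∀ j < n, s₁.realArr 4 [j] = X (s.reg 18) (s.reg 17) j - X (s.reg 19) (s.reg 17) j) ∧
    (∀ i < m, s₁.realArr 5 [i] = X m i (n + 1)) ∧
    (s.reg 16 = 0 → 0 < s₁.realArr 7 [] ∧
      (∀ j < n, ∑ i ∈ Finset.range m, A i j * s₁.realArr 6 [i] ≤ s₁.realArr 7 [] * c j) ∧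
      (∑ i ∈ Finset.range m, b i * X m i (n + 1) = 0 →
        ∑ i ∈ Finset.range m, b i * s₁.realArr 6 [i] =
          s₁.realArr 7 [] * ∑ j ∈ Finset.range n, c j * s₁.realArr 3 [j])) ∧
    (s.reg 16 = 1 → (∑ i ∈ Finset.range m, b i * X m i (n + 1) = 0 → s₁.reg 25 = 3) ∧
      (∑ i ∈ Finset.range m, b i * X m i (n + 1) ≠ 0 → s₁.reg 25 = 4)) ∧
    (s.reg 16 = 0 → (∑ i ∈ Finset.range m, b i * X m i (n + 1) = 0 → s₁.reg 25 = 1) ∧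
      (∑ i ∈ Finset.range m, b i * X m i (n + 1) ≠ 0 → s₁.reg 25 = 2)) := by
  have U1 := totalSupply.unchanged_run s
  have e1 := totalSupply_spec hs rfl
  set t1 := totalSupply.run s
  have p1 : HasParams m n t1 := hs.unchanged U1 (by decide)
  have U2 := writePrimal.unchanged_run t1
  have e2 := fun j hj => writePrimal_spec (j := j) p1 rfl hj
  set t2 := writePrimal.run t1
  have p2 : HasParams m n t2 := p1.unchanged U2 (by decide)
  have U3 := writeFarkas.unchanged_run t2
  have e3 := fun i hi => writeFarkas_spec (i := i) p2 rfl hi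
  set t3 := writeFarkas.run t2
  have p3 : HasParams m n t3 := p2.unchanged U3 (by decide)
  have U4 := writeRay.unchanged_run t3
  have e4 := fun j hj => writeRay_spec (j := j) p3 rfl hj
  set t4 := writeRay.run t3
  have p4 : HasParams m n t4 := p3.unchanged U4 (by decide)
  have U5 := findRatio.unchanged_run t4
  have e5 := findRatio_spec p4 rfl
  set t5 := findRatio.run t4
  have p5 : HasParams m n t5 := p4.unchanged U5 (by decide)
  have U6 := writeDual.unchanged_run t5
  have e6 := fun i hi => writeDual_spec (i := i) p5 rfl hi
  set t6 := writeDual.run t5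
  have U7 := decideCase.unchanged_run t6
  have hrun : s₁ = decideCase.run t6 := hs₁
  rw [← hrun] at U7
  -- The input and the history stay as they are.
  have in1 : ∀ a ∈ [0, 1, 2, 8], t1.realArr a = s.realArr a := fun a ha =>
    U1.realArr a (by revert a; decide)
  have in2 : ∀ a ∈ [0, 1, 2, 8], t2.realArr a = s.realArr a := fun a ha =>
    (U2.realArr a (by revert a; decide)).trans (in1 a ha)
  have in3 : ∀ a ∈ [0, 1, 2, 8], t3.realArr a = s.realArr a := fun a ha =>
    (U3.realArr a (by revert a; decide)).trans (in2 a ha)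
  have in4 : ∀ a ∈ [0, 1, 2, 8], t4.realArr a = s.realArr a := fun a ha =>
    (U4.realArr a (by revert a; decide)).trans (in3 a ha)
  have in5 : ∀ a ∈ [0, 1, 2, 8], t5.realArr a = s.realArr a := fun a ha =>
    (U5.realArr a (by revert a; decide)).trans (in4 a ha)
  simp only [hb, hX] at e1
  simp only [in1 1 (by simp), in1 8 (by simp), hb, hX] at e2
  simp only [in2 8 (by simp), hX] at e3
  simp only [in3 8 (by simp), hX] at e4
  simp only [in4 0 (by simp), in4 2 (by simp), in4 8 (by simp), hA, hc, hX] at e5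
  simp only [in5 8 (by simp), hX] at e6
  -- Where the outputs end up.
  have o3 : s₁.realArr 3 = t2.realArr 3 := by
    rw [U7.realArr 3 (by decide), U6.realArr 3 (by decide), U5.realArr 3 (by decide),
      U4.realArr 3 (by decide), U3.realArr 3 (by decide)]
  have o4 : s₁.realArr 4 = t4.realArr 4 := by
    rw [U7.realArr 4 (by decide), U6.realArr 4 (by decide), U5.realArr 4 (by decide)]
  have o5 : s₁.realArr 5 = t3.realArr 5 := by
    rw [U7.realArr 5 (by decide), U6.realArr 5 (by decide), U5.realArr 5 (by decide),
      U4.realArr 5 (by decide)]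
  have o6 : s₁.realArr 6 = t6.realArr 6 := U7.realArr 6 (by decide)
  have o7 : s₁.realArr 7 = t5.realArr 7 := by
    rw [U7.realArr 7 (by decide), U6.realArr 7 (by decide)]
  have o14 : t6.realArr 14 [] = ∑ i ∈ Finset.range m, b i * X m i (n + 1) := by
    rw [U6.realArr 14 (by decide), U5.realArr 14 (by decide), U4.realArr 14 (by decide),
      U3.realArr 14 (by decide), U2.realArr 14 (by decide), e1]
  have r3 : ∀ r ∈ [16, 17, 18, 19], t3.reg r = s.reg r := fun r hr => by
    rw [U3.reg r (by revert r; decide), U2.reg r (by revert r; decide),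
      U1.reg r (by revert r; decide)]
  have r16 : t6.reg 16 = s.reg 16 := by
    rw [U6.reg 16 (by decide), U5.reg 16 (by decide), U4.reg 16 (by decide), r3 16 (by simp)]
  refine ⟨fun j hj => ?_, fun j hj => ?_, fun i hi => ?_, fun h16 => ?_, fun h16 => ?_,
    fun h16 => ?_⟩
  · rw [o3, e2 j hj]
  · rw [o4, e4 j hj, r3 17 (by simp), r3 18 (by simp), r3 19 (by simp)]
  · rw [o5, e3 i hi]
  · obtain ⟨hroot, hno⟩ := hfix h16
    obtain ⟨hN, hD, hratio⟩ := e5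
    rw [o7, o6, o3]
    have h6 : ∀ f : ℕ → ℝ, ∑ i ∈ Finset.range m, f i * t6.realArr 6 [i] =
        t5.realArr 7 [] * (∑ i ∈ Finset.range m, f i * X m i n) +
          t5.realArr 13 [] * ∑ i ∈ Finset.range m, f i * X m i (n + 1) := by
      intro f
      rw [Finset.mul_sum, Finset.mul_sum, ← Finset.sum_add_distrib]
      refine Finset.sum_congr rfl fun i hi => ?_
      rw [e6 i (Finset.mem_range.1 hi)]
      ring
    refine ⟨hD, fun j hj => ?_, fun hz => ?_⟩
    · rw [h6 fun i => A i j]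
      have := le_of_ratio hD (sub_nonneg.2 (H.supply_farkas hG hj)) (fun h => ?_) (hratio j hj)
      · linarith
      · have := H.cost_feasible hroot hno hj (by linarith)
        linarith
    · rw [h6 b, hz, mul_zero, add_zero, ← H.primal_cost b]
      congr 1
      exact Finset.sum_congr rfl fun j hj => by rw [e2 j (Finset.mem_range.1 hj)]
  · rw [hrun, decideCase,
      run_cond_pos (show (RAMTest.natEq (.reg 16) (.const 1)).Holds t6 from r16.trans h16)]
    constructor <;> intro h
    · rw [run_cond_pos (show (RAMTest.realEq (.load 14 []) .zero).Holds t6 from o14.trans h)]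
      simp [run, NatExpr.eval]
    · rw [run_cond_neg (show ¬ (RAMTest.realEq (.load 14 []) .zero).Holds t6 from
        fun h' => h (o14.symm.trans h'))]
      simp [run, NatExpr.eval]
  · rw [hrun, decideCase, run_cond_neg (show ¬ (RAMTest.natEq (.reg 16) (.const 1)).Holds t6 by
      simp [RAMTest.Holds, NatExpr.eval, r16, h16])]
    constructor <;> intro h
    · rw [run_cond_pos (show (RAMTest.realEq (.load 14 []) .zero).Holds t6 from o14.trans h)]
      simp [run, NatExpr.eval]
    · rw [run_cond_neg (show ¬ (RAMTest.realEq (.load 14 []) .zero).Holds t6 from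
        fun h' => h (o14.symm.trans h'))]
      simp [run, NatExpr.eval]

end CountingProgram

/-! ### Certificates decide the case -/

theorem LPOutput.Certified.caseHolds {m n : ℕ} {A : Matrix (Fin m) (Fin n) ℝ} {b : Fin m → ℝ}
    {c : Fin n → ℝ} {out : LPOutput m n} (h : out.Certified A b c) : out.CaseHolds A b c := by
  have primal : ∀ {z}, PrimalFarkasCertificate A b z → ¬ ∃ x, PrimalFeasible A b x := by
    rintro z ⟨h1, h2⟩ ⟨x, h3, h4⟩
    rw [← h3, Matrix.dotProduct_mulVec] at h2
    have := dotProduct_le_dotProduct_of_nonneg_right h1 h4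
    rw [zero_dotProduct] at this
    linarith
  have dual : ∀ {r}, DualFarkasCertificate A c r → ¬ ∃ y, DualFeasible A c y := by
    rintro r ⟨h1, h2, h3⟩ ⟨y, hy⟩
    have := dotProduct_le_dotProduct_of_nonneg_right hy h3
    rw [← Matrix.dotProduct_mulVec, h1, dotProduct_zero] at this
    linarith
  cases out with
  | optimal x y => exact ⟨x, y, h⟩
  | primalInfeasible z y =>
    obtain ⟨⟨h1, h2⟩, h3⟩ := h
    refine ⟨primal ⟨h1, h2⟩, ⟨y, h3⟩, fun K => ?_⟩
    -- Moving along `z` raises the objective at the rate `z ⬝ᵥ b > 0`.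
    set t := |K - y ⬝ᵥ b| / (z ⬝ᵥ b) + 1 with ht
    have ht0 : 0 ≤ t := by positivity
    refine ⟨y + t • z, ?_, ?_⟩
    · intro j
      have h4 := h3 j
      have h5 := mul_nonpos_of_nonneg_of_nonpos ht0 (h1 j)
      rw [Matrix.add_vecMul, Matrix.smul_vecMul]
      simp only [Pi.add_apply, Pi.smul_apply, smul_eq_mul]
      linarith
    · rw [add_dotProduct, smul_dotProduct, smul_eq_mul, ht, add_mul, div_mul_cancel₀ _ h2.ne']
      have := le_abs_self (K - y ⬝ᵥ b)
      linarith
  | dualInfeasible x r =>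
    obtain ⟨⟨h1, h2⟩, h3, h4, h5⟩ := h
    refine ⟨⟨x, h1, h2⟩, fun K => ?_, dual ⟨h3, h4, h5⟩⟩
    set t := |c ⬝ᵥ x - K| / (-(c ⬝ᵥ r)) + 1 with ht
    have h6 : 0 < -(c ⬝ᵥ r) := by linarith
    have ht0 : 0 ≤ t := by positivity
    refine ⟨x + t • r, ⟨?_, ?_⟩, ?_⟩
    · rw [Matrix.mulVec_add, Matrix.mulVec_smul, h3, smul_zero, add_zero, h1]
    · exact add_nonneg h2 (smul_nonneg ht0 h5)
    · have h7 : t * -(c ⬝ᵥ r) = |c ⬝ᵥ x - K| + -(c ⬝ᵥ r) := by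
        rw [ht, add_mul, div_mul_cancel₀ _ h6.ne', one_mul]
      rw [dotProduct_add, dotProduct_smul, smul_eq_mul]
      have := le_abs_self (c ⬝ᵥ x - K)
      linarith
  | bothInfeasible z r => exact ⟨primal h.1, dual h.2⟩

/-! ### Gainfreeness in terms of closed sequences of rows -/

theorem IsGainfree.cycleWeightsGeOne {m n : ℕ} {A : Matrix (Fin m) (Fin n) ℝ} (hL : IsLeontief A)
    (hG : IsGainfree A) {B : ℕ → ℕ → ℝ}
    (hB : ∀ (i : Fin m) (j : Fin n), B i j = A i j) : CycleWeightsGeOne m n B := by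
  intro p e s t hst hp hstep hinj
  obtain ⟨k, rfl⟩ : ∃ k, t = s + k := ⟨t - s, by omega⟩
  have hk : 0 < k := by omega
  have hmem : ∀ i < k, s + i ∈ Set.Ico s (s + k) := fun i hi => ⟨by omega, by omega⟩
  have hvlt : ∀ i ≤ k, p (s + i) < m := by
    intro i hi
    rcases hi.lt_or_eq with h | rfl
    · exact (hstep _ (hmem i h)).1
    · rw [hp]
      exact (hstep _ (hmem 0 hk)).1
  let V : Fin (k + 1) → Fin m := fun i => ⟨p (s + i), hvlt i (by omega)⟩
  let E : Fin k → Fin n := fun i => ⟨e (s + i), (hstep _ (hmem i i.2)).2.1⟩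
  have htail : ∀ i : Fin k, A (V i.castSucc) (E i) < 0 := fun i => by
    rw [← hB]
    exact (hstep _ (hmem i i.2)).2.2.1
  have hhead : ∀ i : Fin k, A (V i.succ) (E i) = 1 := fun i => by
    rw [← hB]
    exact (hstep _ (hmem i i.2)).2.2.2
  have hV : Function.Injective fun i : Fin k => V i.castSucc := by
    intro i j hij
    have := hinj (hmem i i.2) (hmem j j.2) (congrArg Fin.val hij)
    exact Fin.ext (by omega)
  -- Heads are distinct as well; only the last one needs that the sequence is closed.
  have hV' : ∀ i j : Fin k, V i.succ = V j.succ → i = j := by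
    intro i j hij
    have h0 : p (s + (i + 1)) = p (s + (j + 1)) := congrArg Fin.val hij
    have hlast : ∀ i : Fin k, (i : ℕ) + 1 = k → ∀ j : Fin k, (j : ℕ) + 1 < k →
        p (s + (i + 1)) = p (s + (j + 1)) → False := by
      intro i hi j hj h
      rw [hi, hp] at h
      have := hinj (hmem 0 hk) (hmem _ hj) h
      omega
    rcases (show (i : ℕ) + 1 ≤ k from i.2).lt_or_eq with hi | hi <;>
      rcases (show (j : ℕ) + 1 ≤ k from j.2).lt_or_eq with hj | hj
    · have := hinj (hmem _ hi) (hmem _ hj) h0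
      exact Fin.ext (by omega)
    · exact (hlast j hj i hi h0.symm).elim
    · exact (hlast i hi j hj h0).elim
    · exact Fin.ext (by omega)
  let C : (associatedHypergraph A).DirectedCycle :=
    { length := k
      length_pos := hk
      vertex := V
      arc := E
      closed := Fin.ext hp.symm
      vertex_injective := hV
      arc_injective := fun i j hij => hV' i j
        (hL (E i) _ _ (by rw [hhead]; norm_num) (by rw [hij, hhead]; norm_num))
      head_eq := fun i => by
        ext v
        refine ⟨fun hv => hL (E i) _ _ ?_ ?_, ?_⟩
        · rw [show A v (E i) = 1 from hv]; norm_num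
        · rw [hhead]; norm_num
        · rintro rfl
          exact hhead i
      mem_tail := htail }
  have hpos : 0 < ∏ i : Fin k, -A (V i.castSucc) (E i) :=
    Finset.prod_pos fun i _ => neg_pos.2 (htail i)
  have hgain : 1 / ∏ i : Fin k, -A (V i.castSucc) (E i) ≤ 1 := hG C
  rw [div_le_one hpos] at hgain
  refine hgain.trans_eq ?_
  rw [Finset.prod_Ico_eq_prod_range, show s + k - s = k by omega, Finset.prod_range]
  exact Finset.prod_congr rfl fun i _ => by rw [← hB]; rfl

/-! ### The algorithm on an input -/

/-- The program sets the parameter registers, runs the algorithm and reports the case. -/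
def leontiefProgram : RAMProgram :=
  .seq (.setReg 2 (.add (.reg 0) (.const 1))) (.seq (.setReg 3 (.add (.reg 1) (.const 2)))
    (.seq (.setReg 4 (.add (.reg 1) (.const 1))) (.seq CountingProgram.leontief.compile
      (.setReg 0 (.reg 25)))))

/-- The configuration after the parameter registers have been set. -/
noncomputable def RAMState.inputWithParams {m n : ℕ} (A : Matrix (Fin m) (Fin n) ℝ)
    (b : Fin m → ℝ) (c : Fin n → ℝ) : RAMState :=
  (((RAMState.input A b c).setReg 2 (m + 1)).setReg 3 (n + 2)).setReg 4 (n + 1)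

theorem RAMState.inputWithParams_hasParams {m n : ℕ} (A : Matrix (Fin m) (Fin n) ℝ)
    (b : Fin m → ℝ) (c : Fin n → ℝ) :
    CountingProgram.HasParams m n (RAMState.inputWithParams A b c) :=
  ⟨rfl, rfl, rfl, rfl, rfl, rfl⟩

theorem leontiefProgram_exec {m n : ℕ} (hm : 0 < m) (hn : 0 < n) (A : Matrix (Fin m) (Fin n) ℝ)
    (b : Fin m → ℝ) (c : Fin n → ℝ) : ∃ t ≤ 2620 * (m ^ 3 * n),
    RAMExec leontiefProgram (RAMState.input A b c)
      ((CountingProgram.leontief.run (RAMState.inputWithParams A b c)).setReg 0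
        ((CountingProgram.leontief.run (RAMState.inputWithParams A b c)).reg 25)) t := by
  have hp := RAMState.inputWithParams_hasParams A b c
  obtain ⟨t, ht, hexec⟩ := CountingProgram.exec_compile CountingProgram.leontief_wellFormed
    (RAMState.inputWithParams A b c).reg _ fun _ _ => rfl
  have htime := CountingProgram.leontief_timeBound hm hn hp.reg0 hp.reg1 hp.reg2 hp.reg3
  have hpos : 0 < m ^ 3 * n := by positivity
  refine ⟨4 + (4 + (4 + (t + 2))), by omega, .seq (.setReg 2 _ _) (.seq (.setReg 3 _ _)
    (.seq (.setReg 4 _ _) (.seq hexec (.setReg 0 (.reg 25) _))))⟩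

/-- The Bellman–Ford iteration on an input, together with everything that the later parts of the
algorithm need. -/
theorem iteration_trace {m n : ℕ} {A : Matrix (Fin m) (Fin n) ℝ} {b : Fin m → ℝ}
    {c : Fin n → ℝ} (hL : IsLeontief A) (hU : HasUnitPositiveEntries A) {s : RAMState}
    (hs : s = (.seq CountingProgram.rootRow (.seq CountingProgram.initSupply
      CountingProgram.iteration) : CountingProgram).run (RAMState.inputWithParams A b c)) :
    CountingProgram.HasParams m n s ∧
    BellmanFordTrace m n (fun i j => s.realArr 0 [i, j]) (fun j => s.realArr 2 [j])
      (fun t v l => s.realArr 8 [t, v, l]) (fun t v => s.natArr 0 [t, v])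
      (fun t v => s.natArr 1 [t, v]) ∧
    (∀ (i : Fin m) (j : Fin n), s.realArr 0 [(i : ℕ), (j : ℕ)] = A i j) ∧
    (∀ i : Fin m, s.realArr 1 [(i : ℕ)] = b i) ∧ ∀ j : Fin n, s.realArr 2 [(j : ℕ)] = c j := by
  open CountingProgram in
  set s₀ := RAMState.inputWithParams A b c with hs₀
  have p₀ : HasParams m n s₀ := RAMState.inputWithParams_hasParams A b c
  have U₁ := rootRow.unchanged_run s₀
  obtain ⟨e1, e1'⟩ := rootRow_spec p₀ rfl
  set s₁ := rootRow.run s₀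
  have p₁ : HasParams m n s₁ := p₀.unchanged U₁ (by decide)
  have U₂ := initSupply.unchanged_run s₁
  have e2 := initSupply_spec p₁ rfl
  set s₂ := initSupply.run s₁
  have p₂ : HasParams m n s₂ := p₁.unchanged U₂ (by decide)
  have U₃ := iteration.unchanged_run s₂
  obtain ⟨e3, e3'⟩ := iteration_spec p₂ (s₁ := s) hs
  rw [show iteration.run s₂ = s from hs.symm] at U₃
  have hA : ∀ (i : Fin m) (j : Fin n), s₀.realArr 0 [(i : ℕ), (j : ℕ)] = A i j := by
    intro i j
    simp [hs₀, RAMState.inputWithParams, RAMState.input]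
  have hz : ∀ v l, s₀.realArr 8 [0, v, l] = 0 := fun v l => rfl
  have h0 : s.realArr 0 = s₁.realArr 0 :=
    (U₃.realArr 0 (by decide)).trans (U₂.realArr 0 (by decide))
  have hrow : ∀ i < m, ∀ j < n, ∃ (i' : Fin m) (j' : Fin n), (i' : ℕ) = i ∧ (j' : ℕ) = j ∧
      s₀.realArr 0 [i, j] = A i' j' ∧ s.realArr 0 [i, j] = A i' j' := by
    intro i hi j hj
    refine ⟨⟨i, hi⟩, ⟨j, hj⟩, rfl, rfl, hA ⟨i, hi⟩ ⟨j, hj⟩, ?_⟩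
    rw [h0, e1' i j hi.ne]
    exact hA ⟨i, hi⟩ ⟨j, hj⟩
  have hroot : ∀ j < n, s.realArr 0 [m, j] =
      if ∃ i < m, 0 < s.realArr 0 [i, j] then 0 else 1 := by
    classical
    intro j hj
    rw [h0, e1 j hj]
    congr 1
    refine propext (exists_congr fun i => and_congr_right fun hi => ?_)
    rw [e1' i j hi.ne]
  refine ⟨p₂.unchanged U₃ (by decide), ⟨?_, ?_, ?_, ?_, ?_⟩, ?_, ?_, ?_⟩
  · intro j hj v hv hv1 k hk hkv
    rcases hv.lt_or_eq with hv | rfl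
    · obtain ⟨v', j', rfl, rfl, -, hv'⟩ := hrow v hv j hj
      rcases hk.lt_or_eq with hk | rfl
      · obtain ⟨k', j'', rfl, hj'', -, hk'⟩ := hrow k hk j' hj
        obtain rfl := Fin.ext hj''
        by_contra! hpos
        refine hkv (congrArg Fin.val (hL j'' k' v' ?_ ?_))
        · rw [← hk']; exact hpos
        · rw [← hv']; exact hv1 ▸ one_pos
      · rw [hroot j' hj, if_pos ⟨v', v'.2, hv1 ▸ one_pos⟩]
    · have hk : k < v := lt_of_le_of_ne hk hkv
      by_contra! hpos
      change s.realArr 0 [v, j] = 1 at hv1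
      rw [hroot j hj, if_pos ⟨k, hk, hpos⟩] at hv1
      exact zero_ne_one hv1
  · intro j hj
    by_cases h : ∃ i < m, 0 < s.realArr 0 [i, j]
    · obtain ⟨i, hi, hpos⟩ := h
      obtain ⟨i', j', -, -, -, hi'⟩ := hrow i hi j hj
      refine ⟨i, hi.le, ?_⟩
      rw [hi'] at hpos ⊢
      exact hU i' j' hpos
    · refine ⟨m, le_rfl, ?_⟩
      rw [hroot j hj, if_neg h]
  · intro j hj
    rw [hroot j hj]
    split_ifs <;> norm_num
  · intro v hv l hl
    rw [e3' v l, e2 v l, U₁.realArr 8 (by decide), hz]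
  · exact e3
  · intro i j
    rw [h0, e1' i j i.2.ne]
    exact hA i j
  · intro i
    rw [U₃.realArr 1 (by decide), U₂.realArr 1 (by decide), U₁.realArr 1 (by decide)]
    simp [hs₀, RAMState.inputWithParams, RAMState.input]
  · intro j
    rw [U₃.realArr 2 (by decide), U₂.realArr 2 (by decide), U₁.realArr 2 (by decide)]
    simp [hs₀, RAMState.inputWithParams, RAMState.input]

theorem leontief_correct {m n : ℕ} (A : Matrix (Fin m) (Fin n) ℝ) (b : Fin m → ℝ)
    (c : Fin n → ℝ) (hL : IsLeontief A) (hU : HasUnitPositiveEntries A) (hG : IsGainfree A)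
    (hb : 0 ≤ b) {T s : RAMState}
    (hT : T = CountingProgram.leontief.run (RAMState.inputWithParams A b c))
    (hs : s = T.setReg 0 (T.reg 25)) :
    ∃ out : LPOutput m n, s.Presents out ∧ out.Certified A b c := by
  open CountingProgram in
  set s₁ := (.seq rootRow (.seq initSupply iteration) : CountingProgram).run
    (RAMState.inputWithParams A b c) with hs₁
  obtain ⟨p₁, H, hA, hbs, hcs⟩ := iteration_trace hL hU hs₁
  have hcyc := hG.cycleWeightsGeOne hL (B := fun i j => s₁.realArr 0 [i, j]) hA
  have hray := findRay_spec p₁ H hcyc (fun _ _ => rfl) (fun _ _ => rfl) (fun _ _ => rfl)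
    (fun _ _ _ => rfl) rfl
  have U₂ := findRay.unchanged_run s₁
  set s₂ := findRay.run s₁
  have p₂ : HasParams m n s₂ := p₁.unchanged U₂ (by decide)
  obtain ⟨w3, w4, w5, w6, w7, w8⟩ := writeOutput_spec p₂ (b := fun i => s₁.realArr 1 [i]) H hcyc
    (fun k j => by rw [U₂.realArr 0 (by decide)]) (fun i => by rw [U₂.realArr 1 (by decide)])
    (fun j => by rw [U₂.realArr 2 (by decide)]) (fun t v l => by rw [U₂.realArr 8 (by decide)])
    (fun h => (hray.resolve_left fun h' => by omega).2) (s₁ := T) hT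
  have hb' : ∀ i < m, 0 ≤ s₁.realArr 1 [i] := fun i hi => by
    rw [hbs ⟨i, hi⟩]
    exact hb ⟨i, hi⟩
  set Z := ∑ i ∈ Finset.range m, s₁.realArr 1 [i] * s₁.realArr 8 [m, i, n + 1] with hZ
  have hZ0 : 0 ≤ Z := Finset.sum_nonneg fun i hi => mul_nonneg (hb' i (Finset.mem_range.1 hi))
    (H.artificial_total_nonneg (by omega) (Finset.mem_range.1 hi).le)
  -- The certificates as vectors.
  let x : Fin n → ℝ := fun j => T.realArr 3 [(j : ℕ)]
  let r : Fin n → ℝ := fun j => T.realArr 4 [(j : ℕ)]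
  let z : Fin m → ℝ := fun i => T.realArr 5 [(i : ℕ)]
  let y : Fin m → ℝ := fun i => T.realArr 6 [(i : ℕ)] / T.realArr 7 []
  have hx : Z = 0 → PrimalFeasible A b x := by
    intro h
    constructor
    · ext i
      have := H.primal_of_supply_eq_zero hb' h i.2
      rw [hbs, Finset.sum_range] at this
      rw [← this]
      change ∑ j, A i j * x j = _
      refine Finset.sum_congr rfl fun j _ => ?_
      rw [hA]
      exact congrArg _ (w3 j j.2)
    · intro j
      change 0 ≤ T.realArr 3 [(j : ℕ)]
      rw [w3 j j.2]
      exact Finset.sum_nonneg fun i hi => mul_nonneg (hb' i (Finset.mem_range.1 hi))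
        (H.flow_nonneg (by omega) (Finset.mem_range.1 hi).le j.2)
  have hz : Z ≠ 0 → PrimalFarkasCertificate A b z := by
    intro h
    constructor
    · intro j
      refine le_trans (le_of_eq ?_) (H.supply_farkas hcyc j.2)
      rw [Finset.sum_range]
      change ∑ i, z i * A i j = _
      refine Finset.sum_congr rfl fun i _ => ?_
      rw [hA, mul_comm]
      exact congrArg _ (w5 i i.2)
    · refine lt_of_lt_of_eq (lt_of_le_of_ne hZ0 h.symm) ?_
      rw [hZ, Finset.sum_range]
      refine Finset.sum_congr rfl fun i _ => ?_
      rw [hbs, mul_comm]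
      exact congrArg (· * b i) (w5 i i.2).symm
  have hr : s₂.reg 16 = 1 → DualFarkasCertificate A c r := by
    intro h
    obtain ⟨-, h1, h2, h3⟩ := hray.resolve_right fun h' => by omega
    refine ⟨?_, ?_, fun j => ?_⟩
    · ext i
      have := h1 i i.2
      rw [Finset.sum_range] at this
      rw [Pi.zero_apply, ← this]
      change ∑ j, A i j * r j = _
      refine Finset.sum_congr rfl fun j _ => ?_
      rw [hA]
      exact congrArg _ (w4 j j.2)
    · refine lt_of_eq_of_lt ?_ h2
      rw [Finset.sum_range]
      refine Finset.sum_congr rfl fun j _ => ?_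
      rw [hcs]
      exact congrArg _ (w4 j j.2)
    · exact (h3 j j.2).trans_eq (w4 j j.2).symm
  have hy : s₂.reg 16 = 0 → DualFeasible A c y := by
    intro h j
    obtain ⟨h1, h2, -⟩ := w6 h
    have h3 := h2 j j.2
    rw [Finset.sum_range, hcs] at h3
    refine le_of_mul_le_mul_left (le_trans (le_of_eq ?_) h3) h1
    change T.realArr 7 [] * ∑ i, y i * A i j = _
    rw [Finset.mul_sum]
    refine Finset.sum_congr rfl fun i _ => ?_
    rw [hA, ← mul_assoc, mul_comm]
    exact congrArg _ (mul_div_cancel₀ _ h1.ne')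
  have hopt : s₂.reg 16 = 0 → Z = 0 → c ⬝ᵥ x = y ⬝ᵥ b := by
    intro h hZ
    obtain ⟨h1, -, h3⟩ := w6 h
    have h4 := h3 hZ
    rw [Finset.sum_range, Finset.sum_range] at h4
    refine mul_left_cancel₀ h1.ne' (Eq.trans ?_ (h4.symm.trans ?_))
    · refine congrArg _ (Finset.sum_congr rfl fun j _ => ?_)
      rw [hcs]
    · change _ = T.realArr 7 [] * ∑ i, y i * b i
      rw [Finset.mul_sum]
      refine Finset.sum_congr rfl fun i _ => ?_
      rw [hbs, ← mul_assoc, mul_comm]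
      exact congrArg (· * b i) (mul_div_cancel₀ _ h1.ne').symm
  have hfrac : s₂.reg 16 = 0 → s.HoldsFraction 6 7 y := by
    intro h
    obtain ⟨h1, -, -⟩ := w6 h
    rw [hs]
    exact ⟨h1, fun i => (mul_div_cancel₀ _ h1.ne').symm⟩
  have hs0 : s.reg 0 = T.reg 25 := by rw [hs]; rfl
  have hxs : s.HoldsVector 3 x := fun j => by rw [hs]; rfl
  have hrs : s.HoldsVector 4 r := fun j => by rw [hs]; rfl
  have hzs : s.HoldsVector 5 z := fun j => by rw [hs]; rfl
  rcases hray with ⟨h16, -⟩ | ⟨h16, -⟩ <;> by_cases hZ' : Z = 0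
  · exact ⟨.dualInfeasible x r, ⟨hs0.trans ((w7 h16).1 hZ'), hxs, hrs⟩, hx hZ', hr h16⟩
  · exact ⟨.bothInfeasible z r, ⟨hs0.trans ((w7 h16).2 hZ'), hzs, hrs⟩, hz hZ', hr h16⟩
  · exact ⟨.optimal x y, ⟨hs0.trans ((w8 h16).1 hZ'), hxs, hfrac h16⟩, hx hZ', hy h16,
      hopt h16 hZ'⟩
  · exact ⟨.primalInfeasible z y, ⟨hs0.trans ((w8 h16).2 hZ'), hzs, hfrac h16⟩, hz hZ', hy h16⟩

theorem mainTheorem1 :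
    ∃ (P : RAMProgram) (K : ℕ), ∀ (m n : ℕ), 0 < m → 0 < n →
      ∀ (A : Matrix (Fin m) (Fin n) ℝ) (b : Fin m → ℝ) (c : Fin n → ℝ),
        IsLeontief A → HasUnitPositiveEntries A → IsGainfree A → 0 ≤ b →
        ∃ (s : RAMState) (t : ℕ) (out : LPOutput m n),
          RAMExec P (RAMState.input A b c) s t ∧ t ≤ K * (m ^ 3 * n) ∧
          s.Presents out ∧ out.CaseHolds A b c ∧ out.Certified A b c := by
  refine ⟨leontiefProgram, 2620, fun m n hm hn A b c hL hU hG hb => ?_⟩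
  obtain ⟨t, ht, hexec⟩ := leontiefProgram_exec hm hn A b c
  obtain ⟨out, hout, hcert⟩ := leontief_correct A b c hL hU hG hb rfl rfl
  exact ⟨_, t, out, hexec, ht, hout, hcert.caseHolds, hcert⟩
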